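/- **Setting.** Let $\mathcal H$ be a separable complex Hilbert space and $H\ge 0$ a self-adjoint operator on $\mathcal H$ with a unit vector $\Omega$ such that $H\Omega=0$ and $H\ge 1$ on $\{\mathbb C\Omega\}^\perp$. On $\mathcal H^{(N)}=\mathcal H^{\otimes N}$ let $H_i$ be the copy of $H$ at site $i\in\{1,\dots,N\}$, and for an interval $I_{r,i}=\{i,\dots,i+r\}\subseteq\{1,\dots,N\}$ put $H^0_{I_{r,i}}=\sum_{j=i}^{i+r}H_j$. Let $P^{(-)}_{I}$ be the orthogonal projection $\bigotimes_{j\in I}P_{\Omega_j}$ (identity on the other sites) and $P^{(+)}_I=1-P^{(-)}_I$. A *potential supported on $I$* is a symmetric sesquilinear form $V$ on $D((H^0_I)^{1/2})$ that acts as the identity on the sites outside $I$; its weighted norm is $\|V\|_{H^0}=\|(H^0_I+1)^{-1/2}V(H^0_I+1)^{-1/2}\|$. The same norm, with weight $H^0_{I_{k,q}}$, is used for all forms on $D((H^0_{I_{k,q}})^{1/2})$ below. Fix $N$, $k\ge1$, $q\ge1$ with $q+k\le N$, and $t>0$. For each $I_{r,i}\subseteq I_{k,q}$ with $r\ge1$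 let $V_{I_{r,i}}$ (the potential before the block-diagonalization step $(k,q)$, i.e. $V^{(k,q-1)}_{I_{r,i}}$, or $V^{(k-1,N-k+1)}_{I_{r,i}}$ if $q=1$) be a potential supported on $I_{r,i}$, which for $r<k$ is block-diagonal: $V_{I_{r,i}}=P^{(+)}_{I_{r,i}}V_{I_{r,i}}P^{(+)}_{I_{r,i}}+P^{(-)}_{I_{r,i}}V_{I_{r,i}}P^{(-)}_{I_{r,i}}$. Write $V=V_{I_{k,q}}$, $P^{(\pm)}=P^{(\pm)}_{I_{k,q}}$, $H^0=H^0_{I_{k,q}}$, and, in the sense of forms on $D((H^0)^{1/2})$, $$G=H^0+t\sum_{r=1}^{k-1}\ \sum_{I_{r,i}\subset I_{k,q}}V_{I_{r,i}},\qquad E=t\sum_{r=1}^{k-1}\ \sum_{I_{r,i}\subset I_{k,q}}\langle \Omega^{\otimes N},V_{I_{r,i}}\,\Omega^{\otimes N}\rangle .$$ Define recursively, with $\mathrm{ad}\,A(B)=[A,B]$: $V_1=V$; for $j\ge 1$, $$S_j=\frac1{G-E}P^{(+)}V_jP^{(-)}-h.c.;$$ and for $j\ge2$ $$V_j=\sum_{\substack{p\ge2,\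 r_1,\dots,r_p\ge1\\ r_1+\dots+r_p=j}}\frac1{p!}\,\mathrm{ad}\,S_{r_1}\big(\cdots\mathrm{ad}\,S_{r_p}(G)\cdots\big)+\sum_{\substack{p\ge1,\ r_1,\dots,r_p\ge1\\ r_1+\dots+r_p=j-1}}\frac1{p!}\,\mathrm{ad}\,S_{r_1}\big(\cdots\mathrm{ad}\,S_{r_p}(V)\cdots\big).$$ Here $(G-E)^{-1}P^{(+)}V_jP^{(-)}$ is the bounded operator $T$ with $T\psi\in D((H^0)^{1/2})$, $P^{(-)}T\psi=0$ and $\langle\varphi,(G-E)T\psi\rangle=\langle\varphi,V_jP^{(-)}\psi\rangle$ for all $\psi$ and all $\varphi\in D((H^0)^{1/2})$ with $P^{(-)}\varphi=0$. For a form $F$ put $F^{diag}=P^{(+)}FP^{(+)}+P^{(-)}FP^{(-)}$. **Lemma.** There are universal constants $t_0,A,B>0$ (independent of $\mathcal H,H,\Omega,N,k,q$ and the potentials) such that the following holds for $0<t<t_0$. Assume that $\|V_{I_{r,i}}\|_{H^0}\le t^{\frac{r-1}4}$ for all $I_{r,i}\subseteq I_{k,q}$, $r\ge1$, and that the gap of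 $G$ above $E$ is at least $\tfrac12$, i.e. $P^{(+)}GP^{(+)}\ge(E+\tfrac12)P^{(+)}$ in the sense of forms. Then all $V_j$ are well-defined symmetric forms on $D((H^0)^{1/2})$ with $\|V_j\|_{H^0}<\infty$, and for every $j$ the operator $(G-E)^{-1}P^{(+)}V_jP^{(-)}$ exists and is unique, so that $S_j$ is a well-defined bounded operator. The series $$S=\sum_{j\ge1}t^jS_j,\qquad V'=\sum_{j\ge1}t^{j-1}V_j^{diag}$$ (that is, $S_{I_{k,q}}$ and $V^{(k,q)}_{I_{k,q}}$) converge absolutely in operator norm and in $\|\cdot\|_{H^0}$, respectively, $V'$ is a symmetric form on $D((H^0)^{1/2})$, and $$\|V'\|_{H^0}\le2\|V\|_{H^0},\qquad \|S\|\le A\,t\,\|V\|_{H^0},\qquad \|S(H^0+1)^{1/2}\|=\|(H^0+1)^{1/2}S\|\le B\,t\,\|V\|_{H^0}.$$ In particular $S$ maps $\mathcal H^{(N)}$ into $D((H^0)^{1/2})$, and $S(H^0+1)^{1/2}$ extends from $D((H^0)^{1/2})$ to a bounded operator. -/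

import Mathlib

open scoped InnerProductSpace ENNReal Matrix

noncomputable section

namespace QuantumChain

/-! ### The Hilbert space of a chain of `N` sites

The Hilbert tensor product of `N` copies of `ℋ`: formal linear combinations of tuples
`x = (x₁, …, x_N)` (standing for `x₁ ⊗ ⋯ ⊗ x_N`) carry the positive semidefinite inner product
determined by `⟪x, y⟫ = ∏ⱼ ⟪xⱼ, yⱼ⟫`; null vectors are divided out and the result is completed. -/

section Chain

variable (N : ℕ) (ℋ : Type*) [NormedAddCommGroup ℋ] [InnerProductSpace ℂ ℋ]

/-- The Gram matrix of the pure tensors. -/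
def tensorKernel : Matrix (Fin N → ℋ) (Fin N → ℋ) ℂ :=
  Matrix.of fun x y => ∏ j, ⟪x j, y j⟫_ℂ

open scoped ComplexOrder in
theorem gram_posSemidef {X E : Type*} [NormedAddCommGroup E] [InnerProductSpace ℂ E] (v : X → E) :
    (Matrix.gram ℂ v).PosSemidef := by
  refine ⟨Matrix.isHermitian_gram ℂ v, fun c => ?_⟩
  have h : (c.sum fun i ci => c.sum fun j cj => star ci * Matrix.gram ℂ v i j * cj) =
      ⟪c.sum fun i ci => ci • v i, c.sum fun i ci => ci • v i⟫_ℂ := by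
    simp only [Finsupp.sum, sum_inner]
    refine Finset.sum_congr rfl fun i _ => ?_
    rw [inner_sum]
    refine Finset.sum_congr rfl fun j _ => ?_
    simp only [inner_smul_left, inner_smul_right, Matrix.gram_apply, RCLike.star_def]
    ring
  rw [h]
  exact Complex.nonneg_iff.2 ⟨inner_self_nonneg (𝕜 := ℂ), (inner_self_im (𝕜 := ℂ) _).symm⟩

open scoped ComplexOrder in
theorem tensorKernel_posSemidef : (tensorKernel N ℋ).PosSemidef := by
  have key : ∀ s : Finset (Fin N),
      (Matrix.of fun x y : Fin N → ℋ => ∏ j ∈ s, ⟪x j, y j⟫_ℂ).PosSemidef := by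
    intro s
    induction s using Finset.cons_induction with
    | empty =>
      have h := gram_posSemidef (fun _ : Fin N → ℋ => (1 : ℂ))
      have e : (Matrix.of fun x y : Fin N → ℋ => ∏ j ∈ (∅ : Finset (Fin N)), ⟪x j, y j⟫_ℂ) =
          Matrix.gram ℂ (fun _ : Fin N → ℋ => (1 : ℂ)) := by
        ext x y
        simp [Matrix.gram_apply]
      rw [e]
      exact h
    | cons a s ha ih =>
      have h := (gram_posSemidef (fun x : Fin N → ℋ => x a)).hadamard ih
      have e : (Matrix.of fun x y : Fin N → ℋ => ∏ j ∈ Finset.cons a s ha, ⟪x j, y j⟫_ℂ) =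
          (Matrix.gram ℂ (fun x : Fin N → ℋ => x a)) ⊙
            (Matrix.of fun x y : Fin N → ℋ => ∏ j ∈ s, ⟪x j, y j⟫_ℂ) := by
        ext x y
        simp only [Matrix.of_apply, Matrix.hadamard_apply, Matrix.gram_apply, Finset.prod_cons]
      rw [e]
      exact h
  exact key Finset.univ

/-- Formal linear combinations of pure tensors. -/
def PreChain : Type _ := (Fin N → ℋ) →₀ ℂ

instance : AddCommGroup (PreChain N ℋ) := inferInstanceAs (AddCommGroup ((Fin N → ℋ) →₀ ℂ))
instance : Module ℂ (PreChain N ℋ) := inferInstanceAs (Module ℂ ((Fin N → ℋ) →₀ ℂ))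

/-- The formal pure tensor `x₁ ⊗ ⋯ ⊗ x_N`. -/
def preTensor {N : ℕ} {ℋ : Type*} (x : Fin N → ℋ) : PreChain N ℋ :=
  Finsupp.single x (1 : ℂ)

/-- The sesquilinear extension of `⟪x, y⟫ = ∏ⱼ ⟪xⱼ, yⱼ⟫`. -/
def preInner (f g : (Fin N → ℋ) →₀ ℂ) : ℂ :=
  f.sum fun x a => g.sum fun y b => star a * tensorKernel N ℋ x y * b

open scoped ComplexOrder in
theorem preInner_conj (f g : (Fin N → ℋ) →₀ ℂ) :
    star (preInner N ℋ g f) = preInner N ℋ f g := by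
  unfold preInner
  simp only [Finsupp.sum, star_sum]
  rw [Finset.sum_comm]
  refine Finset.sum_congr rfl fun x _ => Finset.sum_congr rfl fun y _ => ?_
  have h : star (tensorKernel N ℋ y x) = tensorKernel N ℋ x y :=
    (tensorKernel_posSemidef N ℋ).isHermitian.apply x y
  simp only [star_mul', star_star, h]
  ring

open scoped ComplexOrder in
theorem preInner_re_nonneg (f : (Fin N → ℋ) →₀ ℂ) : 0 ≤ (preInner N ℋ f f).re :=
  (Complex.nonneg_iff.1 ((tensorKernel_posSemidef N ℋ).2 f)).1

theorem preInner_add (f g h : (Fin N → ℋ) →₀ ℂ) :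
    preInner N ℋ (f + g) h = preInner N ℋ f h + preInner N ℋ g h := by
  unfold preInner
  refine Finsupp.sum_add_index' ?_ ?_
  · intro x
    simp [Finsupp.sum]
  · intro x a b
    rw [← Finsupp.sum_add]
    simp [Finsupp.sum, add_mul]

theorem preInner_smul (r : ℂ) (f g : (Fin N → ℋ) →₀ ℂ) :
    preInner N ℋ (r • f) g = star r * preInner N ℋ f g := by
  unfold preInner
  rw [Finsupp.sum_smul_index (by simp [Finsupp.sum])]
  simp only [Finsupp.mul_sum]
  simp [Finsupp.sum, mul_assoc]

instance instCorePreChain : PreInnerProductSpace.Core ℂ (PreChain N ℋ) where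
  inner f g := preInner N ℋ f g
  conj_inner_symm f g := preInner_conj N ℋ f g
  re_inner_nonneg f := preInner_re_nonneg N ℋ f
  add_left f g h := preInner_add N ℋ f g h
  smul_left f g r := preInner_smul N ℋ r f g

instance : SeminormedAddCommGroup (PreChain N ℋ) :=
  InnerProductSpace.Core.toSeminormedAddCommGroup (𝕜 := ℂ)

instance : InnerProductSpace ℂ (PreChain N ℋ) := InnerProductSpace.ofCore _

/-- The Hilbert space `ℋ ⊗ ⋯ ⊗ ℋ` (`N` factors) of the chain. -/
abbrev Chain : Type _ := UniformSpace.Completion (PreChain N ℋ)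

variable {N ℋ}

/-- The pure tensor `x₁ ⊗ ⋯ ⊗ x_N`. -/
def tensor (x : Fin N → ℋ) : Chain N ℋ := ((preTensor x : PreChain N ℋ) : Chain N ℋ)

theorem inner_tensor (x y : Fin N → ℋ) :
    ⟪tensor x, tensor y⟫_ℂ = ∏ j, ⟪x j, y j⟫_ℂ := by
  unfold tensor
  rw [UniformSpace.Completion.inner_coe]
  change preInner N ℋ (Finsupp.single x 1) (Finsupp.single y 1) = _
  simp [preInner, tensorKernel]

theorem dense_span_tensor :
    Dense (Submodule.span ℂ (Set.range (tensor : (Fin N → ℋ) → Chain N ℋ)) :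
      Set (Chain N ℋ)) := by
  have hsub : Set.range ((↑) : PreChain N ℋ → Chain N ℋ) ⊆
      (Submodule.span ℂ (Set.range (tensor : (Fin N → ℋ) → Chain N ℋ)) : Set (Chain N ℋ)) := by
    rintro _ ⟨f, rfl⟩
    induction f using Finsupp.induction_linear with
    | zero => exact Submodule.zero_mem _
    | add f g hf hg =>
      have e := UniformSpace.Completion.coe_add (α := PreChain N ℋ) f g
      exact (congrArg (· ∈ Submodule.span ℂ
        (Set.range (tensor : (Fin N → ℋ) → Chain N ℋ))) e).mpr (Submodule.add_mem _ hf hg)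
    | single x a =>
      have e := UniformSpace.Completion.coe_smul a (preTensor x : PreChain N ℋ)
      have h : a • (preTensor x : PreChain N ℋ) = (Finsupp.single x a : (Fin N → ℋ) →₀ ℂ) := by
        change a • (Finsupp.single x (1 : ℂ)) = _
        simp
      rw [h] at e
      exact (congrArg (· ∈ Submodule.span ℂ
        (Set.range (tensor : (Fin N → ℋ) → Chain N ℋ))) e).mpr
        (Submodule.smul_mem _ a (Submodule.subset_span (Set.mem_range_self x)))
  exact (UniformSpace.Completion.denseRange_coe).mono hsub

end Chain

/-! ### Nonnegative operators, their form domains and weighted norms -/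

section Forms

variable {K : Type*} [NormedAddCommGroup K] [InnerProductSpace ℂ K] [CompleteSpace K]

/-- `R` is a nonnegative bounded operator with `R² = (A + 1)⁻¹`, i.e. for every `y` the vector
`R² y` lies in the domain of `A` and `A R² y = y - R² y`. -/
def IsInvSqrt (A : K →ₗ.[ℂ] K) (R : K →L[ℂ] K) : Prop :=
  R.IsPositive ∧ ∀ y, (R (R y), y - R (R y)) ∈ A.graph

open Classical in
/-- The bounded operator `(A + 1)^{-1/2}` (for `A` self-adjoint and nonnegative). -/
def invSqrt (A : K →ₗ.[ℂ] K) : K →L[ℂ] K :=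
  if h : ∃ R, IsInvSqrt A R then h.choose else 0

/-- The operator `(A + 1)^{1/2}`, the inverse of `(A + 1)^{-1/2}`. -/
def sqrtOp (A : K →ₗ.[ℂ] K) : K →ₗ.[ℂ] K :=
  ((invSqrt A : K →ₗ[ℂ] K).toPMap ⊤).inverse

/-- The form domain `D((A + 1)^{1/2}) = D(A^{1/2})`. -/
def formDomain (A : K →ₗ.[ℂ] K) : Submodule ℂ K := (sqrtOp A).domain

/-- A form `F` is recorded by its matrix elements `F φ ψ = ⟨φ, F ψ⟩`; only the values on a form
domain matter. -/
abbrev Form (K : Type*) := K → K → ℂ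

/-- `F` is a symmetric sesquilinear form on the subspace `Q`
(linear in the second, conjugate linear in the first variable). -/
structure IsSymmForm (Q : Submodule ℂ K) (F : Form K) : Prop where
  add_right : ∀ φ ∈ Q, ∀ ψ ∈ Q, ∀ χ ∈ Q, F φ (ψ + χ) = F φ ψ + F φ χ
  smul_right : ∀ φ ∈ Q, ∀ ψ ∈ Q, ∀ c : ℂ, F φ (c • ψ) = c * F φ ψ
  symm : ∀ φ ∈ Q, ∀ ψ ∈ Q, F φ ψ = star (F ψ φ)

/-- The form `⟨φ, A ψ⟩` of `A` on its form domain,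
`⟨(A + 1)^{1/2} φ, (A + 1)^{1/2} ψ⟩ - ⟨φ, ψ⟩`. -/
def kineticForm (A : K →ₗ.[ℂ] K) : Form K := fun φ ψ =>
  open Classical in
  if h : φ ∈ formDomain A ∧ ψ ∈ formDomain A then
    ⟪sqrtOp A ⟨φ, h.1⟩, sqrtOp A ⟨ψ, h.2⟩⟫_ℂ - ⟪φ, ψ⟫_ℂ
  else 0

/-- The weighted norm `‖(A + 1)^{-1/2} F (A + 1)^{-1/2}‖`, with value `∞` if this operator is
unbounded. -/
def weightedNorm (A : K →ₗ.[ℂ] K) (F : Form K) : ℝ≥0∞ :=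
  ⨆ (φ : K) (_ : ‖φ‖ ≤ 1) (ψ : K) (_ : ‖ψ‖ ≤ 1), ‖F (invSqrt A φ) (invSqrt A ψ)‖ₑ

/-- The block-diagonal part `P⁺ F P⁺ + P⁻ F P⁻`, where `P⁻ = P` and `P⁺ = 1 - P`. -/
def diagPart (P : K →L[ℂ] K) (F : Form K) : Form K := fun φ ψ =>
  F (φ - P φ) (ψ - P ψ) + F (P φ) (P ψ)

/-- The form of the commutator `ad S (F) = [S, F] = S F - F S`. -/
def adForm (S : K →L[ℂ] K) (F : Form K) : Form K := fun φ ψ =>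
  F (S.adjoint φ) ψ - F φ (S ψ)

/-! ### The Lie–Schwinger series

Data: a free Hamiltonian `A`, the vacuum projection `P = P⁻` (with `P⁺ = 1 - P`), the form `g` of
the unperturbed Hamiltonian `G` on the form domain of `A`, its ground-state energy `E`, and the
perturbation `V`. -/

/-- `T = (G - E)⁻¹ P⁺ F P⁻` in the sense of forms: for every `ψ`, the vector `χ = T ψ` of the
form domain satisfies `P⁺ χ = χ` and `⟨φ, (G - E) χ⟩ = ⟨φ, F P⁻ ψ⟩` for all `φ = P⁺ φ` in the form
domain. -/
def IsOffDiagSolution (A : K →ₗ.[ℂ] K) (P : K →L[ℂ] K) (g : Form K) (E : ℂ) (F : Form K)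
    (T : K →L[ℂ] K) : Prop :=
  ∀ ψ, T ψ ∈ formDomain A ∧ P (T ψ) = 0 ∧
    ∀ φ ∈ formDomain A, P φ = 0 → g φ (T ψ) - E * ⟪φ, T ψ⟫_ℂ = F φ (P ψ)

open Classical in
/-- The operator `(G - E)⁻¹ P⁺ F P⁻`. -/
def offDiagSolution (A : K →ₗ.[ℂ] K) (P : K →L[ℂ] K) (g : Form K) (E : ℂ) (F : Form K) :
    K →L[ℂ] K :=
  if h : ∃ T, IsOffDiagSolution A P g E F T then h.choose else 0

/-- The operator `(G - E)⁻¹ P⁺ F P⁻ - h.c.` -/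
def generator (A : K →ₗ.[ℂ] K) (P : K →L[ℂ] K) (g : Form K) (E : ℂ) (F : Form K) : K →L[ℂ] K :=
  offDiagSolution A P g E F - (offDiagSolution A P g E F).adjoint

/-- `ad S_{r₁} (ad S_{r₂} (⋯ ad S_{r_p} (F) ⋯))` for the list `[r₁, …, r_p]`. -/
def nestedAd (S : ℕ → K →L[ℂ] K) (l : List ℕ) (F : Form K) : Form K :=
  l.foldr (fun r F' => adForm (S r) F') F

/-- The form `V_j` in terms of the operators `S_r`, `r < j`: `V_1 = V` and, for `j ≥ 2`,
`V_j = ∑_{p ≥ 2, r₁ + ⋯ + r_p = j} (1/p!) ad S_{r₁} (⋯ ad S_{r_p} (G))`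
`    + ∑_{p ≥ 1, r₁ + ⋯ + r_p = j - 1} (1/p!) ad S_{r₁} (⋯ ad S_{r_p} (V))`
(all `r_i ≥ 1`). -/
def potentialTerm (g V : Form K) (S : ℕ → K →L[ℂ] K) (j : ℕ) : Form K :=
  if j = 1 then V else fun φ ψ =>
    (∑ c : Composition j with 2 ≤ c.length,
      ((c.length.factorial : ℂ))⁻¹ * nestedAd S c.blocks g φ ψ) +
    ∑ c : Composition (j - 1) with 1 ≤ c.length,
      ((c.length.factorial : ℂ))⁻¹ * nestedAd S c.blocks V φ ψ

/-- The sequence `S_1, …, S_n, 0, 0, …` produced by `n` steps of the recursion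
`S_j = (G - E)⁻¹ P⁺ V_j P⁻ - h.c.` -/
def lieSUpTo (A : K →ₗ.[ℂ] K) (P : K →L[ℂ] K) (g : Form K) (E : ℂ) (V : Form K) :
    ℕ → ℕ → K →L[ℂ] K
  | 0 => fun _ => 0
  | n + 1 => Function.update (lieSUpTo A P g E V n) (n + 1)
      (generator A P g E (potentialTerm g V (lieSUpTo A P g E V n) (n + 1)))

/-- The operators `S_j`. -/
def lieS (A : K →ₗ.[ℂ] K) (P : K →L[ℂ] K) (g : Form K) (E : ℂ) (V : Form K) (j : ℕ) :
    K →L[ℂ] K :=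
  lieSUpTo A P g E V j j

/-- The forms `V_j`. -/
def lieV (A : K →ₗ.[ℂ] K) (P : K →L[ℂ] K) (g : Form K) (E : ℂ) (V : Form K) (j : ℕ) : Form K :=
  potentialTerm g V (lieS A P g E V) j

theorem nestedAd_congr {S S' : ℕ → K →L[ℂ] K} {l : List ℕ} (F : Form K)
    (h : ∀ r ∈ l, S r = S' r) : nestedAd S l F = nestedAd S' l F := by
  unfold nestedAd
  induction l with
  | nil => rfl
  | cons r l ih =>
    rw [List.foldr_cons, List.foldr_cons, h r (by simp), ih fun r' hr' => h r' (by simp [hr'])]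

theorem potentialTerm_congr (g V : Form K) {S S' : ℕ → K →L[ℂ] K} {j : ℕ}
    (h : ∀ r < j, S r = S' r) : potentialTerm g V S j = potentialTerm g V S' j := by
  unfold potentialTerm
  split_ifs with hj
  · rfl
  · funext φ ψ
    congr 1
    · refine Finset.sum_congr rfl fun c hc => ?_
      rw [nestedAd_congr g (S' := S')]
      intro r hr
      refine h r ?_
      have hlen : 2 ≤ c.blocks.length := (Finset.mem_filter.1 hc).2
      have hsum := List.sum_erase hr
      rw [c.blocks_sum] at hsum
      have hne : c.blocks.erase r ≠ [] := by
        intro h0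
        have := List.length_erase_of_mem hr
        rw [h0] at this
        simp only [List.length_nil] at this
        omega
      obtain ⟨s, hs⟩ := List.exists_mem_of_ne_nil _ hne
      have hs1 : 0 < s := c.blocks_pos (List.mem_of_mem_erase hs)
      have hs2 := List.single_le_sum (fun _ _ => Nat.zero_le _) s hs
      omega
    · refine Finset.sum_congr rfl fun c hc => ?_
      rw [nestedAd_congr V (S' := S')]
      intro r hr
      refine h r ?_
      have hs2 := List.single_le_sum (fun _ _ => Nat.zero_le _) r hr
      rw [c.blocks_sum] at hs2
      have : 0 < r := c.blocks_pos hr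
      omega

theorem lieSUpTo_eq (A : K →ₗ.[ℂ] K) (P : K →L[ℂ] K) (g : Form K) (E : ℂ) (V : Form K)
    {n r : ℕ} (h : r ≤ n) : lieSUpTo A P g E V n r = lieS A P g E V r := by
  induction n with
  | zero =>
    obtain rfl : r = 0 := by omega
    rfl
  | succ n ih =>
    rcases Nat.lt_or_ge n r with h' | h'
    · obtain rfl : r = n + 1 := by omega
      rfl
    · rw [← ih h', lieSUpTo, Function.update_of_ne (by omega)]

/-- The recursion `S_j = (G - E)⁻¹ P⁺ V_j P⁻ - h.c.` for `j ≥ 1`. -/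
theorem lieS_eq (A : K →ₗ.[ℂ] K) (P : K →L[ℂ] K) (g : Form K) (E : ℂ) (V : Form K)
    {j : ℕ} (hj : 1 ≤ j) :
    lieS A P g E V j = generator A P g E (lieV A P g E V j) := by
  obtain ⟨n, rfl⟩ : ∃ n, j = n + 1 := ⟨j - 1, by omega⟩
  unfold lieS lieV
  rw [lieSUpTo, Function.update_self]
  congr 1
  exact potentialTerm_congr g V fun r hr => lieSUpTo_eq A P g E V (by omega)

/-- The series `S = ∑_{j ≥ 1} t^j S_j` (in operator norm). -/
def lieSeries (A : K →ₗ.[ℂ] K) (P : K →L[ℂ] K) (g : Form K) (E : ℂ) (V : Form K) (t : ℝ) :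
    K →L[ℂ] K :=
  ∑' j : ℕ, (t : ℂ) ^ (j + 1) • lieS A P g E V (j + 1)

/-- The series `∑_{j ≥ 1} t^{j-1} (V_j)^{diag}` (of matrix elements). -/
def diagSeries (A : K →ₗ.[ℂ] K) (P : K →L[ℂ] K) (g : Form K) (E : ℂ) (V : Form K) (t : ℝ) :
    Form K := fun φ ψ =>
  ∑' j : ℕ, (t : ℂ) ^ j * diagPart P (lieV A P g E V (j + 1)) φ ψ

/-- The `n`-th partial sum of `∑_{j ≥ 1} t^{j-1} (V_j)^{diag}`. -/
def diagPartialSum (A : K →ₗ.[ℂ] K) (P : K →L[ℂ] K) (g : Form K) (E : ℂ) (V : Form K) (t : ℝ)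
    (n : ℕ) : Form K := fun φ ψ =>
  ∑ j ∈ Finset.range n, (t : ℂ) ^ j * diagPart P (lieV A P g E V (j + 1)) φ ψ

end Forms

/-! ### The chain: free Hamiltonians, vacuum projections, potentials, local Hamiltonians -/

section Model

variable {N : ℕ} {ℋ : Type*} [NormedAddCommGroup ℋ] [InnerProductSpace ℂ ℋ] [CompleteSpace ℋ]

/-- The one-site Hamiltonian: self-adjoint, nonnegative, with normalized ground-state vector `Ω`
of energy `0`, and `H ≥ 1` on the orthogonal complement of `Ω`. -/
structure IsSiteHamiltonian (H : ℋ →ₗ.[ℂ] ℋ) (Ω : ℋ) : Prop where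
  selfAdjoint : IsSelfAdjoint H
  nonneg : ∀ x : H.domain, 0 ≤ (⟪(x : ℋ), H x⟫_ℂ).re
  norm_vacuum : ‖Ω‖ = 1
  vacuum : (Ω, (0 : ℋ)) ∈ H.graph
  gap : ∀ x : H.domain, ⟪Ω, (x : ℋ)⟫_ℂ = 0 → ‖(x : ℋ)‖ ^ 2 ≤ (⟪(x : ℋ), H x⟫_ℂ).re

/-- The interval `I_{r,i} = {i, …, i + r}` in the chain `{1, …, N}`; the site `s ∈ {1, …, N}` is
represented by the element of `Fin N` with value `s - 1`. -/
def interval (N r i : ℕ) : Finset (Fin N) :=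
  Finset.univ.filter fun s => i ≤ (s : ℕ) + 1 ∧ (s : ℕ) + 1 ≤ i + r

/-- The free Hamiltonian `H⁰_I = ∑_{i ∈ I} H_i`, the closure of the operator
`x₁ ⊗ ⋯ ⊗ x_N ↦ ∑_{i ∈ I} x₁ ⊗ ⋯ ⊗ H x_i ⊗ ⋯ ⊗ x_N` on the span of the pure tensors with
`x_i ∈ D(H)` for `i ∈ I`. -/
def freeHamiltonian (H : ℋ →ₗ.[ℂ] ℋ) (I : Finset (Fin N)) : Chain N ℋ →ₗ.[ℂ] Chain N ℋ :=
  (Submodule.span ℂ {p : Chain N ℋ × Chain N ℋ |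
    ∃ (x : Fin N → ℋ) (h : ∀ i ∈ I, x i ∈ H.domain),
      p = (tensor x, ∑ i ∈ I.attach,
        tensor (Function.update x i.1 (H ⟨x i.1, h i.1 i.2⟩)))}).topologicalClosure.toLinearPMap

/-- The projection `P⁻_I = ⨂_{i ∈ I} P_{Ω_i}` (times the identity on the other sites), the
orthogonal projection onto the closed span of the pure tensors with `x_i = Ω` for `i ∈ I`. -/
def vacuumProj (Ω : ℋ) (I : Finset (Fin N)) : Chain N ℋ →L[ℂ] Chain N ℋ :=
  (Submodule.span ℂ {φ : Chain N ℋ |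
    ∃ x : Fin N → ℋ, (∀ i ∈ I, x i = Ω) ∧ φ = tensor x}).topologicalClosure.starProjection

/-- A potential supported on `I`: a symmetric form on the form domain of `H⁰_I` that acts as the
identity on the sites outside `I`, i.e. is of the form `v ⊗ 1`. -/
structure IsPotential (H : ℋ →ₗ.[ℂ] ℋ) (I : Finset (Fin N)) (V : Form (Chain N ℋ)) : Prop where
  symmForm : IsSymmForm (formDomain (freeHamiltonian H I)) V
  support : ∃ v : (I → ℋ) → (I → ℋ) → ℂ, ∀ x y : Fin N → ℋ,
    tensor x ∈ formDomain (freeHamiltonian H I) →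
    tensor y ∈ formDomain (freeHamiltonian H I) →
    V (tensor x) (tensor y) =
      v (fun i => x i) (fun i => y i) * ∏ j ∈ Iᶜ, ⟪x j, y j⟫_ℂ

/-- `V = P⁺_I V P⁺_I + P⁻_I V P⁻_I` on the form domain of `H⁰_I`. -/
def IsBlockDiagonal (H : ℋ →ₗ.[ℂ] ℋ) (Ω : ℋ) (I : Finset (Fin N)) (V : Form (Chain N ℋ)) :
    Prop :=
  ∀ φ ∈ formDomain (freeHamiltonian H I), ∀ ψ ∈ formDomain (freeHamiltonian H I),
    V φ ψ = diagPart (vacuumProj Ω I) V φ ψ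

/-- The form of the local Hamiltonian
`G_{I_{k,q}} = ∑_{i ∈ I_{k,q}} H_i + t ∑_{r=1}^{k-1} ∑_{I_{r,i} ⊂ I_{k,q}} V_{I_{r,i}}`. -/
def localForm (H : ℋ →ₗ.[ℂ] ℋ) (t : ℝ) (V : ℕ → ℕ → Form (Chain N ℋ)) (k q : ℕ) :
    Form (Chain N ℋ) := fun φ ψ =>
  kineticForm (freeHamiltonian H (interval N k q)) φ ψ +
    t * ∑ r ∈ Finset.Icc 1 (k - 1), ∑ i ∈ Finset.Icc q (q + k - r), V r i φ ψ

/-- `E_{I_{k,q}} = t ∑_{r=1}^{k-1} ∑_{I_{r,i} ⊂ I_{k,q}} ⟨V_{I_{r,i}}⟩`, where `⟨·⟩` is the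
expectation in the vacuum `Ω ⊗ ⋯ ⊗ Ω`. -/
def vacuumEnergy (Ω : ℋ) (t : ℝ) (V : ℕ → ℕ → Form (Chain N ℋ)) (k q : ℕ) : ℂ :=
  t * ∑ r ∈ Finset.Icc 1 (k - 1), ∑ i ∈ Finset.Icc q (q + k - r),
    V r i (tensor fun _ => Ω) (tensor fun _ => Ω)

/-- The spectral gap of `G_{I_{k,q}}` above `E_{I_{k,q}}` is at least `Δ`:
`G_{I_{k,q}} ≥ E_{I_{k,q}} + Δ` on the range of `P⁺_{I_{k,q}}`, in the sense of forms. -/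
def HasGap (H : ℋ →ₗ.[ℂ] ℋ) (Ω : ℋ) (t : ℝ) (V : ℕ → ℕ → Form (Chain N ℋ)) (k q : ℕ)
    (Δ : ℝ) : Prop :=
  ∀ φ ∈ formDomain (freeHamiltonian H (interval N k q)),
    vacuumProj Ω (interval N k q) φ = 0 →
      ((vacuumEnergy Ω t V k q).re + Δ) * ‖φ‖ ^ 2 ≤ (localForm H t V k q φ φ).re

end Model

end QuantumChain

end

open QuantumChain Filter Topology

set_option linter.unusedSectionVars false

noncomputable section

namespace QuantumChain


/-! ### The square root of the resolvent -/

section InvSqrt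

variable {K : Type*} [NormedAddCommGroup K] [InnerProductSpace ℂ K]

/-! Write R = (H⁰ + 1)^{-1/2}. The form domain is the range of R, and a symmetric form F of finite
weighted norm amounts to the bounded operator R F R, so every estimate is made on vectors R x.

Two facts drive the proof. The first is that G − E is close to H⁰. A block-diagonal potential minus
its vacuum expectation vanishes on the vacuum of its interval, hence is bounded by 3‖V_I‖ H⁰_I
(`norm_potential_sub_le`). Each site lies in at most r + 1 of the intervals I_{r,i}, so ∑_i
H⁰_{I_{r,i}} ≤ (r + 1) H⁰ (`sum_kineticForm_le`), and the decay t^{(r-1)/4} makes the sum over r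
converge. Therefore |G − E − H⁰| ≤ (H⁰ + 1)/4 and G P⁻ = E P⁻, uniformly in N and k
(`isGappedPerturbation_localForm`). Since H⁰ ≥ 1 on the range of P⁺, R(G − E)R ≥ 1/4 there. A
Lax–Milgram argument then solves (G − E)T = P⁺FP⁻ with ‖R⁻¹T‖ ≤ 4‖F‖ (`exists_offDiagSolution`), so
that ‖R⁻¹S_j‖ ≤ 8‖V_j‖.

The second is that [S_j, G] is minus the off-diagonal part of V_j (`generator_spec`). The innermost
commutator with G thus costs only ‖V_j‖, and every further ad S_r costs a factor 16‖V_r‖. With f_n =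
∑_{j ≤ n} t^j ‖V_j‖ the recursion gives f_{n+1} ≤ t‖V‖ + 16 f_n² + 32 t‖V‖ f_n, and f_n ≤ 2t‖V‖ is
preserved as long as t‖V‖ ≤ 1/128 (`sum_pow_mul_le`). This yields both series and all bounds; ‖S
R⁻¹‖ = ‖R⁻¹S‖ because S is antisymmetric.

It remains to give meaning to R for H⁰_I, the closure of an operator on the span of the pure
tensors. Positivity and boundedness of tensor operators come from the Schur product theorem for Gram
kernels, and `dense_core` shows that H⁰_I + 1 has dense range already on that span. -/

theorem re_inner_self_add_nonneg {u v : K} (h : 0 ≤ (⟪u, v⟫_ℂ).re) :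
    ‖u‖ ≤ ‖u + v‖ ∧ ‖v‖ ≤ ‖u + v‖ := by
  have e := norm_add_sq (𝕜 := ℂ) u v
  rw [RCLike.re_to_complex] at e
  constructor
  · refine abs_le_of_sq_le_sq' ?_ (norm_nonneg _) |>.2
    nlinarith [sq_nonneg ‖v‖]
  · refine abs_le_of_sq_le_sq' ?_ (norm_nonneg _) |>.2
    nlinarith [sq_nonneg ‖u‖]

variable [CompleteSpace K]

/-- A closed nonnegative operator `A` such that `A + 1` has dense range has `A + 1` surjective. -/
theorem exists_mem_graph_add_eq {A : K →ₗ.[ℂ] K} (hclosed : IsClosed (A.graph : Set (K × K)))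
    (hnn : ∀ p ∈ A.graph, 0 ≤ (⟪p.1, p.2⟫_ℂ).re)
    (hd : Dense ((fun p : K × K => p.1 + p.2) '' (A.graph : Set (K × K)))) (y : K) :
    ∃ p ∈ A.graph, p.1 + p.2 = y := by
  -- `A + 1` as a bounded map on the complete space `A.graph`: it is bounded below, so its range is
  -- closed.
  let f : A.graph →L[ℂ] K :=
    (ContinuousLinearMap.fst ℂ K K + ContinuousLinearMap.snd ℂ K K).comp A.graph.subtypeL
  have hf : ∀ p : A.graph, f p = (p : K × K).1 + (p : K × K).2 := fun p => rfl
  have hanti : AntilipschitzWith 1 f := by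
    refine f.antilipschitz_of_bound fun p => ?_
    have := re_inner_self_add_nonneg (hnn _ p.2)
    rw [hf, NNReal.coe_one, one_mul, Submodule.coe_norm, Prod.norm_def]
    exact max_le this.1 this.2
  have : CompleteSpace A.graph := hclosed.completeSpace_coe
  have hcl : IsClosed (Set.range f) := hanti.isClosed_range f.uniformContinuous
  have hr : Set.range f = (fun p : K × K => p.1 + p.2) '' (A.graph : Set (K × K)) := by
    ext z
    constructor
    · rintro ⟨p, rfl⟩
      exact ⟨p, p.2, rfl⟩
    · rintro ⟨p, hp, rfl⟩
      exact ⟨⟨p, hp⟩, rfl⟩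
  have hy : y ∈ Set.range f := by
    rw [← hcl.closure_eq, hr]
    exact hd y
  obtain ⟨p, rfl⟩ := hy
  exact ⟨p, p.2, rfl⟩

/-- The resolvent `(A + 1)⁻¹` of a symmetric nonnegative operator with `A + 1` surjective. -/
theorem exists_resolvent {A : K →ₗ.[ℂ] K}
    (hsym : ∀ p ∈ A.graph, ∀ q ∈ A.graph, ⟪p.1, q.2⟫_ℂ = ⟪p.2, q.1⟫_ℂ)
    (hnn : ∀ p ∈ A.graph, 0 ≤ (⟪p.1, p.2⟫_ℂ).re)
    (hsurj : ∀ y, ∃ p ∈ A.graph, p.1 + p.2 = y) :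
    ∃ r : K →L[ℂ] K, r.IsPositive ∧ (1 - r).IsPositive ∧ ∀ y, (r y, y - r y) ∈ A.graph := by
  choose p hp hpy using hsurj
  -- `A + 1` is injective by nonnegativity, so the chosen preimages depend linearly on the
  -- right-hand side.
  have huniq : ∀ u ∈ A.graph, u.1 = (p (u.1 + u.2)).1 := by
    intro u hu
    have hd := A.graph.sub_mem hu (hp (u.1 + u.2))
    have := (re_inner_self_add_nonneg (hnn _ hd)).1
    rw [Prod.fst_sub, Prod.snd_sub, show u.1 - (p (u.1 + u.2)).1 + (u.2 - (p (u.1 + u.2)).2) =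
      u.1 + u.2 - ((p (u.1 + u.2)).1 + (p (u.1 + u.2)).2) by abel, hpy, sub_self, norm_zero] at this
    exact sub_eq_zero.1 (norm_le_zero_iff.1 this)
  let r₀ : K →ₗ[ℂ] K :=
    { toFun := fun y => (p y).1
      map_add' := fun y z => by
        have := huniq _ (A.graph.add_mem (hp y) (hp z))
        rw [Prod.fst_add, Prod.snd_add, show (p y).1 + (p z).1 + ((p y).2 + (p z).2) =
          (p y).1 + (p y).2 + ((p z).1 + (p z).2) by abel, hpy, hpy] at this
        exact this.symm
      map_smul' := fun c y => by
        have := huniq _ (A.graph.smul_mem c (hp y))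
        rw [Prod.smul_fst, Prod.smul_snd, ← smul_add, hpy] at this
        exact this.symm }
  let r : K →L[ℂ] K := r₀.mkContinuous 1 fun y => by
    rw [one_mul]
    have := (re_inner_self_add_nonneg (hnn _ (hp y))).1
    rwa [hpy] at this
  have hr : ∀ y, r y = (p y).1 := fun y => rfl
  have hmem : ∀ y, (r y, y - r y) ∈ A.graph := by
    intro y
    have : (r y, y - r y) = p y := by
      ext
      · rfl
      · rw [hr, sub_eq_iff_eq_add', hpy]
    rw [this]
    exact hp y
  have hsy : ∀ x y, ⟪r x, y⟫_ℂ = ⟪x, r y⟫_ℂ := by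
    intro x y
    have h := hsym _ (hmem x) _ (hmem y)
    simp only [inner_sub_left, inner_sub_right] at h
    linear_combination h
  refine ⟨r, ?_, ?_, hmem⟩
  · refine (ContinuousLinearMap.isPositive_iff r).2 ⟨hsy, fun x => ?_⟩
    rw [Complex.nonneg_iff]
    have h1 := hnn _ (hmem x)
    have h2 : (⟪r x, x⟫_ℂ).im = 0 := by
      have : ⟪r x, x⟫_ℂ = star ⟪r x, x⟫_ℂ := by
        rw [hsy]
        exact (inner_conj_symm _ _).symm.trans (by rw [hsy]; rfl)
      exact Complex.conj_eq_iff_im.1 this.symm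
    refine ⟨?_, h2.symm⟩
    simp only [inner_sub_right, Complex.sub_re] at h1
    have := inner_self_nonneg (𝕜 := ℂ) (x := r x)
    rw [RCLike.re_to_complex] at this
    linarith
  · refine (ContinuousLinearMap.isPositive_iff _).2 ⟨fun x y => ?_, fun x => ?_⟩
    · simp [inner_sub_left, inner_sub_right, hsy]
    rw [Complex.nonneg_iff]
    have h1 := hnn _ (hmem x)
    have e : ∀ z, (1 - r) z = z - r z := fun z => rfl
    have h2 : (⟪x - r x, x⟫_ℂ).im = 0 := by
      have : ⟪x - r x, x⟫_ℂ = star ⟪x - r x, x⟫_ℂ := by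
        rw [RCLike.star_def, inner_conj_symm, inner_sub_left, inner_sub_right, hsy]
      exact Complex.conj_eq_iff_im.1 this.symm
    rw [e]
    refine ⟨?_, h2.symm⟩
    -- The first summand is `‖x - r x‖²`, the second has the real part of `⟪r x, A r x⟫`.
    have e2 : ⟪x - r x, x⟫_ℂ = ⟪x - r x, x - r x⟫_ℂ + ⟪x - r x, r x⟫_ℂ := by
      rw [← inner_add_right, sub_add_cancel]
    have e3 : ⟪x - r x, r x⟫_ℂ = star ⟪r x, x - r x⟫_ℂ := (inner_conj_symm _ _).symm
    rw [e2, Complex.add_re, e3]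
    have := inner_self_nonneg (𝕜 := ℂ) (x := x - r x)
    rw [RCLike.re_to_complex] at this
    have h4 : (star ⟪r x, x - r x⟫_ℂ).re = (⟪r x, x - r x⟫_ℂ).re := Complex.conj_re _
    rw [h4]
    linarith

theorem exists_isInvSqrt {A : K →ₗ.[ℂ] K} {r : K →L[ℂ] K} (hr : r.IsPositive)
    (hmem : ∀ y, (r y, y - r y) ∈ A.graph) : ∃ R, IsInvSqrt A R := by
  have h0 : 0 ≤ r := (ContinuousLinearMap.nonneg_iff_isPositive r).2 hr
  refine ⟨CFC.sqrt r, (ContinuousLinearMap.nonneg_iff_isPositive _).1 (CFC.sqrt_nonneg r),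
    fun y => ?_⟩
  have e : CFC.sqrt r (CFC.sqrt r y) = r y :=
    congrArg (fun T : K →L[ℂ] K => T y) (CFC.sqrt_mul_sqrt_self r h0)
  rw [e]
  exact hmem y

/-- From here on only the defining properties of the chosen operator are used; uniqueness of the
square root is not needed. -/
theorem isInvSqrt_invSqrt {A : K →ₗ.[ℂ] K} (h : ∃ R, IsInvSqrt A R) :
    IsInvSqrt A (invSqrt A) := by
  unfold invSqrt
  rw [dif_pos h]
  exact h.choose_spec

/-- The orthogonal complement of the range of a symmetric operator is its kernel. -/
theorem denseRange_of_injective {R : K →L[ℂ] K} (hs : ∀ x y, ⟪R x, y⟫_ℂ = ⟪x, R y⟫_ℂ)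
    (hi : ∀ x, R x = 0 → x = 0) : DenseRange R := by
  have : (LinearMap.range (R : K →ₗ[ℂ] K)).topologicalClosure = ⊤ := by
    rw [Submodule.topologicalClosure_eq_top_iff, Submodule.eq_bot_iff]
    intro x hx
    refine hi x (ext_inner_right ℂ fun y => ?_)
    rw [hs, inner_zero_left]
    exact (Submodule.mem_orthogonal' _ _).1 hx _ ⟨y, rfl⟩
  exact Submodule.dense_iff_topologicalClosure_eq_top.2 this

namespace IsInvSqrt

variable {A : K →ₗ.[ℂ] K} {R : K →L[ℂ] K}

theorem inner_left (hR : IsInvSqrt A R) (x y : K) : ⟪R x, y⟫_ℂ = ⟪x, R y⟫_ℂ :=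
  hR.1.inner_left_eq_inner_right x y

/-- If `R x = 0`, then `(0, x)` lies in the graph of `A`, which is single-valued. -/
theorem eq_zero (hR : IsInvSqrt A R) {x : K} (hx : R x = 0) : x = 0 := by
  have h := hR.2 x
  rw [hx, map_zero, sub_zero] at h
  exact A.graph_fst_eq_zero_snd h rfl

theorem denseRange (hR : IsInvSqrt A R) : DenseRange R :=
  denseRange_of_injective hR.inner_left fun _ => hR.eq_zero

theorem norm_sq_eq (hR : IsInvSqrt A R) (x : K) : ‖R x‖ ^ 2 = (⟪R (R x), x⟫_ℂ).re := by
  rw [hR.inner_left]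
  exact (inner_self_eq_norm_sq (𝕜 := ℂ) (R x)).symm

/-- A lower bound `A + 1 ≥ c` at the vector `R² x` gives `c ‖R x‖² ≤ ‖x‖²`. -/
theorem mul_norm_sq_le (hR : IsInvSqrt A R) {c : ℝ} (hc : 0 < c) {x : K}
    (h : c * ‖R (R x)‖ ^ 2 ≤ (⟪R (R x), x⟫_ℂ).re) : c * ‖R x‖ ^ 2 ≤ ‖x‖ ^ 2 := by
  rw [hR.norm_sq_eq]
  have h2 : (⟪R (R x), x⟫_ℂ).re ≤ ‖R (R x)‖ * ‖x‖ := re_inner_le_norm (𝕜 := ℂ) _ _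
  set a := ‖R (R x)‖
  have ha : 0 ≤ a := norm_nonneg _
  have hx := norm_nonneg x
  -- One factor `a` cancels in `c a² ≤ ⟪R² x, x⟫ ≤ a ‖x‖`; then `c ‖R x‖² ≤ c a ‖x‖ ≤ ‖x‖²`.
  have h3 : c * a ≤ ‖x‖ := by
    rcases ha.eq_or_lt with h0 | h0
    · rw [← h0, mul_zero]
      exact hx
    · refine le_of_mul_le_mul_left ?_ h0
      nlinarith
  nlinarith [mul_le_mul_of_nonneg_right h3 hx, mul_le_mul_of_nonneg_left h2 hc.le]

theorem norm_le (hR : IsInvSqrt A R) (hnn : ∀ p ∈ A.graph, 0 ≤ (⟪p.1, p.2⟫_ℂ).re) (x : K) :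
    ‖R x‖ ≤ ‖x‖ := by
  refine abs_le_of_sq_le_sq' ?_ (norm_nonneg _) |>.2
  have := hR.mul_norm_sq_le one_pos (x := x) ?_
  · simpa using this
  have h := hnn _ (hR.2 x)
  simp only [inner_sub_right, Complex.sub_re] at h
  have e := inner_self_eq_norm_sq (𝕜 := ℂ) (R (R x))
  rw [RCLike.re_to_complex] at e
  linarith

/-- The value of `R²` on `(A + 1) φ`. -/
theorem apply_apply_add (hR : IsInvSqrt A R) (hnn : ∀ p ∈ A.graph, 0 ≤ (⟪p.1, p.2⟫_ℂ).re)
    {p : K × K} (hp : p ∈ A.graph) : R (R (p.1 + p.2)) = p.1 := by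
  have hd := A.graph.sub_mem hp (hR.2 (p.1 + p.2))
  have := (re_inner_self_add_nonneg (hnn _ hd)).1
  rw [Prod.fst_sub, Prod.snd_sub, show p.1 - R (R (p.1 + p.2)) +
    (p.2 - (p.1 + p.2 - R (R (p.1 + p.2)))) = 0 by abel, norm_zero] at this
  exact (sub_eq_zero.1 (norm_le_zero_iff.1 this)).symm

/-- On the kernel of `A` one has `R² x = x`, so `d = R x - x` satisfies `R d = -d`, and `R ≥ 0`
forces `d = 0`. -/
theorem apply_of_mem_graph_zero (hR : IsInvSqrt A R)
    (hnn : ∀ p ∈ A.graph, 0 ≤ (⟪p.1, p.2⟫_ℂ).re) {x : K} (hx : (x, (0 : K)) ∈ A.graph) :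
    R x = x := by
  have h := hR.apply_apply_add hnn hx
  rw [add_zero] at h
  have h1 : R (R x - x) + (R x - x) = 0 := by
    rw [map_sub, h]
    abel
  have h2 := hR.1.re_inner_nonneg_right (R x - x)
  have h3 := (re_inner_self_add_nonneg h2).1
  rw [add_comm, h1, norm_zero] at h3
  exact sub_eq_zero.1 (norm_le_zero_iff.1 h3)

end IsInvSqrt

section SqrtOp

variable {A : K →ₗ.[ℂ] K}

/-- The inverse taken in `sqrtOp` is a genuine inverse only when the kernel is trivial. -/
theorem ker_toPMap_invSqrt (h : ∃ R, IsInvSqrt A R) :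
    LinearMap.ker ((invSqrt A : K →ₗ[ℂ] K).toPMap ⊤).toFun = ⊥ := by
  rw [LinearMap.ker_eq_bot']
  rintro ⟨x, hx⟩ h0
  exact Subtype.ext ((isInvSqrt_invSqrt h).eq_zero h0)

/-- The domain of an inverse is a range, whether or not a square root exists. All later arguments
parametrize the form domain in this way. -/
theorem mem_formDomain_iff {x : K} : x ∈ formDomain A ↔ ∃ y, invSqrt A y = x := by
  unfold formDomain sqrtOp
  rw [LinearPMap.inverse_domain]
  constructor
  · rintro ⟨y, rfl⟩
    exact ⟨y, rfl⟩
  · rintro ⟨y, rfl⟩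
    exact ⟨⟨y, trivial⟩, rfl⟩

theorem invSqrt_mem (y : K) : invSqrt A y ∈ formDomain A :=
  mem_formDomain_iff.2 ⟨y, rfl⟩

theorem sqrtOp_invSqrt (h : ∃ R, IsInvSqrt A R) (y : K) (hy : invSqrt A y ∈ (sqrtOp A).domain) :
    sqrtOp A ⟨invSqrt A y, hy⟩ = y :=
  LinearPMap.inverse_apply_eq (ker_toPMap_invSqrt h)
    (y := (⟨invSqrt A y, hy⟩ : (sqrtOp A).domain))
    (x := (⟨y, trivial⟩ : ((invSqrt A : K →ₗ[ℂ] K).toPMap ⊤).domain)) rfl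

theorem kineticForm_invSqrt (h : ∃ R, IsInvSqrt A R) (x y : K) :
    kineticForm A (invSqrt A x) (invSqrt A y) = ⟪x, y⟫_ℂ - ⟪invSqrt A x, invSqrt A y⟫_ℂ := by
  unfold kineticForm
  rw [dif_pos ⟨invSqrt_mem x, invSqrt_mem y⟩]
  congr 2
  · exact sqrtOp_invSqrt h x _
  · exact sqrtOp_invSqrt h y _

end SqrtOp

end InvSqrt


/-! ### Symmetric forms and bounds relative to `A + 1` -/

section FormAlgebra

variable {K : Type*} [NormedAddCommGroup K] [InnerProductSpace ℂ K] [CompleteSpace K]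

namespace IsSymmForm

variable {Q : Submodule ℂ K} {F F' : Form K}

theorem add_left (hF : IsSymmForm Q F) {φ χ ψ : K} (hφ : φ ∈ Q) (hχ : χ ∈ Q) (hψ : ψ ∈ Q) :
    F (φ + χ) ψ = F φ ψ + F χ ψ := by
  rw [hF.symm _ (Q.add_mem hφ hχ) _ hψ, hF.add_right _ hψ _ hφ _ hχ, star_add,
    ← hF.symm _ hφ _ hψ, ← hF.symm _ hχ _ hψ]

theorem smul_left (hF : IsSymmForm Q F) {φ ψ : K} (hφ : φ ∈ Q) (hψ : ψ ∈ Q) (c : ℂ) :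
    F (c • φ) ψ = star c * F φ ψ := by
  rw [hF.symm _ (Q.smul_mem c hφ) _ hψ, hF.smul_right _ hψ _ hφ, star_mul', ← hF.symm _ hφ _ hψ]

theorem neg_left (hF : IsSymmForm Q F) {φ ψ : K} (hφ : φ ∈ Q) (hψ : ψ ∈ Q) :
    F (-φ) ψ = -F φ ψ := by
  have := hF.smul_left hφ hψ (-1)
  simpa using this

theorem neg_right (hF : IsSymmForm Q F) {φ ψ : K} (hφ : φ ∈ Q) (hψ : ψ ∈ Q) :
    F φ (-ψ) = -F φ ψ := by
  have := hF.smul_right _ hφ _ hψ (-1)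
  simpa using this

theorem sub_right (hF : IsSymmForm Q F) {φ ψ χ : K} (hφ : φ ∈ Q) (hψ : ψ ∈ Q) (hχ : χ ∈ Q) :
    F φ (ψ - χ) = F φ ψ - F φ χ := by
  rw [sub_eq_add_neg, hF.add_right _ hφ _ hψ _ (Q.neg_mem hχ), hF.neg_right hφ hχ, ← sub_eq_add_neg]

theorem sub_left (hF : IsSymmForm Q F) {φ ψ χ : K} (hφ : φ ∈ Q) (hχ : χ ∈ Q) (hψ : ψ ∈ Q) :
    F (φ - χ) ψ = F φ ψ - F χ ψ := by
  rw [sub_eq_add_neg, hF.add_left hφ (Q.neg_mem hχ) hψ, hF.neg_left hχ hψ, ← sub_eq_add_neg]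

theorem mono {Q' : Submodule ℂ K} (hF : IsSymmForm Q F) (h : Q' ≤ Q) : IsSymmForm Q' F where
  add_right φ hφ ψ hψ χ hχ := hF.add_right φ (h hφ) ψ (h hψ) χ (h hχ)
  smul_right φ hφ ψ hψ c := hF.smul_right φ (h hφ) ψ (h hψ) c
  symm φ hφ ψ hψ := hF.symm φ (h hφ) ψ (h hψ)

theorem add (hF : IsSymmForm Q F) (hF' : IsSymmForm Q F') :
    IsSymmForm Q (fun φ ψ => F φ ψ + F' φ ψ) where
  add_right φ hφ ψ hψ χ hχ := by
    simp only [hF.add_right φ hφ ψ hψ χ hχ, hF'.add_right φ hφ ψ hψ χ hχ]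
    ring
  smul_right φ hφ ψ hψ c := by
    simp only [hF.smul_right φ hφ ψ hψ c, hF'.smul_right φ hφ ψ hψ c]
    ring
  symm φ hφ ψ hψ := by
    simp only [star_add]
    rw [hF.symm φ hφ ψ hψ, hF'.symm φ hφ ψ hψ]

theorem smul (hF : IsSymmForm Q F) {c : ℂ} (hc : star c = c) :
    IsSymmForm Q (fun φ ψ => c * F φ ψ) where
  add_right φ hφ ψ hψ χ hχ := by
    simp only [hF.add_right φ hφ ψ hψ χ hχ]
    ring
  smul_right φ hφ ψ hψ d := by
    simp only [hF.smul_right φ hφ ψ hψ d]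
    ring
  symm φ hφ ψ hψ := by
    simp only [star_mul', hc]
    rw [hF.symm φ hφ ψ hψ]

theorem sum {ι : Type*} (s : Finset ι) {f : ι → Form K} (h : ∀ i ∈ s, IsSymmForm Q (f i)) :
    IsSymmForm Q (fun φ ψ => ∑ i ∈ s, f i φ ψ) where
  add_right φ hφ ψ hψ χ hχ := by
    rw [← Finset.sum_add_distrib]
    exact Finset.sum_congr rfl fun i hi => (h i hi).add_right φ hφ ψ hψ χ hχ
  smul_right φ hφ ψ hψ d := by
    rw [Finset.mul_sum]
    exact Finset.sum_congr rfl fun i hi => (h i hi).smul_right φ hφ ψ hψ d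
  symm φ hφ ψ hψ := by
    rw [star_sum]
    exact Finset.sum_congr rfl fun i hi => (h i hi).symm φ hφ ψ hψ

theorem tsum {f : ℕ → Form K} (h : ∀ i, IsSymmForm Q (f i))
    (hs : ∀ φ ∈ Q, ∀ ψ ∈ Q, Summable fun i => f i φ ψ) :
    IsSymmForm Q (fun φ ψ => ∑' i, f i φ ψ) where
  add_right φ hφ ψ hψ χ hχ := by
    rw [← (hs φ hφ ψ hψ).tsum_add (hs φ hφ χ hχ)]
    exact tsum_congr fun i => (h i).add_right φ hφ ψ hψ χ hχ
  smul_right φ hφ ψ hψ d := by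
    rw [← tsum_mul_left]
    exact tsum_congr fun i => (h i).smul_right φ hφ ψ hψ d
  symm φ hφ ψ hψ := by
    rw [tsum_star]
    exact tsum_congr fun i => (h i).symm φ hφ ψ hψ

/-- For antisymmetric `S` the form is `-F (S φ) ψ - F φ (S ψ)`, and conjugation exchanges the two
terms. The range condition on `S` keeps every argument inside `Q`. -/
theorem adForm (hF : IsSymmForm Q F) {S : K →L[ℂ] K} (hS : S.adjoint = -S)
    (hQ : ∀ φ, S φ ∈ Q) : IsSymmForm Q (adForm S F) := by
  have e : ∀ φ ∈ Q, ∀ ψ ∈ Q, QuantumChain.adForm S F φ ψ = -F (S φ) ψ - F φ (S ψ) := by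
    intro φ hφ ψ hψ
    unfold QuantumChain.adForm
    rw [hS, neg_apply, hF.neg_left (hQ _) hψ]
  refine ⟨fun φ hφ ψ hψ χ hχ => ?_, fun φ hφ ψ hψ c => ?_, fun φ hφ ψ hψ => ?_⟩
  · rw [e φ hφ _ (Q.add_mem hψ hχ), e φ hφ ψ hψ, e φ hφ χ hχ, map_add,
      hF.add_right _ (hQ _) _ hψ _ hχ, hF.add_right _ hφ _ (hQ _) _ (hQ _)]
    ring
  · rw [e φ hφ _ (Q.smul_mem c hψ), e φ hφ ψ hψ, map_smul,
      hF.smul_right _ (hQ _) _ hψ, hF.smul_right _ hφ _ (hQ _)]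
    ring
  · rw [e φ hφ ψ hψ, e ψ hψ φ hφ, star_sub, star_neg, ← hF.symm _ hφ _ (hQ _),
      ← hF.symm _ (hQ _) _ hψ]
    ring

theorem diagPart (hF : IsSymmForm Q F) {P : K →L[ℂ] K} (hP : ∀ φ, P φ ∈ Q) :
    IsSymmForm Q (diagPart P F) := by
  have hP' : ∀ φ ∈ Q, φ - P φ ∈ Q := fun φ hφ => Q.sub_mem hφ (hP φ)
  unfold QuantumChain.diagPart
  refine ⟨fun φ hφ ψ hψ χ hχ => ?_, fun φ hφ ψ hψ c => ?_, fun φ hφ ψ hψ => ?_⟩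
  · rw [map_add, add_sub_add_comm, hF.add_right _ (hP' _ hφ) _ (hP' _ hψ) _ (hP' _ hχ),
      hF.add_right _ (hP _) _ (hP _) _ (hP _)]
    ring
  · rw [map_smul, ← smul_sub, hF.smul_right _ (hP' _ hφ) _ (hP' _ hψ),
      hF.smul_right _ (hP _) _ (hP _)]
    ring
  · rw [star_add, ← hF.symm _ (hP' _ hφ) _ (hP' _ hψ), ← hF.symm _ (hP _) _ (hP _)]

end IsSymmForm

/-- `|⟨R x, F R y⟩| ≤ c ‖x‖ ‖y‖` for `R = (A + 1)^{-1/2}`. -/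
def FormBound (A : K →ₗ.[ℂ] K) (F : Form K) (c : ℝ) : Prop :=
  ∀ x y, ‖F (invSqrt A x) (invSqrt A y)‖ ≤ c * (‖x‖ * ‖y‖)

variable {A : K →ₗ.[ℂ] K} {F F' : Form K} {c c' : ℝ}

theorem weightedNorm_le_of_formBound (hc : 0 ≤ c) (h : FormBound A F c) :
    weightedNorm A F ≤ ENNReal.ofReal c := by
  unfold weightedNorm
  refine iSup₂_le fun x hx => iSup₂_le fun y hy => ?_
  rw [← ofReal_norm]
  refine ENNReal.ofReal_le_ofReal ((h x y).trans ?_)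
  calc c * (‖x‖ * ‖y‖) ≤ c * (1 * 1) := by gcongr
    _ = c := by ring

/-- Homogeneity extends the bound from unit balls to all vectors. A `Form` is an arbitrary function,
so this needs sesquilinearity, and zero vectors are treated apart. -/
theorem IsSymmForm.formBound_of_weightedNorm_le (hF : IsSymmForm (formDomain A) F)
    (hc : 0 ≤ c) (h : weightedNorm A F ≤ ENNReal.ofReal c) : FormBound A F c := by
  have key : ∀ x y, ‖x‖ ≤ 1 → ‖y‖ ≤ 1 → ‖F (invSqrt A x) (invSqrt A y)‖ ≤ c := by
    intro x y hx hy
    have h1 : ‖F (invSqrt A x) (invSqrt A y)‖ₑ ≤ weightedNorm A F := by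
      unfold weightedNorm
      exact le_iSup₂_of_le x hx (le_iSup₂_of_le y hy le_rfl)
    have h2 := h1.trans h
    rw [← ofReal_norm] at h2
    exact (ENNReal.ofReal_le_ofReal_iff hc).1 h2
  intro x y
  rcases eq_or_ne x 0 with rfl | hx
  · have := hF.smul_left (invSqrt_mem (0 : K)) (invSqrt_mem y) 0
    simp only [zero_smul, star_zero, zero_mul] at this
    simp [this]
  rcases eq_or_ne y 0 with rfl | hy
  · have := hF.smul_right _ (invSqrt_mem x) _ (invSqrt_mem (0 : K)) 0
    simp only [zero_smul, zero_mul] at this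
    simp [this]
  have hx' := norm_ne_zero_iff.2 hx
  have hy' := norm_ne_zero_iff.2 hy
  have ex : x = (‖x‖ : ℂ) • ((‖x‖⁻¹ : ℝ) : ℂ) • x := by
    rw [smul_smul, ← Complex.ofReal_mul, mul_inv_cancel₀ hx', Complex.ofReal_one, one_smul]
  have ey : y = (‖y‖ : ℂ) • ((‖y‖⁻¹ : ℝ) : ℂ) • y := by
    rw [smul_smul, ← Complex.ofReal_mul, mul_inv_cancel₀ hy', Complex.ofReal_one, one_smul]
  have hn : ∀ z : K, z ≠ 0 → ‖((‖z‖⁻¹ : ℝ) : ℂ) • z‖ ≤ 1 := by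
    intro z hz
    rw [norm_smul, Complex.norm_real, norm_inv, norm_norm, inv_mul_cancel₀ (norm_ne_zero_iff.2 hz)]
  have h1 := key _ _ (hn x hx) (hn y hy)
  have e : F (invSqrt A x) (invSqrt A y) = star (‖x‖ : ℂ) * ((‖y‖ : ℂ) *
      F (invSqrt A (((‖x‖⁻¹ : ℝ) : ℂ) • x)) (invSqrt A (((‖y‖⁻¹ : ℝ) : ℂ) • y))) := by
    conv_lhs => rw [ex, ey]
    rw [map_smul (invSqrt A) (‖x‖ : ℂ), map_smul (invSqrt A) (‖y‖ : ℂ),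
      hF.smul_left (invSqrt_mem _) (Submodule.smul_mem _ _ (invSqrt_mem _)),
      hF.smul_right _ (invSqrt_mem _) _ (invSqrt_mem _)]
  rw [e, norm_mul, norm_mul, norm_star, Complex.norm_real, Complex.norm_real, norm_norm, norm_norm]
  nlinarith [mul_le_mul_of_nonneg_left h1 (mul_nonneg (norm_nonneg x) (norm_nonneg y))]

theorem IsSymmForm.formBound_toReal (hF : IsSymmForm (formDomain A) F)
    (h : weightedNorm A F < ⊤) : FormBound A F (weightedNorm A F).toReal :=
  hF.formBound_of_weightedNorm_le ENNReal.toReal_nonneg (ENNReal.ofReal_toReal h.ne).ge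

namespace FormBound

theorem mono (h : FormBound A F c) (hc : c ≤ c') : FormBound A F c' := fun x y =>
  (h x y).trans (by gcongr)

theorem add (h : FormBound A F c) (h' : FormBound A F' c') :
    FormBound A (fun φ ψ => F φ ψ + F' φ ψ) (c + c') := fun x y =>
  (norm_add_le _ _).trans ((add_le_add (h x y) (h' x y)).trans_eq (by ring))

theorem smul (h : FormBound A F c) (d : ℂ) :
    FormBound A (fun φ ψ => d * F φ ψ) (‖d‖ * c) := fun x y => by
  rw [norm_mul, mul_assoc]
  exact mul_le_mul_of_nonneg_left (h x y) (norm_nonneg d)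

theorem sum {ι : Type*} (s : Finset ι) {f : ι → Form K} {b : ι → ℝ}
    (h : ∀ i ∈ s, FormBound A (f i) (b i)) :
    FormBound A (fun φ ψ => ∑ i ∈ s, f i φ ψ) (∑ i ∈ s, b i) := fun x y =>
  (norm_sum_le _ _).trans ((Finset.sum_le_sum fun i hi => h i hi x y).trans_eq
    (Finset.sum_mul _ _ _).symm)

/-- Writing `S = R S'` turns `F (R x) (S R y)` into `F (R x) (R (S' R y))`, where `‖S' R‖ ≤ s`. The
2 counts the two terms of the commutator. -/
theorem adForm (hF : IsSymmForm (formDomain A) F) (h : FormBound A F c) (hc : 0 ≤ c)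
    {S S' : K →L[ℂ] K} (hS : S.adjoint = -S) (hS' : ∀ x, S x = invSqrt A (S' x))
    (hR : ∀ x, ‖invSqrt A x‖ ≤ ‖x‖) {s : ℝ} (hs : ‖S'‖ ≤ s) :
    FormBound A (adForm S F) (2 * s * c) := by
  intro x y
  have hn : ∀ z, ‖S' (invSqrt A z)‖ ≤ s * ‖z‖ := fun z =>
    (S'.le_opNorm _).trans (mul_le_mul hs (hR z) (norm_nonneg _) ((norm_nonneg _).trans hs))
  unfold QuantumChain.adForm
  rw [hS, neg_apply, hS', hS', hF.neg_left (invSqrt_mem _) (invSqrt_mem _)]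
  refine (norm_sub_le _ _).trans ?_
  rw [norm_neg]
  refine (add_le_add (h _ _) (h _ _)).trans ?_
  have h1 : ‖S' (invSqrt A x)‖ * ‖y‖ ≤ s * ‖x‖ * ‖y‖ := by gcongr; exact hn x
  have h2 : ‖x‖ * ‖S' (invSqrt A y)‖ ≤ ‖x‖ * (s * ‖y‖) := by gcongr; exact hn y
  nlinarith [mul_le_mul_of_nonneg_left h1 hc, mul_le_mul_of_nonneg_left h2 hc]

end FormBound

/-- A bounded symmetric form is given by a bounded operator. -/
theorem FormBound.exists_operator (hF : IsSymmForm (formDomain A) F) (h : FormBound A F c) :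
    ∃ W : K →L[ℂ] K, ∀ x y, ⟪x, W y⟫_ℂ = F (invSqrt A x) (invSqrt A y) := by
  let B₀ : K →ₗ⋆[ℂ] K →ₗ[ℂ] ℂ := LinearMap.mk₂'ₛₗ (starRingEnd ℂ) (RingHom.id ℂ)
    (fun x y => F (invSqrt A x) (invSqrt A y))
    (fun x y z => by rw [map_add, hF.add_left (invSqrt_mem _) (invSqrt_mem _) (invSqrt_mem _)])
    (fun a x y => by rw [map_smul, hF.smul_left (invSqrt_mem _) (invSqrt_mem _)]; rfl)
    (fun x y z => by
      rw [map_add, hF.add_right _ (invSqrt_mem _) _ (invSqrt_mem _) _ (invSqrt_mem _)])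
    (fun a x y => by rw [map_smul, hF.smul_right _ (invSqrt_mem _) _ (invSqrt_mem _)]; rfl)
  let B : K →L⋆[ℂ] K →L[ℂ] ℂ := B₀.mkContinuous₂ c fun x y => by
    rw [mul_assoc]
    exact h x y
  refine ⟨InnerProductSpace.continuousLinearMapOfBilin B, fun x y => ?_⟩
  -- The operator represents the form in its first argument, `⟪W y, x⟫ = B y x`; symmetry of `F`
  -- moves it to the second.
  rw [← inner_conj_symm, InnerProductSpace.continuousLinearMapOfBilin_apply]
  exact (hF.symm _ (invSqrt_mem x) _ (invSqrt_mem y)).symm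

end FormAlgebra


/-! ### Solving `(G - E) T = P⁺ F P⁻` -/

section OffDiag

variable {K : Type*} [NormedAddCommGroup K] [InnerProductSpace ℂ K] [CompleteSpace K]

/-- The form `g` is a small perturbation of `A + E`, which has the range of the projection `P` as
its ground states and the spectral gap `1` above `E`. -/
structure IsGappedPerturbation (A : K →ₗ.[ℂ] K) (P : K →L[ℂ] K) (g : Form K) (E : ℂ) : Prop where
  isInvSqrt : IsInvSqrt A (invSqrt A)
  norm_le : ∀ x, ‖invSqrt A x‖ ≤ ‖x‖
  proj_inner : ∀ x y, ⟪P x, y⟫_ℂ = ⟪x, P y⟫_ℂ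
  proj_idem : ∀ x, P (P x) = P x
  invSqrt_proj : ∀ x, invSqrt A (P x) = P x
  -- This is `A + 1 ≥ 2` on the range of `P⁺`.
  gap : ∀ x, P x = 0 → 2 * ‖invSqrt A x‖ ^ 2 ≤ ‖x‖ ^ 2
  symm : IsSymmForm (formDomain A) g
  real : star E = E
  -- In form language, `|G - E - A| ≤ (A + 1) / 4`.
  close : ∀ x y, ‖g (invSqrt A x) (invSqrt A y) - E * ⟪invSqrt A x, invSqrt A y⟫_ℂ -
    (⟪x, y⟫_ℂ - ⟪invSqrt A x, invSqrt A y⟫_ℂ)‖ ≤ 1 / 4 * (‖x‖ * ‖y‖)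
  vacuum : ∀ φ ∈ formDomain A, ∀ ψ, g φ (P ψ) = E * ⟪φ, P ψ⟫_ℂ

namespace IsGappedPerturbation

variable {A : K →ₗ.[ℂ] K} {P : K →L[ℂ] K} {g : Form K} {E : ℂ}
  {F : Form K} {c : ℝ}

theorem proj_mem (h : IsGappedPerturbation A P g E) (x : K) : P x ∈ formDomain A := by
  rw [← h.invSqrt_proj]
  exact invSqrt_mem _

theorem proj_invSqrt (h : IsGappedPerturbation A P g E) (x : K) : P (invSqrt A x) = P x :=
  ext_inner_right ℂ fun y => by
    rw [h.proj_inner, h.isInvSqrt.inner_left, h.invSqrt_proj, ← h.proj_inner]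

theorem proj_sub (h : IsGappedPerturbation A P g E) (x : K) : P (x - P x) = 0 := by
  rw [map_sub, h.proj_idem, sub_self]

theorem inner_proj_sub (h : IsGappedPerturbation A P g E) (x y : K) : ⟪x - P x, P y⟫_ℂ = 0 := by
  rw [← h.proj_inner, h.proj_sub, inner_zero_left]

theorem norm_sq_split (h : IsGappedPerturbation A P g E) (x : K) :
    ‖x‖ ^ 2 = ‖x - P x‖ ^ 2 + ‖P x‖ ^ 2 := by
  have e := norm_add_sq (𝕜 := ℂ) (x - P x) (P x)
  rw [sub_add_cancel, h.inner_proj_sub, map_zero, mul_zero, add_zero] at e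
  exact e

theorem norm_proj_le (h : IsGappedPerturbation A P g E) (x : K) : ‖P x‖ ≤ ‖x‖ :=
  abs_le_of_sq_le_sq' (by nlinarith [h.norm_sq_split x, sq_nonneg ‖x - P x‖])
    (norm_nonneg _) |>.2

/-- `|a₁| |b₁| + |a₂| |b₂| ≤ |a| |b|` for the components `a₁, a₂` of `a` and `b₁, b₂` of `b` along
the ranges of `P⁺` and `P⁻`. -/
theorem split_mul_le (h : IsGappedPerturbation A P g E) (x y : K) :
    ‖x - P x‖ * ‖y - P y‖ + ‖P x‖ * ‖P y‖ ≤ ‖x‖ * ‖y‖ := by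
  refine abs_le_of_sq_le_sq' ?_ (by positivity) |>.2
  rw [mul_pow, h.norm_sq_split x, h.norm_sq_split y]
  nlinarith [sq_nonneg (‖x - P x‖ * ‖P y‖ - ‖P x‖ * ‖y - P y‖)]

/-- Cauchy–Schwarz in ℝ² with crossed components: the off-diagonal part of a form is no larger than
the form. -/
theorem split_mul_le' (h : IsGappedPerturbation A P g E) (x y : K) :
    ‖x - P x‖ * ‖P y‖ + ‖P x‖ * ‖y - P y‖ ≤ ‖x‖ * ‖y‖ := by
  refine abs_le_of_sq_le_sq' ?_ (by positivity) |>.2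
  rw [mul_pow, h.norm_sq_split x, h.norm_sq_split y]
  nlinarith [sq_nonneg (‖x - P x‖ * ‖y - P y‖ - ‖P x‖ * ‖P y‖)]

theorem invSqrt_sub_proj (h : IsGappedPerturbation A P g E) (x : K) :
    invSqrt A (x - P x) = invSqrt A x - P (invSqrt A x) := by
  rw [map_sub, h.invSqrt_proj, h.proj_invSqrt]

/-- The two blocks act on orthogonal components, so their bounds combine through `split_mul_le`
without a factor 2. -/
theorem formBound_diagPart (h : IsGappedPerturbation A P g E) (hc : 0 ≤ c)
    (hF : FormBound A F c) : FormBound A (diagPart P F) c := by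
  intro x y
  unfold diagPart
  rw [← h.invSqrt_sub_proj, ← h.invSqrt_sub_proj, h.proj_invSqrt, h.proj_invSqrt,
    ← h.invSqrt_proj x, ← h.invSqrt_proj y]
  refine (norm_add_le _ _).trans ((add_le_add (hF _ _) (hF _ _)).trans ?_)
  rw [← mul_add, h.invSqrt_proj, h.invSqrt_proj]
  exact mul_le_mul_of_nonneg_left (h.split_mul_le x y) hc

/-- The constant is `1 - 1/2 - 1/4`: on the kernel of `P` the gap gives `‖x‖² - ‖R x‖² ≥ ‖x‖² / 2`,
and `close` costs a further `‖x‖² / 4`. -/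
theorem coercive (h : IsGappedPerturbation A P g E) {x : K} (hx : P x = 0) :
    1 / 4 * ‖x‖ ^ 2 ≤ ‖g (invSqrt A x) (invSqrt A x) - E * ⟪invSqrt A x, invSqrt A x⟫_ℂ‖ := by
  have h1 := h.close x x
  have h2 := h.gap x hx
  have e : ∀ z : K, ⟪z, z⟫_ℂ = ((‖z‖ ^ 2 : ℝ) : ℂ) := fun z => by
    rw [inner_self_eq_norm_sq_to_K]
    norm_cast
  rw [e x, e (invSqrt A x), ← Complex.ofReal_sub] at h1
  have h3 := norm_sub_norm_le (((‖x‖ ^ 2 - ‖invSqrt A x‖ ^ 2 : ℝ) : ℂ))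
    (g (invSqrt A x) (invSqrt A x) - E * ((‖invSqrt A x‖ ^ 2 : ℝ) : ℂ))
  rw [norm_sub_rev ((‖x‖ ^ 2 - ‖invSqrt A x‖ ^ 2 : ℝ) : ℂ), Complex.norm_real, Real.norm_eq_abs] at h3
  have h4 := le_abs_self (‖x‖ ^ 2 - ‖invSqrt A x‖ ^ 2)
  rw [e (invSqrt A x)]
  nlinarith

/-- The difference of two solutions is an admissible test vector for itself, so coercivity makes it
vanish. -/
theorem offDiagSolution_unique (h : IsGappedPerturbation A P g E) {T T' : K →L[ℂ] K}
    (hT : IsOffDiagSolution A P g E F T) (hT' : IsOffDiagSolution A P g E F T') : T = T' := by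
  ext ψ
  obtain ⟨hm, hP, hs⟩ := hT ψ
  obtain ⟨hm', hP', hs'⟩ := hT' ψ
  obtain ⟨x, hx⟩ := mem_formDomain_iff.1 (Submodule.sub_mem _ hm hm')
  have hPx : P x = 0 := by rw [← h.proj_invSqrt, hx, map_sub, hP, hP', sub_self]
  have hPd : P (T ψ - T' ψ) = 0 := by rw [map_sub, hP, hP', sub_self]
  have h1 := h.coercive hPx
  rw [hx] at h1
  have hd := Submodule.sub_mem _ hm hm'
  have h2 : g (T ψ - T' ψ) (T ψ - T' ψ) - E * ⟪T ψ - T' ψ, T ψ - T' ψ⟫_ℂ = 0 := by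
    have a := hs _ hd hPd
    have b := hs' _ hd hPd
    rw [h.symm.sub_right hd hm hm', inner_sub_right]
    linear_combination a - b
  rw [h2, norm_zero] at h1
  have h3 : x = 0 := by
    rw [← norm_eq_zero]
    nlinarith [norm_nonneg x]
  rw [h3, map_zero] at hx
  exact sub_eq_zero.1 hx.symm

/-- Lax–Milgram on the range of `P⁺` for the bounded operator of the form `R (G - E) R`. The
solution is produced as `R T`, which yields the bound on `(A + 1)^{1/2}` times the solution. -/
theorem exists_offDiagSolution (h : IsGappedPerturbation A P g E)
    (hF : IsSymmForm (formDomain A) F) (hb : FormBound A F c) (hc : 0 ≤ c) :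
    ∃ T : K →L[ℂ] K, ‖T‖ ≤ 4 * c ∧ (∀ x, P (T x) = 0) ∧ (∀ x, T (P x) = T x) ∧
      IsOffDiagSolution A P g E F ((invSqrt A).comp T) := by
  obtain ⟨W, hW⟩ := hb.exists_operator hF
  let g' : Form K := fun φ ψ => g φ ψ + -E * ⟪φ, ψ⟫_ℂ
  have hg' : IsSymmForm (formDomain A) g' := by
    refine h.symm.add (IsSymmForm.smul ⟨?_, ?_, ?_⟩ (by rw [star_neg, h.real]))
    · intros; rw [inner_add_right]
    · intros; rw [inner_smul_right]
    · intro φ _ ψ _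
      exact (inner_conj_symm _ _).symm
  have hg'b : FormBound A g' (1 / 4 + 2) := by
    intro x y
    have h1 := h.close x y
    have h2 : ‖⟪x, y⟫_ℂ‖ ≤ ‖x‖ * ‖y‖ := norm_inner_le_norm x y
    have h3 : ‖⟪invSqrt A x, invSqrt A y⟫_ℂ‖ ≤ ‖x‖ * ‖y‖ :=
      (norm_inner_le_norm _ _).trans (mul_le_mul (h.norm_le x) (h.norm_le y) (norm_nonneg _)
        (norm_nonneg _))
    have e : g' (invSqrt A x) (invSqrt A y) = (g (invSqrt A x) (invSqrt A y) -
      E * ⟪invSqrt A x, invSqrt A y⟫_ℂ - (⟪x, y⟫_ℂ - ⟪invSqrt A x, invSqrt A y⟫_ℂ)) + (⟪x, y⟫_ℂ -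
        ⟪invSqrt A x, invSqrt A y⟫_ℂ) := by
      simp only [g']
      ring
    rw [e]
    refine (norm_add_le _ _).trans ((add_le_add h1 (norm_sub_le _ _)).trans ?_)
    linarith
  obtain ⟨B, hB⟩ := hg'b.exists_operator hg'
  let Pp : K →L[ℂ] K := 1 - P
  have hPp : ∀ x, Pp x = x - P x := fun x => rfl
  -- Adding `P` to the compression to `P⁺` makes the operator coercive on the whole space, so it can
  -- be inverted without passing to a subspace.
  let B' : K →L[ℂ] K := P + Pp.comp (B.comp Pp)
  have hB' : ∀ x, B' x = P x + Pp (B (Pp x)) := fun x => rfl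
  have hPpP : ∀ x y, ⟪Pp x, y⟫_ℂ = ⟪x, Pp y⟫_ℂ := fun x y => by
    rw [hPp, hPp, inner_sub_left, inner_sub_right, h.proj_inner]
  have hco : ∀ x, P x = 0 → 1 / 4 * ‖x‖ ^ 2 ≤ (⟪x, B x⟫_ℂ).re := by
    intro x hx
    rw [hB]
    have h1 := h.close x x
    have h2 := h.gap x hx
    have h3 := (Complex.abs_re_le_norm _).trans h1
    have e : ∀ z : K, ⟪z, z⟫_ℂ = ((‖z‖ ^ 2 : ℝ) : ℂ) := fun z => by
      rw [inner_self_eq_norm_sq_to_K]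
      norm_cast
    have e1 : g' (invSqrt A x) (invSqrt A x) = g (invSqrt A x) (invSqrt A x) -
      E * ⟪invSqrt A x, invSqrt A x⟫_ℂ := by
        simp only [g']
        ring
    rw [← e1, e x, e (invSqrt A x), ← Complex.ofReal_sub, Complex.sub_re, Complex.ofReal_re] at h3
    have := (abs_le.1 h3).1
    nlinarith
  have hunit : IsUnit B' := by
    refine ContinuousLinearMap.isUnit_of_forall_le_norm_inner_map B' (c := 1 / 4) (by norm_num)
      fun x => ?_
    have h1 := hco (Pp x) (h.proj_sub x)
    have h2 := h.norm_sq_split x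
    rw [← norm_inner_symm, hB', inner_add_right, ← hPpP, ← h.proj_idem, ← h.proj_inner]
    have e : (⟪P x, P x⟫_ℂ).re = ‖P x‖ ^ 2 := inner_self_eq_norm_sq (𝕜 := ℂ) (P x)
    refine le_trans ?_ ((le_abs_self _).trans (Complex.abs_re_le_norm _))
    rw [Complex.add_re, e, h2, ← hPp]
    have : ((1 / 4 : NNReal) : ℝ) = 1 / 4 := by norm_num
    rw [this]
    nlinarith [sq_nonneg ‖P x‖]
  obtain ⟨u, hu⟩ := hunit
  let U : K →L[ℂ] K := ((u⁻¹ : (K →L[ℂ] K)ˣ) : K →L[ℂ] K)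
  have hU : ∀ x, B' (U x) = x := by
    intro x
    have : (u : K →L[ℂ] K) * U = 1 := u.mul_inv
    rw [hu] at this
    exact congrArg (fun T : K →L[ℂ] K => T x) this
  let T : K →L[ℂ] K := U.comp (Pp.comp (W.comp P))
  have hT : ∀ x, T x = U (Pp (W (P x))) := fun x => rfl
  have hBT : ∀ x, B' (T x) = Pp (W (P x)) := fun x => hU _
  have hPPp : ∀ x, P (Pp x) = 0 := h.proj_sub
  have hPT : ∀ x, P (T x) = 0 := by
    intro x
    have := congrArg P (hBT x)
    rwa [hB', map_add, h.proj_idem, hPPp, hPPp, add_zero] at this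
  have hPpT : ∀ x, Pp (T x) = T x := fun x => by rw [hPp, hPT, sub_zero]
  have hsol : ∀ x y, P x = 0 → ⟪x, B (T y)⟫_ℂ = ⟪x, W (P y)⟫_ℂ := by
    intro x y hx
    have e := hBT y
    rw [hB', hPT, zero_add, hPpT] at e
    have hx' : Pp x = x := by rw [hPp, hx, sub_zero]
    rw [← hx', hPpP, hPpP, e]
  refine ⟨T, ?_, hPT, fun x => by rw [hT, hT, h.proj_idem], fun ψ => ⟨invSqrt_mem _, ?_, ?_⟩⟩
  -- Testing the equation with `T x` gives `‖T x‖² / 4 ≤ c ‖T x‖ ‖P x‖`.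
  · refine T.opNorm_le_bound (by positivity) fun x => ?_
    have h1 := hco (T x) (hPT x)
    rw [hsol _ _ (hPT x), hW] at h1
    have h2 := h1.trans (((le_abs_self _).trans (Complex.abs_re_le_norm _)).trans (hb _ _))
    have h3 := h.norm_proj_le x
    have h0 := norm_nonneg (T x)
    rcases h0.eq_or_lt with h4 | h4
    · rw [← h4]
      positivity
    · refine le_of_mul_le_mul_left ?_ h4
      nlinarith [mul_le_mul_of_nonneg_left h3 (mul_nonneg hc h0)]
  · rw [ContinuousLinearMap.comp_apply, h.proj_invSqrt, hPT]
  · intro φ hφ hPφ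
    obtain ⟨x, rfl⟩ := mem_formDomain_iff.1 hφ
    rw [h.proj_invSqrt] at hPφ
    have e := hsol x ψ hPφ
    rw [hB, hW, h.invSqrt_proj] at e
    rw [ContinuousLinearMap.comp_apply, ← e]
    simp only [g']
    ring

theorem existsUnique_offDiagSolution (h : IsGappedPerturbation A P g E)
    (hF : IsSymmForm (formDomain A) F) (hb : FormBound A F c) (hc : 0 ≤ c) :
    ∃! T : K →L[ℂ] K, IsOffDiagSolution A P g E F T := by
  obtain ⟨T, -, -, -, hT⟩ := h.exists_offDiagSolution hF hb hc
  exact ⟨_, hT, fun T' hT' => h.offDiagSolution_unique hT' hT⟩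

/-- The generator `S = T - T*` is antisymmetric, factors through `(A + 1)^{-1/2}`, and
`[S, G] = -(P⁺ F P⁻ + P⁻ F P⁺)`. -/
theorem generator_spec (h : IsGappedPerturbation A P g E)
    (hF : IsSymmForm (formDomain A) F) (hb : FormBound A F c) (hc : 0 ≤ c) :
    (generator A P g E F).adjoint = -generator A P g E F ∧
    (∃ S' : K →L[ℂ] K, ‖S'‖ ≤ 8 * c ∧ ∀ x, generator A P g E F x = invSqrt A (S' x)) ∧
    ∀ φ ∈ formDomain A, ∀ ψ ∈ formDomain A, adForm (generator A P g E F) g φ ψ =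
      -(F (φ - P φ) (P ψ) + F (P φ) (ψ - P ψ)) := by
  obtain ⟨T', hn, hPT, hTP, hT⟩ := h.exists_offDiagSolution hF hb hc
  set T := (invSqrt A).comp T' with hTdef
  have heq : offDiagSolution A P g E F = T := by
    have hex : ∃ T, IsOffDiagSolution A P g E F T := ⟨T, hT⟩
    unfold offDiagSolution
    rw [dif_pos hex]
    exact h.offDiagSolution_unique hex.choose_spec hT
  have hS : generator A P g E F = T - T.adjoint := by unfold generator; rw [heq]
  have hSadj : (generator A P g E F).adjoint = -generator A P g E F := by
    rw [hS, map_sub, ContinuousLinearMap.adjoint_adjoint, neg_sub]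
  -- `T P = T`, hence `T* = P T*`; as `R P = P`, the adjoint also factors through `R`, with itself
  -- as second factor.
  have hTadj : ∀ x, T.adjoint x = P (T.adjoint x) := by
    intro x
    refine ext_inner_left ℂ fun y => ?_
    rw [← h.proj_inner, ContinuousLinearMap.adjoint_inner_right,
      ContinuousLinearMap.adjoint_inner_right, hTdef, ContinuousLinearMap.comp_apply,
      ContinuousLinearMap.comp_apply, hTP]
  have hTadj' : ∀ x, T.adjoint x = invSqrt A (T.adjoint x) := by
    intro x
    rw [hTadj, h.invSqrt_proj]
  have hSm : ∀ x, generator A P g E F x = invSqrt A ((T' - T.adjoint) x) := by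
    intro x
    rw [hS, sub_apply, sub_apply, map_sub, ← hTadj']
    rfl
  have hmem : ∀ x, generator A P g E F x ∈ formDomain A := fun x => by
    rw [hSm]
    exact invSqrt_mem _
  refine ⟨hSadj, ⟨T' - T.adjoint, ?_, hSm⟩, ?_⟩
  · have h1 : ‖T‖ ≤ 4 * c := T.opNorm_le_bound (by positivity) fun x =>
      (h.norm_le _).trans ((T'.le_opNorm x).trans (by gcongr))
    refine (norm_sub_le _ _).trans ?_
    rw [LinearIsometryEquiv.norm_map]
    linarith
  -- The summand `T*` of `S` has range in the vacuum, where `G` acts as `E`; only the equation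
  -- solved by `T` contributes beyond `E`.
  · have key : ∀ φ ∈ formDomain A, ∀ ψ ∈ formDomain A, g φ (generator A P g E F ψ) =
        E * ⟪φ, generator A P g E F ψ⟫_ℂ + F (φ - P φ) (P ψ) := by
      intro φ hφ ψ hψ
      have hm := (hT ψ).1
      have hPφ := h.proj_mem φ
      have hφ' := Submodule.sub_mem _ hφ hPφ
      have hPT' := (hT ψ).2.1
      have hmadj : T.adjoint ψ ∈ formDomain A := by
        rw [hTadj]
        exact h.proj_mem _
      have h1 := (hT ψ).2.2 _ hφ' (h.proj_sub φ)
      have h2 : g (P φ) (T ψ) = 0 := by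
        rw [h.symm.symm _ hPφ _ hm, h.vacuum _ hm, ← h.proj_inner, hPT', inner_zero_left,
          mul_zero, star_zero]
      have h3 : ⟪P φ, T ψ⟫_ℂ = 0 := by rw [h.proj_inner, hPT', inner_zero_right]
      have h4 : g φ (T ψ) = E * ⟪φ, T ψ⟫_ℂ + F (φ - P φ) (P ψ) := by
        rw [h.symm.sub_left hφ hPφ hm, h2, inner_sub_left, h3] at h1
        linear_combination h1
      have h5 : g φ (T.adjoint ψ) = E * ⟪φ, T.adjoint ψ⟫_ℂ := by
        rw [hTadj, h.vacuum _ hφ]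
      rw [hS, sub_apply, h.symm.sub_right hφ hm hmadj, h4, h5, inner_sub_right]
      ring
    intro φ hφ ψ hψ
    have hmφ := hmem φ
    have hPφ := h.proj_mem φ
    have hPψ := h.proj_mem ψ
    unfold adForm
    rw [hSadj, neg_apply, h.symm.neg_left hmφ hψ, key _ hφ _ hψ, h.symm.symm _ hmφ _ hψ,
      key _ hψ _ hφ, star_add, star_mul', h.real,
      ← hF.symm _ hPφ _ (Submodule.sub_mem _ hψ hPψ)]
    -- Antisymmetry of `S` cancels the terms proportional to `E`, so no bound on the energy is ever
    -- needed.
    have e : star ⟪ψ, generator A P g E F φ⟫_ℂ = -⟪φ, generator A P g E F ψ⟫_ℂ := by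
      rw [RCLike.star_def, inner_conj_symm, ← ContinuousLinearMap.adjoint_inner_right, hSadj,
        neg_apply, inner_neg_right]
    rw [e]
    ring

end IsGappedPerturbation

end OffDiag


/-! ### The majorant of the Lie–Schwinger series -/

section Majorant

/-- Sums over compositions are dominated by powers of sums. -/
theorem sum_composition_le {u : ℕ → ℝ} (hu : ∀ i, 0 ≤ u i) {s : Finset ℕ} {m n M : ℕ}
    (hs : ∀ j ∈ s, ∀ c : Composition j, m ≤ c.length →
      c.length ≤ n ∧ ∀ b ∈ c.blocks, b ≤ M) :
    ∑ j ∈ s, ∑ c : Composition j with m ≤ c.length,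
        ((c.length.factorial : ℝ))⁻¹ * (c.blocks.map u).prod ≤
      ∑ p ∈ Finset.Icc m n, ((p.factorial : ℝ))⁻¹ * (∑ i ∈ Finset.Icc 1 M, u i) ^ p := by
  classical
  have hr : ∀ p : ℕ, ((p.factorial : ℝ))⁻¹ * (∑ i ∈ Finset.Icc 1 M, u i) ^ p =
      ∑ x ∈ Fintype.piFinset fun _ : Fin p => Finset.Icc 1 M,
        ((p.factorial : ℝ))⁻¹ * ∏ i, u (x i) := by
    intro p
    have h1 := Finset.prod_univ_sum (fun _ : Fin p => Finset.Icc 1 M) (fun _ i => u i)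
    rw [Finset.prod_const, Finset.card_univ, Fintype.card_fin] at h1
    rw [h1, Finset.mul_sum]
  simp only [hr]
  rw [Finset.sum_sigma', Finset.sum_sigma']
  -- A composition is determined by its length and its blocks, so the sum is part of the expansion
  -- of the powers `(∑ u)^p`, all of whose terms are nonnegative.
  let f : (Σ j, Composition j) → Σ p, (Fin p → ℕ) := fun c => ⟨c.2.length, c.2.blocksFun⟩
  have hf : Function.Injective f := by
    intro c c' h
    rw [Composition.sigma_eq_iff_blocks_eq, ← Composition.ofFn_blocksFun,
      ← Composition.ofFn_blocksFun]
    exact congrArg (fun q : Σ p, (Fin p → ℕ) => List.ofFn q.2) h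
  have hval : ∀ c : Σ j, Composition j, ((c.2.length.factorial : ℝ))⁻¹ * (c.2.blocks.map u).prod =
      (((f c).1.factorial : ℝ))⁻¹ * ∏ i, u ((f c).2 i) := by
    intro c
    rw [← Composition.ofFn_blocksFun, List.map_ofFn, List.prod_ofFn]
    rfl
  rw [Finset.sum_congr rfl fun c _ => hval c, ← Finset.sum_image (s := s.sigma _) (g := f)
    (f := fun q : Σ p, (Fin p → ℕ) => ((q.1.factorial : ℝ))⁻¹ * ∏ i, u (q.2 i)) hf.injOn]
  refine Finset.sum_le_sum_of_subset_of_nonneg ?_ fun q _ _ =>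
    mul_nonneg (by positivity) (Finset.prod_nonneg fun i _ => hu _)
  intro q hq
  obtain ⟨⟨j, c⟩, hc, rfl⟩ := Finset.mem_image.1 hq
  rw [Finset.mem_sigma, Finset.mem_filter] at hc
  obtain ⟨h1, h2⟩ := hs j hc.1 c hc.2.2
  rw [Finset.mem_sigma, Finset.mem_Icc, Fintype.mem_piFinset]
  refine ⟨⟨hc.2.2, h1⟩, fun i => Finset.mem_Icc.2 ⟨c.one_le_blocksFun i, h2 _ ?_⟩⟩
  exact c.blocksFun_mem_blocks i

/-- Another block of size at least 1 remains. Hence `V_j` involves only indices below `j`. -/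
theorem composition_blocks_lt {j : ℕ} (c : Composition j) (hlen : 2 ≤ c.length) {r : ℕ}
    (hr : r ∈ c.blocks) : r < j := by
  have hsum := List.sum_erase hr
  rw [c.blocks_sum] at hsum
  have hne : c.blocks.erase r ≠ [] := by
    intro h0
    have h1 := List.length_erase_of_mem hr
    rw [h0] at h1
    have h2 : 2 ≤ c.blocks.length := hlen
    simp only [List.length_nil] at h1
    omega
  obtain ⟨s, hs⟩ := List.exists_mem_of_ne_nil _ hne
  have hs1 : 0 < s := c.blocks_pos (List.mem_of_mem_erase hs)
  have hs2 := List.single_le_sum (fun _ _ => Nat.zero_le _) s hs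
  omega

theorem composition_blocks_le {j : ℕ} (c : Composition j) {r : ℕ} (hr : r ∈ c.blocks) :
    r ≤ j := by
  have hs2 := List.single_le_sum (fun _ _ => Nat.zero_le _) r hr
  rwa [c.blocks_sum] at hs2

/-- From `exp x - 1 - x ≤ x²` on `[0, 1]`; the term `p = 1` then gives `x + x² ≤ 2 x`. -/
theorem sum_pow_div_factorial_le {x : ℝ} (hx : 0 ≤ x) (hx1 : x ≤ 1) (n : ℕ) :
    ∑ p ∈ Finset.Icc 2 n, ((p.factorial : ℝ))⁻¹ * x ^ p ≤ x ^ 2 ∧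
      ∑ p ∈ Finset.Icc 1 n, ((p.factorial : ℝ))⁻¹ * x ^ p ≤ 2 * x := by
  have h0 := Real.sum_le_exp_of_nonneg hx (n + 2)
  have h1 := (abs_le.1 (Real.abs_exp_sub_one_sub_id_le (x := x) (by rwa [abs_of_nonneg hx]))).2
  have e : ∑ p ∈ Finset.Icc 2 n, ((p.factorial : ℝ))⁻¹ * x ^ p ≤
      ∑ i ∈ Finset.range (n + 2), x ^ i / (i.factorial : ℝ) - 1 - x := by
    rw [Finset.range_eq_Ico, Finset.sum_eq_sum_Ico_succ_bot (by omega),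
      Finset.sum_eq_sum_Ico_succ_bot (by omega)]
    simp only [pow_zero, Nat.factorial_zero, Nat.cast_one, zero_add, pow_one, Nat.factorial_one,
      div_one]
    have : ∑ p ∈ Finset.Icc 2 n, ((p.factorial : ℝ))⁻¹ * x ^ p ≤
        ∑ p ∈ Finset.Ico (1 + 1) (n + 2), x ^ p / (p.factorial : ℝ) := by
      simp only [div_eq_inv_mul]
      refine Finset.sum_le_sum_of_subset_of_nonneg (fun p hp => ?_) fun p _ _ => by positivity
      rw [Finset.mem_Icc] at hp
      rw [Finset.mem_Ico]
      omega
    linarith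
  have h2 : ∑ p ∈ Finset.Icc 2 n, ((p.factorial : ℝ))⁻¹ * x ^ p ≤ x ^ 2 := by linarith
  refine ⟨h2, ?_⟩
  rcases Nat.lt_or_ge n 1 with hn | hn
  · obtain rfl : n = 0 := by omega
    simpa using hx
  · have e2 : Finset.Icc 1 n = insert 1 (Finset.Icc 2 n) := by
      ext p
      simp only [Finset.mem_Icc, Finset.mem_insert]
      omega
    rw [e2, Finset.sum_insert (by simp)]
    simp only [Nat.factorial_one, Nat.cast_one, inv_one, pow_one, one_mul]
    nlinarith

theorem prod_map_mul_pow (u : ℕ → ℝ) (t : ℝ) (l : List ℕ) :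
    (l.map fun r => t ^ r * u r).prod = t ^ l.sum * (l.map u).prod := by
  induction l with
  | nil => simp
  | cons r l ih =>
    rw [List.map_cons, List.prod_cons, ih, List.map_cons, List.prod_cons, List.sum_cons, pow_add]
    ring

/-- The recursive majorant of `‖V_j‖` in terms of `v_r`, `r < j`. -/
def majorant (v : ℕ → ℝ) (j : ℕ) : ℝ :=
  (∑ c : Composition j with 2 ≤ c.length,
      ((c.length.factorial : ℝ))⁻¹ * (1 / 16 * (c.blocks.map fun r => 16 * v r).prod)) +
    ∑ c : Composition (j - 1) with 1 ≤ c.length,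
      ((c.length.factorial : ℝ))⁻¹ * ((c.blocks.map fun r => 16 * v r).prod * v 1)

/-- Let `f` be the sum up to `n`. Summing the recursion bounds the sum up to `n + 1` by `t v₁ + (16
f)² / 16 + t v₁ · 2 · 16 f`. Inserting `f ≤ 2 t v₁` gives `t v₁ (1 + 128 t v₁)`, which is at most `2
t v₁`; this fixes the threshold `1/128`. -/
theorem sum_pow_mul_le {v : ℕ → ℝ} (hv : ∀ j, 0 ≤ v j) (hv1 : v 1 ≤ 1)
    (hrec : ∀ j, 2 ≤ j → v j ≤ majorant v j) {t : ℝ} (ht : 0 < t) (ht' : t < 1 / 128) (n : ℕ) :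
    ∑ j ∈ Finset.Icc 1 n, t ^ j * v j ≤ 2 * (t * v 1) := by
  induction n with
  | zero => simpa using mul_nonneg ht.le (hv 1)
  | succ n ih =>
    have hv0 := hv 1
    have h0 : 0 ≤ ∑ j ∈ Finset.Icc 1 n, t ^ j * v j :=
      Finset.sum_nonneg fun j _ => mul_nonneg (by positivity) (hv j)
    set f := ∑ j ∈ Finset.Icc 1 n, t ^ j * v j with hf
    have hsplit : Finset.Icc 1 (n + 1) = insert 1 (Finset.Icc 2 (n + 1)) := by
      ext p
      simp only [Finset.mem_Icc, Finset.mem_insert]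
      omega
    set u : ℕ → ℝ := fun r => t ^ r * (16 * v r) with hu
    have hu0 : ∀ i, 0 ≤ u i := fun i => mul_nonneg (by positivity) (mul_nonneg (by norm_num) (hv i))
    have hsum : ∑ i ∈ Finset.Icc 1 n, u i = 16 * f := by
      rw [hf, Finset.mul_sum]
      refine Finset.sum_congr rfl fun i _ => ?_
      simp only [hu]
      ring
    have hX : 16 * f ≤ 1 := by nlinarith
    -- For `j ≤ n + 1` and at least two blocks, every block is at most `n`, so the induction
    -- hypothesis controls all of them.
    have h1 : ∑ j ∈ Finset.Icc 2 (n + 1), ∑ c : Composition j with 2 ≤ c.length,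
        ((c.length.factorial : ℝ))⁻¹ * (c.blocks.map u).prod ≤ (16 * f) ^ 2 := by
      refine (sum_composition_le hu0 (n := n + 1) (M := n) fun j hj c hc => ?_).trans ?_
      · rw [Finset.mem_Icc] at hj
        exact ⟨c.length_le.trans hj.2, fun b hb => by
          have := composition_blocks_lt c hc hb
          omega⟩
      · rw [hsum]
        exact (sum_pow_div_factorial_le (by positivity) hX _).1
    have h2 : ∑ j ∈ Finset.Icc 1 n, ∑ c : Composition j with 1 ≤ c.length,
        ((c.length.factorial : ℝ))⁻¹ * (c.blocks.map u).prod ≤ 2 * (16 * f) := by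
      refine (sum_composition_le hu0 (n := n) (M := n) fun j hj c hc => ?_).trans ?_
      · rw [Finset.mem_Icc] at hj
        exact ⟨c.length_le.trans hj.2, fun b hb => (composition_blocks_le c hb).trans hj.2⟩
      · rw [hsum]
        exact (sum_pow_div_factorial_le (by positivity) hX _).2
    have hprod : ∀ {j} (c : Composition j), (c.blocks.map u).prod =
        t ^ j * (c.blocks.map fun r => 16 * v r).prod := fun {j} c => by
      rw [hu, prod_map_mul_pow (fun r => 16 * v r), c.blocks_sum]
    -- `t ^ j` is distributed over the blocks. In the second sum the blocks add up to `j - 1`, and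
    -- the spare `t` joins `v 1`.
    have h3 : ∑ j ∈ Finset.Icc 2 (n + 1), t ^ j * majorant v j =
        1 / 16 * (∑ j ∈ Finset.Icc 2 (n + 1), ∑ c : Composition j with 2 ≤ c.length,
          ((c.length.factorial : ℝ))⁻¹ * (c.blocks.map u).prod) +
        t * v 1 * ∑ j ∈ Finset.Icc 1 n, ∑ c : Composition j with 1 ≤ c.length,
          ((c.length.factorial : ℝ))⁻¹ * (c.blocks.map u).prod := by
      have hshift : ∑ j ∈ Finset.Icc 2 (n + 1), (t ^ j *
          ∑ c : Composition (j - 1) with 1 ≤ c.length,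
            ((c.length.factorial : ℝ))⁻¹ * ((c.blocks.map fun r => 16 * v r).prod * v 1)) =
          ∑ j ∈ Finset.Icc 1 n, (t ^ (j + 1) *
          ∑ c : Composition j with 1 ≤ c.length,
            ((c.length.factorial : ℝ))⁻¹ * ((c.blocks.map fun r => 16 * v r).prod * v 1)) := by
        symm
        refine Finset.sum_bij (fun j _ => j + 1) ?_ ?_ ?_ ?_
        · intro j hj
          rw [Finset.mem_Icc] at hj ⊢
          omega
        · intro a _ b _ hab
          omega
        · intro j hj
          rw [Finset.mem_Icc] at hj
          exact ⟨j - 1, Finset.mem_Icc.2 (by omega), by omega⟩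
        · intro j hj
          rfl
      simp only [majorant, mul_add, Finset.sum_add_distrib]
      rw [hshift]
      simp only [Finset.mul_sum, hprod]
      congr 1
      · refine Finset.sum_congr rfl fun j _ => Finset.sum_congr rfl fun c _ => ?_
        ring
      · refine Finset.sum_congr rfl fun j _ => Finset.sum_congr rfl fun c _ => ?_
        ring
    rw [hsplit, Finset.sum_insert (by simp), pow_one]
    have h4 : ∑ j ∈ Finset.Icc 2 (n + 1), t ^ j * v j ≤
        ∑ j ∈ Finset.Icc 2 (n + 1), t ^ j * majorant v j := by
      refine Finset.sum_le_sum fun j hj => ?_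
      exact mul_le_mul_of_nonneg_left (hrec j (Finset.mem_Icc.1 hj).1) (by positivity)
    rw [h3] at h4
    have h5 : t * v 1 * ∑ j ∈ Finset.Icc 1 n, ∑ c : Composition j with 1 ≤ c.length,
        ((c.length.factorial : ℝ))⁻¹ * (c.blocks.map u).prod ≤ t * v 1 * (2 * (16 * f)) :=
      mul_le_mul_of_nonneg_left h2 (by positivity)
    have h6 : t * v 1 ≤ 1 / 128 := by nlinarith
    have h7 : 0 ≤ t * v 1 := by positivity
    nlinarith

end Majorant

/-! ### Bounds on the terms of the Lie–Schwinger series -/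

section Terms

variable {K : Type*} [NormedAddCommGroup K] [InnerProductSpace ℂ K] [CompleteSpace K]
  {A : K →ₗ.[ℂ] K} {P : K →L[ℂ] K} {g V : Form K} {E : ℂ}

/-- `F` is a symmetric form with `‖F‖ ≤ c`. -/
structure IsBoundedForm (A : K →ₗ.[ℂ] K) (F : Form K) (c : ℝ) : Prop where
  symm : IsSymmForm (formDomain A) F
  nonneg : 0 ≤ c
  bound : FormBound A F c

/-- `S` is antisymmetric with `‖(A + 1)^{1/2} S‖ ≤ s`. -/
structure IsBoundedGenerator (A : K →ₗ.[ℂ] K) (S : K →L[ℂ] K) (s : ℝ) : Prop where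
  adjoint : S.adjoint = -S
  factor : ∃ S' : K →L[ℂ] K, ‖S'‖ ≤ s ∧ ∀ x, S x = invSqrt A (S' x)

theorem IsBoundedGenerator.mem {S : K →L[ℂ] K} {s : ℝ} (h : IsBoundedGenerator A S s) (x : K) :
    S x ∈ formDomain A := by
  obtain ⟨S', -, h'⟩ := h.factor
  rw [h']
  exact invSqrt_mem _

theorem IsBoundedForm.adForm (hR : ∀ x, ‖invSqrt A x‖ ≤ ‖x‖) {F : Form K} {c s : ℝ}
    (hF : IsBoundedForm A F c) {S : K →L[ℂ] K} (hS : IsBoundedGenerator A S s) :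
    IsBoundedForm A (adForm S F) (2 * s * c) := by
  obtain ⟨S', hn, h'⟩ := hS.factor
  have := hF.nonneg
  have hs : 0 ≤ s := (norm_nonneg _).trans hn
  exact ⟨hF.symm.adForm hS.adjoint hS.mem, by positivity,
    FormBound.adForm hF.symm hF.bound hF.nonneg hS.adjoint h' hR hn⟩

/-- Each commutator costs `2 · 8 v_r`: two terms, and `‖(A + 1)^{1/2} S_r‖ ≤ 8 v_r`. -/
theorem IsBoundedForm.nestedAd (hR : ∀ x, ‖invSqrt A x‖ ≤ ‖x‖) {F : Form K} {c : ℝ}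
    (hF : IsBoundedForm A F c) {S : ℕ → K →L[ℂ] K} {v : ℕ → ℝ} {l : List ℕ}
    (hS : ∀ r ∈ l, IsBoundedGenerator A (S r) (8 * v r)) :
    IsBoundedForm A (nestedAd S l F) ((l.map fun r => 16 * v r).prod * c) := by
  induction l with
  | nil => simpa [QuantumChain.nestedAd] using hF
  | cons r l ih =>
    have h1 := (ih fun r' hr' => hS r' (by simp [hr'])).adForm hR (hS r (by simp))
    have e : 2 * (8 * v r) * ((l.map fun r => 16 * v r).prod * c) =
        ((r :: l).map fun r => 16 * v r).prod * c := by
      rw [List.map_cons, List.prod_cons]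
      ring
    rw [e] at h1
    exact h1

/-- The last entry of the list is the innermost commutator. There `[S_r, G]` is minus the
off-diagonal part of `V_r`, of size `v_r` instead of `16 v_r` times a bound on `G`; this accounts
for the factor `1/16` and keeps `E` out of the estimate. -/
theorem IsGappedPerturbation.isBoundedForm_nestedAd (h : IsGappedPerturbation A P g E)
    {v : ℕ → ℝ} {l : List ℕ} (hl : l ≠ [])
    (hS : ∀ r ∈ l, IsBoundedGenerator A (lieS A P g E V r) (8 * v r))
    (hV : ∀ r ∈ l, IsBoundedForm A (lieV A P g E V r) (v r)) (hpos : ∀ r ∈ l, 1 ≤ r) :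
    IsBoundedForm A (nestedAd (lieS A P g E V) l g)
      (1 / 16 * (l.map fun r => 16 * v r).prod) := by
  obtain ⟨l', r, rfl⟩ := List.eq_nil_or_concat l |>.resolve_left hl
  have hr : r ∈ l'.concat r := by simp
  have hVr := hV r hr
  have hbase : IsBoundedForm A (QuantumChain.adForm (lieS A P g E V r) g) (v r) := by
    refine ⟨h.symm.adForm (hS r hr).adjoint (hS r hr).mem, hVr.nonneg, fun x y => ?_⟩
    have hsp := (h.generator_spec hVr.symm hVr.bound hVr.nonneg).2.2
    rw [lieS_eq A P g E V (hpos r hr), hsp _ (invSqrt_mem x) _ (invSqrt_mem y), norm_neg,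
      ← h.invSqrt_sub_proj, ← h.invSqrt_sub_proj, h.proj_invSqrt, h.proj_invSqrt,
      ← h.invSqrt_proj x, ← h.invSqrt_proj y]
    refine (norm_add_le _ _).trans ((add_le_add (hVr.bound _ _) (hVr.bound _ _)).trans ?_)
    rw [← mul_add, h.invSqrt_proj, h.invSqrt_proj]
    exact mul_le_mul_of_nonneg_left (h.split_mul_le' x y) hVr.nonneg
  have h1 := hbase.nestedAd h.norm_le (S := lieS A P g E V) (v := v) (l := l')
    fun r' hr' => hS r' (by simp [hr'])
  have e : nestedAd (lieS A P g E V) (l' ++ [r]) g =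
      nestedAd (lieS A P g E V) l' (QuantumChain.adForm (lieS A P g E V r) g) := by
    unfold nestedAd
    rw [List.foldr_append]
    rfl
  have e2 : 1 / 16 * ((l' ++ [r]).map fun r => 16 * v r).prod =
      (l'.map fun r => 16 * v r).prod * v r := by
    rw [List.map_append, List.prod_append]
    simp
    ring
  rw [List.concat_eq_append, e, e2]
  exact h1

theorem IsBoundedForm.sum {ι : Type*} (s : Finset ι) {f : ι → Form K} {b : ι → ℝ}
    (h : ∀ i ∈ s, IsBoundedForm A (f i) (b i)) :
    IsBoundedForm A (fun φ ψ => ∑ i ∈ s, f i φ ψ) (∑ i ∈ s, b i) :=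
  ⟨IsSymmForm.sum s fun i hi => (h i hi).symm, Finset.sum_nonneg fun i hi => (h i hi).nonneg,
    FormBound.sum s fun i hi => (h i hi).bound⟩

theorem IsBoundedForm.inv_factorial_mul {F : Form K} {b : ℝ} (h : IsBoundedForm A F b) (n : ℕ) :
    IsBoundedForm A (fun φ ψ => ((n.factorial : ℂ))⁻¹ * F φ ψ) (((n.factorial : ℝ))⁻¹ * b) := by
  have := h.nonneg
  refine ⟨h.symm.smul (by simp), by positivity, ?_⟩
  have h1 := h.bound.smul ((n.factorial : ℂ))⁻¹
  rwa [norm_inv, Complex.norm_natCast] at h1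

theorem IsGappedPerturbation.isBoundedGenerator_lieS (h : IsGappedPerturbation A P g E) {j : ℕ}
    (hj : 1 ≤ j) {c : ℝ} (hV : IsBoundedForm A (lieV A P g E V j) c) :
    IsBoundedGenerator A (lieS A P g E V j) (8 * c) := by
  rw [lieS_eq A P g E V hj]
  have := h.generator_spec hV.symm hV.bound hV.nonneg
  exact ⟨this.1, this.2.1⟩

theorem IsGappedPerturbation.isBoundedForm_lieV_majorant (h : IsGappedPerturbation A P g E)
    {v : ℕ → ℝ} {j : ℕ} (hj : 2 ≤ j)
    (hV : ∀ r, 1 ≤ r → r < j → IsBoundedForm A (lieV A P g E V r) (v r)) :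
    IsBoundedForm A (lieV A P g E V j) (majorant v j) := by
  have hV1 : IsBoundedForm A V (v 1) := by
    have := hV 1 le_rfl (by omega)
    unfold lieV potentialTerm at this
    rwa [if_pos rfl] at this
  have hS : ∀ r, 1 ≤ r → r < j → IsBoundedGenerator A (lieS A P g E V r) (8 * v r) :=
    fun r hr hrj => h.isBoundedGenerator_lieS hr (hV r hr hrj)
  have h1 := IsBoundedForm.sum (A := A)
    (Finset.univ.filter fun c : Composition j => 2 ≤ c.length)
    (f := fun c φ ψ => ((c.length.factorial : ℂ))⁻¹ *
      nestedAd (lieS A P g E V) c.blocks g φ ψ)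
    (b := fun c => ((c.length.factorial : ℝ))⁻¹ *
      (1 / 16 * (c.blocks.map fun r => 16 * v r).prod)) (fun c hc => by
    have hlen := (Finset.mem_filter.1 hc).2
    refine (h.isBoundedForm_nestedAd ?_ ?_ ?_ ?_).inv_factorial_mul _
    · intro h0
      have : c.length = 0 := by
        rw [← Composition.blocks_length, h0, List.length_nil]
      omega
    · exact fun r hr => hS r (c.blocks_pos hr) (composition_blocks_lt c hlen hr)
    · exact fun r hr => hV r (c.blocks_pos hr) (composition_blocks_lt c hlen hr)
    · exact fun r hr => c.blocks_pos hr)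
  have h2 := IsBoundedForm.sum (A := A)
    (Finset.univ.filter fun c : Composition (j - 1) => 1 ≤ c.length)
    (f := fun c φ ψ => ((c.length.factorial : ℂ))⁻¹ *
      nestedAd (lieS A P g E V) c.blocks V φ ψ)
    (b := fun c => ((c.length.factorial : ℝ))⁻¹ *
      ((c.blocks.map fun r => 16 * v r).prod * v 1)) (fun c hc => by
    refine (hV1.nestedAd h.norm_le fun r hr => hS r (c.blocks_pos hr) ?_).inv_factorial_mul _
    have := composition_blocks_le c hr
    omega)
  have e : lieV A P g E V j = fun φ ψ =>
      (∑ c : Composition j with 2 ≤ c.length,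
        ((c.length.factorial : ℂ))⁻¹ * nestedAd (lieS A P g E V) c.blocks g φ ψ) +
      ∑ c : Composition (j - 1) with 1 ≤ c.length,
        ((c.length.factorial : ℂ))⁻¹ * nestedAd (lieS A P g E V) c.blocks V φ ψ := by
    unfold lieV potentialTerm
    rw [if_neg (by omega)]
  rw [e]
  exact ⟨h1.symm.add h2.symm, add_nonneg h1.nonneg h2.nonneg, h1.bound.add h2.bound⟩

theorem lieV_one : lieV A P g E V 1 = V := by
  unfold lieV potentialTerm
  rw [if_pos rfl]

/-- Replaces an arbitrary bound by the weighted norm itself, so that the recursive inequality holds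
for the actual norms. -/
theorem IsBoundedForm.toReal {F : Form K} {c : ℝ} (hF : IsBoundedForm A F c) :
    weightedNorm A F < ⊤ ∧ (weightedNorm A F).toReal ≤ c ∧
      IsBoundedForm A F (weightedNorm A F).toReal := by
  have h1 := weightedNorm_le_of_formBound hF.nonneg hF.bound
  have h2 := h1.trans_lt ENNReal.ofReal_lt_top
  exact ⟨h2, ENNReal.toReal_le_of_le_ofReal hF.nonneg h1, hF.symm, ENNReal.toReal_nonneg,
    hF.symm.formBound_toReal h2⟩

/-- Finiteness only: the majorant at `j` is a finite expression in the norms of lower index. -/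
theorem IsGappedPerturbation.isBoundedForm_lieV (h : IsGappedPerturbation A P g E)
    (hsymm : IsSymmForm (formDomain A) V) (hV : weightedNorm A V < ⊤) {j : ℕ} (hj : 1 ≤ j) :
    IsBoundedForm A (lieV A P g E V j) (weightedNorm A (lieV A P g E V j)).toReal := by
  induction j using Nat.strong_induction_on with
  | _ j ih =>
    rcases hj.eq_or_lt with rfl | hj'
    · rw [lieV_one]
      exact ⟨hsymm, ENNReal.toReal_nonneg, hsymm.formBound_toReal hV⟩
    · exact (h.isBoundedForm_lieV_majorant hj'
        (v := fun j => (weightedNorm A (lieV A P g E V j)).toReal)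
        fun r hr hrj => ih r hrj hr).toReal.2.2

theorem IsGappedPerturbation.sum_weightedNorm_le (h : IsGappedPerturbation A P g E)
    (hsymm : IsSymmForm (formDomain A) V) (hV : weightedNorm A V ≤ 1) {t : ℝ} (ht : 0 < t)
    (ht' : t < 1 / 128) (n : ℕ) :
    ∑ j ∈ Finset.Icc 1 n, t ^ j * (weightedNorm A (lieV A P g E V j)).toReal ≤
      2 * (t * (weightedNorm A V).toReal) := by
  have hV' := hV.trans_lt ENNReal.one_lt_top
  have h1 := sum_pow_mul_le (v := fun j => (weightedNorm A (lieV A P g E V j)).toReal)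
    (fun j => ENNReal.toReal_nonneg) ?_ (fun j hj => ?_) ht ht' n
  · rwa [lieV_one] at h1
  · rw [lieV_one]
    exact ENNReal.toReal_le_of_le_ofReal zero_le_one (by rwa [ENNReal.ofReal_one])
  · exact (h.isBoundedForm_lieV_majorant hj
      fun r hr hrj => h.isBoundedForm_lieV hsymm hV' hr).toReal.2.1

end Terms


/-! ### Convergence of the Lie–Schwinger series -/

section Convergence

variable {K : Type*} [NormedAddCommGroup K] [InnerProductSpace ℂ K] [CompleteSpace K]
  {A : K →ₗ.[ℂ] K} {P : K →L[ℂ] K} {g V : Form K} {E : ℂ} {t : ℝ}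

theorem IsGappedPerturbation.summable_weightedNorm (h : IsGappedPerturbation A P g E)
    (hsymm : IsSymmForm (formDomain A) V) (hV : weightedNorm A V ≤ 1) (ht : 0 < t)
    (ht' : t < 1 / 128) :
    (Summable fun j : ℕ => t ^ j * (weightedNorm A (lieV A P g E V (j + 1))).toReal) ∧
      ∑' j : ℕ, t ^ j * (weightedNorm A (lieV A P g E V (j + 1))).toReal ≤
        2 * (weightedNorm A V).toReal := by
  have h0 : ∀ j : ℕ, 0 ≤ t ^ j * (weightedNorm A (lieV A P g E V (j + 1))).toReal :=
    fun j => mul_nonneg (by positivity) ENNReal.toReal_nonneg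
  have hb : ∀ n, ∑ j ∈ Finset.range n, t ^ j * (weightedNorm A (lieV A P g E V (j + 1))).toReal ≤
      2 * (weightedNorm A V).toReal := by
    intro n
    -- The majorant sum starts with `t ^ 1`, this series with `t ^ 0`; one factor `t` is cancelled.
    refine le_of_mul_le_mul_left ?_ ht
    have h1 := h.sum_weightedNorm_le hsymm hV ht ht' n
    have e : ∑ j ∈ Finset.Icc 1 n, t ^ j * (weightedNorm A (lieV A P g E V j)).toReal =
        t * ∑ j ∈ Finset.range n, t ^ j * (weightedNorm A (lieV A P g E V (j + 1))).toReal := by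
      rw [Finset.mul_sum, Finset.range_eq_Ico, ← Finset.Ico_add_one_right_eq_Icc,
        ← Finset.sum_Ico_add' _ 0 n 1]
      refine Finset.sum_congr rfl fun j _ => ?_
      ring
    rw [← e]
    linarith
  exact ⟨summable_of_sum_range_le h0 hb, Real.tsum_le_of_sum_range_le h0 hb⟩

theorem IsGappedPerturbation.isBoundedForm_diagPart (h : IsGappedPerturbation A P g E) {F : Form K}
    {c : ℝ} (hF : IsBoundedForm A F c) : IsBoundedForm A (diagPart P F) c :=
  ⟨hF.symm.diagPart h.proj_mem, hF.nonneg, h.formBound_diagPart hF.nonneg hF.bound⟩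

/-- The block-diagonal series converges absolutely in the weighted norm. -/
theorem IsGappedPerturbation.diagSeries_spec (h : IsGappedPerturbation A P g E)
    (hsymm : IsSymmForm (formDomain A) V) (hV : weightedNorm A V ≤ 1) (ht : 0 < t)
    (ht' : t < 1 / 128) :
    (∑' j : ℕ, ENNReal.ofReal (t ^ j) * weightedNorm A (diagPart P (lieV A P g E V (j + 1))) < ⊤) ∧
    Tendsto (fun n => weightedNorm A (diagSeries A P g E V t - diagPartialSum A P g E V t n))
      atTop (𝓝 0) ∧
    IsSymmForm (formDomain A) (diagSeries A P g E V t) ∧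
    weightedNorm A (diagSeries A P g E V t) ≤ 2 * weightedNorm A V := by
  have hV' := hV.trans_lt ENNReal.one_lt_top
  set v : ℕ → ℝ := fun j => (weightedNorm A (lieV A P g E V (j + 1))).toReal with hv
  obtain ⟨hsum, hle⟩ := h.summable_weightedNorm hsymm hV ht ht'
  have hD : ∀ j, IsBoundedForm A (diagPart P (lieV A P g E V (j + 1))) (v j) := fun j =>
    h.isBoundedForm_diagPart (h.isBoundedForm_lieV hsymm hV' (by omega))
  have hD' : ∀ j, IsBoundedForm A
      (fun φ ψ => (t : ℂ) ^ j * diagPart P (lieV A P g E V (j + 1)) φ ψ) (t ^ j * v j) := by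
    intro j
    have h1 := (hD j).bound.smul ((t : ℂ) ^ j)
    rw [norm_pow, Complex.norm_real, Real.norm_eq_abs, abs_of_pos ht] at h1
    exact ⟨(hD j).symm.smul (by simp), mul_nonneg (by positivity) (hD j).nonneg, h1⟩
  have hs : ∀ x y, Summable fun j : ℕ => (t : ℂ) ^ j *
      diagPart P (lieV A P g E V (j + 1)) (invSqrt A x) (invSqrt A y) := fun x y =>
    Summable.of_norm_bounded (hsum.mul_right (‖x‖ * ‖y‖)) fun j => (hD' j).bound x y
  -- The remainder is dominated by the tail of the convergent scalar series.
  have htail : ∀ n, FormBound A (diagSeries A P g E V t - diagPartialSum A P g E V t n)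
      (∑' j, t ^ (j + n) * v (j + n)) := by
    intro n x y
    have e : (diagSeries A P g E V t - diagPartialSum A P g E V t n) (invSqrt A x) (invSqrt A y) =
        ∑' j : ℕ, (t : ℂ) ^ (j + n) *
          diagPart P (lieV A P g E V (j + n + 1)) (invSqrt A x) (invSqrt A y) := by
      have := (hs x y).sum_add_tsum_nat_add n
      rw [Pi.sub_apply, Pi.sub_apply]
      unfold diagSeries diagPartialSum
      rw [← this, add_sub_cancel_left]
    rw [e, ← tsum_mul_right]
    have hsn : Summable fun j => t ^ (j + n) * v (j + n) * (‖x‖ * ‖y‖) :=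
      ((summable_nat_add_iff n).2 hsum).mul_right _
    exact tsum_of_norm_bounded hsn.hasSum fun j => (hD' (j + n)).bound x y
  have hnn : ∀ j, 0 ≤ t ^ j * v j := fun j => (hD' j).nonneg
  refine ⟨?_, ?_, ?_, ?_⟩
  · refine lt_of_le_of_lt (ENNReal.tsum_le_tsum (g := fun j => ENNReal.ofReal (t ^ j * v j))
      fun j => ?_) ?_
    · rw [ENNReal.ofReal_mul (by positivity)]
      gcongr
      exact weightedNorm_le_of_formBound (hD j).nonneg (hD j).bound
    · rw [← ENNReal.ofReal_tsum_of_nonneg hnn hsum]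
      exact ENNReal.ofReal_lt_top
  · have h1 : Tendsto (fun n => ENNReal.ofReal (∑' j, t ^ (j + n) * v (j + n))) atTop (𝓝 0) := by
      have := ENNReal.tendsto_ofReal (tendsto_sum_nat_add fun j => t ^ j * v j)
      rwa [ENNReal.ofReal_zero] at this
    refine tendsto_of_tendsto_of_tendsto_of_le_of_le tendsto_const_nhds h1 (fun n => zero_le)
      fun n => weightedNorm_le_of_formBound (tsum_nonneg fun j => hnn _) (htail n)
  · unfold diagSeries
    refine IsSymmForm.tsum (fun j => (hD' j).symm) fun φ hφ ψ hψ => ?_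
    obtain ⟨x, rfl⟩ := mem_formDomain_iff.1 hφ
    obtain ⟨y, rfl⟩ := mem_formDomain_iff.1 hψ
    exact hs x y
  · have h1 : FormBound A (diagSeries A P g E V t) (2 * (weightedNorm A V).toReal) := by
      refine FormBound.mono (c := ∑' j, t ^ j * v j) (fun x y => ?_) hle
      unfold diagSeries
      rw [← tsum_mul_right]
      exact tsum_of_norm_bounded (hsum.mul_right _).hasSum fun j => (hD' j).bound x y
    refine (weightedNorm_le_of_formBound (by positivity) h1).trans_eq ?_
    rw [ENNReal.ofReal_mul (by norm_num), ENNReal.ofReal_toReal hV'.ne]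
    norm_num

/-- The generators sum up to an operator `S` with `(A + 1)^{1/2} S` bounded. -/
theorem IsGappedPerturbation.lieSeries_spec (h : IsGappedPerturbation A P g E)
    (hsymm : IsSymmForm (formDomain A) V) (hV : weightedNorm A V ≤ 1) (ht : 0 < t)
    (ht' : t < 1 / 128) :
    (Summable fun j : ℕ => ‖(t : ℂ) ^ (j + 1) • lieS A P g E V (j + 1)‖) ∧
    ‖lieSeries A P g E V t‖ₑ ≤ ENNReal.ofReal (16 * t) * weightedNorm A V ∧
    ∃ T T' : K →L[ℂ] K,
      (∀ ψ, ∃ hm : lieSeries A P g E V t ψ ∈ (sqrtOp A).domain,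
        T ψ = sqrtOp A ⟨lieSeries A P g E V t ψ, hm⟩) ∧
      (∀ ψ : (sqrtOp A).domain, T' ψ = lieSeries A P g E V t (sqrtOp A ψ)) ∧
      ‖T'‖ = ‖T‖ ∧ ‖T‖ₑ ≤ ENNReal.ofReal (16 * t) * weightedNorm A V := by
  have hV' := hV.trans_lt ENNReal.one_lt_top
  have hex : ∃ R, IsInvSqrt A R := ⟨_, h.isInvSqrt⟩
  set v : ℕ → ℝ := fun j => (weightedNorm A (lieV A P g E V (j + 1))).toReal with hv
  obtain ⟨hsum, hle⟩ := h.summable_weightedNorm hsymm hV ht ht'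
  have hS : ∀ j, IsBoundedGenerator A (lieS A P g E V (j + 1)) (8 * v j) := fun j =>
    h.isBoundedGenerator_lieS (by omega) (h.isBoundedForm_lieV hsymm hV' (by omega))
  choose S' hn hS' using fun j => (hS j).factor
  have hSR : ∀ j, lieS A P g E V (j + 1) = (invSqrt A).comp (S' j) := fun j => by
    ext x
    rw [hS', ContinuousLinearMap.comp_apply]
  have hnt : ‖(t : ℂ)‖ = t := by rw [Complex.norm_real, Real.norm_eq_abs, abs_of_pos ht]
  have hRn : ‖invSqrt A‖ ≤ 1 := (invSqrt A).opNorm_le_bound zero_le_one fun x => by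
    rw [one_mul]
    exact h.norm_le x
  have hsum' : Summable fun j => 8 * t * (t ^ j * v j) := hsum.mul_left _
  have hb : ∀ j, ‖(t : ℂ) ^ (j + 1) • S' j‖ ≤ 8 * t * (t ^ j * v j) := by
    intro j
    rw [norm_smul, norm_pow, hnt]
    refine (mul_le_mul_of_nonneg_left (hn j) (by positivity)).trans_eq ?_
    ring
  have hRle : ∀ T : K →L[ℂ] K, ‖(invSqrt A).comp T‖ ≤ ‖T‖ := fun T =>
    ((invSqrt A).opNorm_comp_le T).trans
      ((mul_le_mul_of_nonneg_right hRn (norm_nonneg _)).trans_eq (one_mul _))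
  have hTs : Summable fun j => (t : ℂ) ^ (j + 1) • S' j := Summable.of_norm_bounded hsum' hb
  have hterm : ∀ j, (t : ℂ) ^ (j + 1) • lieS A P g E V (j + 1) =
      (invSqrt A).comp ((t : ℂ) ^ (j + 1) • S' j) := fun j => by
    rw [hSR, ContinuousLinearMap.comp_smul]
  -- `T` is `(A + 1)^{1/2} S`. Summing the factors `S'` first and applying `R` afterwards avoids
  -- interchanging the unbounded operator with the series.
  set T : K →L[ℂ] K := ∑' j, (t : ℂ) ^ (j + 1) • S' j with hT
  have hST : lieSeries A P g E V t = (invSqrt A).comp T := by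
    unfold lieSeries
    simp only [hterm]
    exact ((ContinuousLinearMap.compL ℂ K K K (invSqrt A)).map_tsum hTs).symm
  have hTn : ‖T‖ ≤ 16 * t * (weightedNorm A V).toReal := by
    refine (tsum_of_norm_bounded hsum'.hasSum hb).trans ?_
    rw [tsum_mul_left]
    refine (mul_le_mul_of_nonneg_left hle (by positivity)).trans_eq ?_
    ring
  have hTe : ∀ U : K →L[ℂ] K, ‖U‖ ≤ 16 * t * (weightedNorm A V).toReal →
      ‖U‖ₑ ≤ ENNReal.ofReal (16 * t) * weightedNorm A V := by
    intro U hU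
    rw [← ofReal_norm]
    refine (ENNReal.ofReal_le_ofReal hU).trans_eq ?_
    rw [ENNReal.ofReal_mul (by positivity), ENNReal.ofReal_toReal hV'.ne]
  have hsumS : Summable fun j : ℕ => ‖(t : ℂ) ^ (j + 1) • lieS A P g E V (j + 1)‖ :=
    Summable.of_nonneg_of_le (fun j => norm_nonneg _) (fun j => by
      rw [hterm]
      exact (hRle _).trans (hb j)) hsum'
  have hSadj : (lieSeries A P g E V t).adjoint = -lieSeries A P g E V t := by
    have h1 := ContinuousLinearMap.adjoint (𝕜 := ℂ) (E := K) (F := K)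
      |>.toContinuousLinearEquiv.toContinuousLinearMap.map_tsum hsumS.of_norm
    unfold lieSeries
    refine h1.trans ?_
    rw [← tsum_neg]
    refine tsum_congr fun j => ?_
    change ContinuousLinearMap.adjoint _ = _
    rw [map_smulₛₗ, (hS j).adjoint, smul_neg]
    simp
  -- From `S = R T` and `S* = -S` one gets `T* R = -S`, so `-T*` is the bounded extension of `S (A +
  -- 1)^{1/2}`.
  have hTadj : ∀ x, T.adjoint (invSqrt A x) = -lieSeries A P g E V t x := by
    intro x
    rw [← neg_apply, ← hSadj, hST]
    refine ext_inner_left ℂ fun y => ?_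
    rw [ContinuousLinearMap.adjoint_inner_right, ContinuousLinearMap.adjoint_inner_right,
      ContinuousLinearMap.comp_apply, h.isInvSqrt.inner_left]
  refine ⟨hsumS, hTe _ (by rw [hST]; exact (hRle T).trans hTn), T, -T.adjoint, fun ψ => ?_,
    fun ψ => ?_, ?_, hTe _ hTn⟩
  · have e : lieSeries A P g E V t ψ = invSqrt A (T ψ) := by rw [hST]; rfl
    rw [e]
    exact ⟨invSqrt_mem _, (sqrtOp_invSqrt hex _ _).symm⟩
  · obtain ⟨ψ, hψ⟩ := ψ
    obtain ⟨x, rfl⟩ := mem_formDomain_iff.1 hψ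
    rw [sqrtOp_invSqrt hex, neg_apply, hTadj, neg_neg]
  · rw [norm_neg, LinearIsometryEquiv.norm_map]

end Convergence


/-! ### Positive semidefinite kernels -/

section Kernels

open scoped ComplexOrder

/-- The Schur product theorem, iterated; the empty product is the Gram kernel of a constant. -/
theorem posSemidef_prod {X ι : Type*} (s : Finset ι) {k : ι → Matrix X X ℂ}
    (h : ∀ i ∈ s, (k i).PosSemidef) :
    (Matrix.of fun x y => ∏ i ∈ s, k i x y).PosSemidef := by
  induction s using Finset.cons_induction with
  | empty =>
    have h := gram_posSemidef (fun _ : X => (1 : ℂ))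
    have e : (Matrix.of fun x y : X => ∏ i ∈ (∅ : Finset ι), k i x y) =
        Matrix.gram ℂ (fun _ : X => (1 : ℂ)) := by
      ext x y
      simp [Matrix.gram_apply]
    rw [e]
    exact h
  | cons a s ha ih =>
    have h' := (h a (by simp)).hadamard (ih fun i hi => h i (by simp [hi]))
    have e : (Matrix.of fun x y : X => ∏ i ∈ Finset.cons a s ha, k i x y) =
        k a ⊙ (Matrix.of fun x y : X => ∏ i ∈ s, k i x y) := by
      ext x y
      simp only [Matrix.of_apply, Matrix.hadamard_apply, Finset.prod_cons]
    rw [e]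
    exact h'

theorem inner_linearCombination {X E : Type*} [SeminormedAddCommGroup E] [InnerProductSpace ℂ E]
    (v w : X → E) (c : X →₀ ℂ) :
    ⟪Finsupp.linearCombination ℂ v c, Finsupp.linearCombination ℂ w c⟫_ℂ =
      c.sum fun i ci => c.sum fun j cj => star ci * ⟪v i, w j⟫_ℂ * cj := by
  simp only [Finsupp.linearCombination_apply, Finsupp.sum, sum_inner]
  refine Finset.sum_congr rfl fun i _ => ?_
  rw [inner_sum]
  refine Finset.sum_congr rfl fun j _ => ?_
  simp only [inner_smul_left, inner_smul_right, RCLike.star_def]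
  ring

theorem re_inner_linearCombination_nonneg {X E : Type*} [SeminormedAddCommGroup E]
    [InnerProductSpace ℂ E] {v w : X → E}
    (h : (Matrix.of fun x y => ⟪v x, w y⟫_ℂ).PosSemidef) (c : X →₀ ℂ) :
    0 ≤ (⟪Finsupp.linearCombination ℂ v c, Finsupp.linearCombination ℂ w c⟫_ℂ).re := by
  rw [inner_linearCombination]
  exact (Complex.nonneg_iff.1 (h.2 c)).1

/-- A symmetric nonnegative operator `S` (on a domain embedded by `e`) gives rise to a positive
semidefinite kernel. -/
theorem posSemidef_of_symm_nonneg {X D E : Type*} [SeminormedAddCommGroup E]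
    [InnerProductSpace ℂ E] [AddCommGroup D] [Module ℂ D] (e S : D →ₗ[ℂ] E)
    (hs : ∀ a b, ⟪e a, S b⟫_ℂ = ⟪S a, e b⟫_ℂ) (hn : ∀ a, 0 ≤ (⟪e a, S a⟫_ℂ).re) (f : X → D) :
    (Matrix.of fun x y => ⟪e (f x), S (f y)⟫_ℂ).PosSemidef := by
  refine ⟨Matrix.ext fun x y => ?_, fun c => ?_⟩
  · simp only [Matrix.conjTranspose_apply, Matrix.of_apply]
    rw [RCLike.star_def, inner_conj_symm, hs]
  · have h1 := inner_linearCombination (fun x => e (f x)) (fun x => S (f x)) c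
    simp only [Matrix.of_apply]
    rw [← h1]
    have h2 : ∀ L : D →ₗ[ℂ] E, Finsupp.linearCombination ℂ (fun x => L (f x)) c =
        L (Finsupp.linearCombination ℂ f c) := fun L => by
      rw [Finsupp.apply_linearCombination]
      rfl
    rw [h2 e, h2 S, Complex.nonneg_iff]
    refine ⟨hn _, ?_⟩
    refine (Complex.conj_eq_iff_im.1 ?_).symm
    rw [inner_conj_symm, hs]

end Kernels

/-! ### Operators on the chain -/

section ChainOperators

variable {N : ℕ} {ℋ : Type*} [NormedAddCommGroup ℋ] [InnerProductSpace ℂ ℋ]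

theorem eq_of_inner_tensor {φ ψ : Chain N ℋ} (h : ∀ x, ⟪tensor x, φ⟫_ℂ = ⟪tensor x, ψ⟫_ℂ) :
    φ = ψ := by
  refine (dense_span_tensor (N := N) (ℋ := ℋ)).eq_of_inner_right ℂ fun v hv => ?_
  induction hv using Submodule.span_induction with
  | mem v hv =>
    obtain ⟨x, rfl⟩ := hv
    exact h x
  | zero => rw [inner_zero_left, inner_zero_left]
  | add u v _ _ hu hv => rw [inner_add_left, inner_add_left, hu, hv]
  | smul a v _ hv => rw [inner_smul_left, inner_smul_left, hv]

theorem clm_ext_tensor {F : Type*} [NormedAddCommGroup F] [NormedSpace ℂ F]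
    {T T' : Chain N ℋ →L[ℂ] F} (h : ∀ x, T (tensor x) = T' (tensor x)) : T = T' :=
  ContinuousLinearMap.ext_on dense_span_tensor (by
    rintro _ ⟨x, rfl⟩
    exact h x)

theorem denseRange_linearCombination_tensor :
    DenseRange (Finsupp.linearCombination ℂ (tensor : (Fin N → ℋ) → Chain N ℋ)) := by
  have h := dense_span_tensor (N := N) (ℋ := ℋ)
  rw [← Finsupp.range_linearCombination] at h
  exact h

theorem re_inner_nonneg_of_kernel {T : Chain N ℋ →L[ℂ] Chain N ℋ}
    (h : open scoped ComplexOrder in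
      (Matrix.of fun x y : Fin N → ℋ => ⟪tensor x, T (tensor y)⟫_ℂ).PosSemidef) (φ : Chain N ℋ) :
    0 ≤ (⟪φ, T φ⟫_ℂ).re := by
  have hcl : IsClosed {φ : Chain N ℋ | 0 ≤ (⟪φ, T φ⟫_ℂ).re} :=
    isClosed_le continuous_const (Complex.continuous_re.comp (continuous_id.inner T.continuous))
  refine denseRange_linearCombination_tensor.induction_on φ hcl fun c => ?_
  have h1 := re_inner_linearCombination_nonneg h c
  have e : Finsupp.linearCombination ℂ (fun y : Fin N → ℋ => T (tensor y)) c =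
      T (Finsupp.linearCombination ℂ tensor c) := by
    rw [← ContinuousLinearMap.coe_coe T, Finsupp.apply_linearCombination]
    rfl
  rw [e] at h1
  exact h1

theorem inner_apply_eq_of_tensor [CompleteSpace ℋ] {T T' : Chain N ℋ →L[ℂ] Chain N ℋ}
    (h : ∀ x y, ⟪T (tensor x), tensor y⟫_ℂ = ⟪tensor x, T' (tensor y)⟫_ℂ) (φ ψ : Chain N ℋ) :
    ⟪T φ, ψ⟫_ℂ = ⟪φ, T' ψ⟫_ℂ := by
  have e : T' = T.adjoint := clm_ext_tensor fun y => eq_of_inner_tensor fun x => by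
    rw [← h, ContinuousLinearMap.adjoint_inner_right]
  rw [e, ContinuousLinearMap.adjoint_inner_right]

theorem inner_tensor_update [DecidableEq (Fin N)] (x y : Fin N → ℋ) (i : Fin N) (z : ℋ) :
    ⟪tensor x, tensor (Function.update y i z)⟫_ℂ =
      ⟪x i, z⟫_ℂ * ∏ j ∈ Finset.univ.erase i, ⟪x j, y j⟫_ℂ := by
  rw [inner_tensor, ← Finset.mul_prod_erase _ _ (Finset.mem_univ i), Function.update_self]
  congr 1
  refine Finset.prod_congr rfl fun j hj => ?_
  rw [Function.update_of_ne (Finset.ne_of_mem_erase hj)]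

theorem inner_tensor_erase (x y : Fin N → ℋ) (i : Fin N) :
    ⟪tensor x, tensor y⟫_ℂ = ⟪x i, y i⟫_ℂ * ∏ j ∈ Finset.univ.erase i, ⟪x j, y j⟫_ℂ := by
  rw [inner_tensor, ← Finset.mul_prod_erase _ _ (Finset.mem_univ i)]

theorem tensor_update_zero (x : Fin N → ℋ) (i : Fin N) :
    tensor (Function.update x i 0) = 0 :=
  eq_of_inner_tensor fun y => by
    rw [inner_tensor_update, inner_zero_right, inner_zero_right, zero_mul]

/-- `‖tensor x - tensor x₀‖²` expands into products of one-site inner products, which are continuous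
in `x`. -/
theorem continuous_tensor : Continuous (tensor : (Fin N → ℋ) → Chain N ℋ) := by
  rw [continuous_iff_continuousAt]
  intro x₀
  rw [ContinuousAt, tendsto_iff_norm_sub_tendsto_zero]
  have e : ∀ x : Fin N → ℋ, ‖tensor x - tensor x₀‖ =
      √((∏ j, ⟪x j, x j⟫_ℂ).re - 2 * (∏ j, ⟪x j, x₀ j⟫_ℂ).re + (∏ j, ⟪x₀ j, x₀ j⟫_ℂ).re) := by
    intro x
    rw [← Real.sqrt_sq (norm_nonneg (tensor x - tensor x₀))]
    congr 1
    have h := norm_sub_sq (𝕜 := ℂ) (tensor x) (tensor x₀)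
    rw [← inner_self_eq_norm_sq (𝕜 := ℂ) (tensor x), ← inner_self_eq_norm_sq (𝕜 := ℂ) (tensor x₀),
      inner_tensor, inner_tensor, inner_tensor] at h
    exact h
  simp only [e]
  have hc : Continuous fun x : Fin N → ℋ =>
      √((∏ j, ⟪x j, x j⟫_ℂ).re - 2 * (∏ j, ⟪x j, x₀ j⟫_ℂ).re + (∏ j, ⟪x₀ j, x₀ j⟫_ℂ).re) := by
    fun_prop
  have h := hc.tendsto x₀
  have h0 : ∀ a : ℝ, √(a - 2 * a + a) = 0 := fun a => by
    rw [show a - 2 * a + a = 0 by ring, Real.sqrt_zero]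
  rwa [h0] at h

theorem dense_span_tensor_of_dense {D : Set ℋ} (hD : Dense D) (I : Finset (Fin N)) :
    Dense (Submodule.span ℂ {φ : Chain N ℋ | ∃ x : Fin N → ℋ, (∀ i ∈ I, x i ∈ D) ∧
      φ = tensor x} : Set (Chain N ℋ)) := by
  have h1 : Dense ((I : Set (Fin N)).pi fun _ => D) := dense_pi _ fun _ _ => hD
  rw [Submodule.dense_iff_topologicalClosure_eq_top, eq_top_iff,
    ← Submodule.dense_iff_topologicalClosure_eq_top.1 (dense_span_tensor (N := N) (ℋ := ℋ))]
  refine Submodule.topologicalClosure_minimal _ (Submodule.span_le.2 ?_)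
    (Submodule.isClosed_topologicalClosure _)
  rintro _ ⟨x, rfl⟩
  have h2 : tensor x ∈ closure (tensor '' ((I : Set (Fin N)).pi fun _ => D)) :=
    image_closure_subset_closure_image continuous_tensor ⟨x, h1 x, rfl⟩
  refine closure_mono ?_ h2
  rintro _ ⟨y, hy, rfl⟩
  exact Submodule.subset_span ⟨y, fun i hi => hy i hi, rfl⟩

variable [CompleteSpace ℋ]

open scoped ComplexOrder in
-- `‖B‖² - B* B ≥ 0` gives a positive kernel at site `i`; its Schur product with the Gram kernels of
-- the other sites says that the operator is bounded by `‖B‖` on formal combinations of tensors. The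
-- bound gives both well-definedness and a continuous extension.
theorem exists_siteOp (i : Fin N) (B : ℋ →L[ℂ] ℋ) :
    ∃ T : Chain N ℋ →L[ℂ] Chain N ℋ, ∀ x,
      T (tensor x) = tensor (Function.update x i (B (x i))) := by
  let v : (Fin N → ℋ) → Chain N ℋ := tensor
  let w : (Fin N → ℋ) → Chain N ℋ := fun x => tensor (Function.update x i (B (x i)))
  let D : ℋ →L[ℂ] ℋ := ((‖B‖ ^ 2 : ℝ) : ℂ) • (1 : ℋ →L[ℂ] ℋ) - B.adjoint.comp B
  have hD : ∀ x y, ⟪x, D y⟫_ℂ = ((‖B‖ ^ 2 : ℝ) : ℂ) * ⟪x, y⟫_ℂ - ⟪B x, B y⟫_ℂ := by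
    intro x y
    simp only [D, sub_apply, smul_apply, ContinuousLinearMap.comp_apply, inner_sub_right,
      inner_smul_right, ContinuousLinearMap.adjoint_inner_right, one_apply_eq_self]
  have hpsd : (Matrix.of fun x y : Fin N → ℋ => ⟪x i, D (y i)⟫_ℂ).PosSemidef := by
    refine posSemidef_of_symm_nonneg (LinearMap.id : ℋ →ₗ[ℂ] ℋ) (D : ℋ →ₗ[ℂ] ℋ) (fun a b => ?_)
      (fun a => ?_) (fun x : Fin N → ℋ => x i)
    · simp only [LinearMap.id_apply, ContinuousLinearMap.coe_coe]
      rw [← inner_conj_symm (D a), hD, hD]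
      simp [inner_conj_symm]
    · simp only [LinearMap.id_apply, ContinuousLinearMap.coe_coe]
      have e : ∀ z : ℋ, (⟪z, z⟫_ℂ).re = ‖z‖ ^ 2 := fun z => inner_self_eq_norm_sq (𝕜 := ℂ) z
      rw [hD, Complex.sub_re, Complex.re_ofReal_mul, e, e, ← mul_pow, sub_nonneg]
      exact pow_le_pow_left₀ (norm_nonneg _) (B.le_opNorm a) 2
  have hpsd2 := hpsd.hadamard (posSemidef_prod (Finset.univ.erase i)
    (k := fun j => Matrix.gram ℂ fun x : Fin N → ℋ => x j) fun j _ => gram_posSemidef _)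
  have hb : ∀ c, ‖Finsupp.linearCombination ℂ w c‖ ≤ ‖B‖ * ‖Finsupp.linearCombination ℂ v c‖ := by
    intro c
    refine abs_le_of_sq_le_sq' ?_ (by positivity) |>.2
    have h1 := (Complex.nonneg_iff.1 (hpsd2.2 c)).1
    have h2 : (c.sum fun x ci => c.sum fun y cj => star ci * ((Matrix.of fun x y : Fin N → ℋ =>
        ⟪x i, D (y i)⟫_ℂ) ⊙ (Matrix.of fun x y => ∏ j ∈ Finset.univ.erase i,
          (Matrix.gram ℂ fun x : Fin N → ℋ => x j) x y)) x y * cj) =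
        ((‖B‖ ^ 2 : ℝ) : ℂ) * ⟪Finsupp.linearCombination ℂ v c, Finsupp.linearCombination ℂ v c⟫_ℂ -
        ⟪Finsupp.linearCombination ℂ w c, Finsupp.linearCombination ℂ w c⟫_ℂ := by
      rw [inner_linearCombination, inner_linearCombination]
      simp only [Finsupp.sum, Finset.mul_sum]
      rw [← Finset.sum_sub_distrib]
      refine Finset.sum_congr rfl fun x _ => ?_
      rw [← Finset.sum_sub_distrib]
      refine Finset.sum_congr rfl fun y _ => ?_
      have hw : ⟪w x, w y⟫_ℂ = ⟪B (x i), B (y i)⟫_ℂ *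
          ∏ j ∈ Finset.univ.erase i, ⟪x j, y j⟫_ℂ := by
        simp only [w]
        rw [inner_tensor_update, Function.update_self]
        congr 1
        refine Finset.prod_congr rfl fun j hj => ?_
        rw [Function.update_of_ne (Finset.ne_of_mem_erase hj)]
      simp only [Matrix.hadamard_apply, Matrix.of_apply, Matrix.gram_apply, hw, hD, v]
      rw [inner_tensor_erase x y i]
      ring
    rw [h2, Complex.sub_re, Complex.re_ofReal_mul] at h1
    have e : ∀ z : Chain N ℋ, (⟪z, z⟫_ℂ).re = ‖z‖ ^ 2 :=
      fun z => inner_self_eq_norm_sq (𝕜 := ℂ) z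
    rw [e, e] at h1
    nlinarith
  refine ⟨(Finsupp.linearCombination ℂ w).extendOfNorm (Finsupp.linearCombination ℂ v),
    fun x => ?_⟩
  have h1 := LinearMap.extendOfNorm_eq denseRange_linearCombination_tensor ⟨_, hb⟩
    (Finsupp.single x (1 : ℂ))
  simpa [v, w] using h1

theorem exists_tensorMap (B : Fin N → ℋ →L[ℂ] ℋ) :
    ∃ T : Chain N ℋ →L[ℂ] Chain N ℋ, ∀ x, T (tensor x) = tensor fun j => B j (x j) := by
  have key : ∀ s : Finset (Fin N), ∃ T : Chain N ℋ →L[ℂ] Chain N ℋ, ∀ x,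
      T (tensor x) = tensor fun j => if j ∈ s then B j (x j) else x j := by
    intro s
    induction s using Finset.induction_on with
    | empty => exact ⟨1, fun x => by simp⟩
    | insert a s ha ih =>
      obtain ⟨T, hT⟩ := ih
      obtain ⟨U, hU⟩ := exists_siteOp a (B a)
      refine ⟨U.comp T, fun x => ?_⟩
      rw [ContinuousLinearMap.comp_apply, hT, hU]
      congr 1
      ext j
      by_cases hj : j = a
      · subst hj
        simp [ha]
      · simp [hj]
  obtain ⟨T, hT⟩ := key Finset.univ
  exact ⟨T, fun x => by simpa using hT x⟩

/-- The operator `B₁ ⊗ ⋯ ⊗ B_N`. -/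
def tensorMap (B : Fin N → ℋ →L[ℂ] ℋ) : Chain N ℋ →L[ℂ] Chain N ℋ :=
  (exists_tensorMap B).choose

theorem tensorMap_tensor (B : Fin N → ℋ →L[ℂ] ℋ) (x : Fin N → ℋ) :
    tensorMap B (tensor x) = tensor fun j => B j (x j) :=
  (exists_tensorMap B).choose_spec x

open scoped ComplexOrder in
-- The kernel `⟪tensor x, T (tensor y)⟫` is a product of positive one-site kernels.
theorem tensorMap_isPositive {B : Fin N → ℋ →L[ℂ] ℋ} (hB : ∀ j, (B j).IsPositive) :
    (tensorMap B).IsPositive := by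
  have hs : ∀ φ ψ : Chain N ℋ, ⟪tensorMap B φ, ψ⟫_ℂ = ⟪φ, tensorMap B ψ⟫_ℂ := by
    refine inner_apply_eq_of_tensor fun x y => ?_
    rw [tensorMap_tensor, tensorMap_tensor, inner_tensor, inner_tensor]
    exact Finset.prod_congr rfl fun j _ => (hB j).inner_left_eq_inner_right _ _
  refine ContinuousLinearMap.isPositive_def'.2
    ⟨(ContinuousLinearMap.isSelfAdjoint_iff_isSymmetric).2 hs, fun φ => ?_⟩
  rw [ContinuousLinearMap.reApplyInnerSelf_apply, hs]
  refine re_inner_nonneg_of_kernel ?_ φ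
  have h := posSemidef_prod Finset.univ
    (k := fun j => Matrix.of fun x y : Fin N → ℋ => ⟪x j, B j (y j)⟫_ℂ) fun j _ =>
      posSemidef_of_symm_nonneg (LinearMap.id : ℋ →ₗ[ℂ] ℋ) (B j : ℋ →ₗ[ℂ] ℋ)
        (fun a b => ((hB j).inner_left_eq_inner_right a b).symm)
        (fun a => (hB j).re_inner_nonneg_right a) (fun x : Fin N → ℋ => x j)
  convert h using 1
  ext x y
  simp only [Matrix.of_apply]
  rw [tensorMap_tensor, inner_tensor]

end ChainOperators


/-! ### The one-site Hamiltonian -/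

section Site

variable {ℋ : Type*} [NormedAddCommGroup ℋ] [InnerProductSpace ℂ ℋ] [CompleteSpace ℋ]
  {H : ℋ →ₗ.[ℂ] ℋ} {Ω : ℋ}

namespace IsSiteHamiltonian

theorem dense_domain (h : IsSiteHamiltonian H Ω) : Dense (H.domain : Set ℋ) :=
  h.selfAdjoint.dense_domain

theorem symm (h : IsSiteHamiltonian H Ω) (x y : H.domain) :
    ⟪H x, (y : ℋ)⟫_ℂ = ⟪(x : ℋ), H y⟫_ℂ := by
  have h1 := LinearPMap.adjoint_isFormalAdjoint (T := H) h.dense_domain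
  rw [(LinearPMap.isSelfAdjoint_def).1 h.selfAdjoint] at h1
  exact h1 x y

theorem exists_resolvent (h : IsSiteHamiltonian H Ω) :
    ∃ r : ℋ →L[ℂ] ℋ, r.IsPositive ∧ (1 - r).IsPositive ∧ ∀ y, (r y, y - r y) ∈ H.graph := by
  have hnn : ∀ p ∈ H.graph, 0 ≤ (⟪p.1, p.2⟫_ℂ).re := by
    rintro ⟨a, b⟩ hp
    obtain ⟨x, rfl, rfl⟩ := (LinearPMap.mem_graph_iff H).1 hp
    exact h.nonneg x
  refine QuantumChain.exists_resolvent ?_ hnn (exists_mem_graph_add_eq ?_ hnn ?_)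
  · rintro ⟨a, b⟩ hp ⟨c, d⟩ hq
    obtain ⟨x, rfl, rfl⟩ := (LinearPMap.mem_graph_iff H).1 hp
    obtain ⟨y, rfl, rfl⟩ := (LinearPMap.mem_graph_iff H).1 hq
    exact (h.symm x y).symm
  · exact h.selfAdjoint.isClosed
  · have e : ((fun p : ℋ × ℋ => p.1 + p.2) '' (H.graph : Set (ℋ × ℋ))) =
        ((H.graph.map (LinearMap.fst ℂ ℋ ℋ + LinearMap.snd ℂ ℋ ℋ) : Submodule ℂ ℋ) : Set ℋ) := rfl
    rw [e, Submodule.dense_iff_topologicalClosure_eq_top,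
      Submodule.topologicalClosure_eq_top_iff, Submodule.eq_bot_iff]
    intro χ hχ
    -- Orthogonality to the range of `H + 1` means `H* χ = -χ`; since `H* = H ≥ 0`, this forces `χ =
    -- 0`.
    have h1 : (χ, -χ) ∈ H.graph := by
      have h2 : (χ, -χ) ∈ H.graph.adjoint := by
        rw [Submodule.mem_adjoint_iff]
        intro a b hab
        have := (Submodule.mem_orthogonal _ _).1 hχ (a + b) ⟨(a, b), hab, rfl⟩
        rw [inner_add_left] at this
        rw [inner_neg_right, sub_neg_eq_add, add_comm]
        exact this
      rwa [← LinearPMap.adjoint_graph_eq_graph_adjoint h.dense_domain,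
        (LinearPMap.isSelfAdjoint_def).1 h.selfAdjoint] at h2
    have h3 := (re_inner_self_add_nonneg (hnn _ h1)).1
    simpa using h3

/-- `H ≥ 1 - |Ω⟩⟨Ω|`. -/
theorem norm_sq_sub_le (h : IsSiteHamiltonian H Ω) (z : H.domain) :
    ‖(z : ℋ)‖ ^ 2 - ‖⟪Ω, (z : ℋ)⟫_ℂ‖ ^ 2 ≤ (⟪(z : ℋ), H z⟫_ℂ).re := by
  obtain ⟨ω, hω, hHω⟩ := (LinearPMap.mem_graph_iff H).1 h.vacuum
  simp only at hω hHω
  have e : ∀ z : ℋ, (⟪z, z⟫_ℂ).re = ‖z‖ ^ 2 := fun z => inner_self_eq_norm_sq (𝕜 := ℂ) z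
  have hΩ : ⟪Ω, Ω⟫_ℂ = 1 := by
    rw [inner_self_eq_norm_sq_to_K, h.norm_vacuum]
    simp
  -- Removing the vacuum component of `z` does not change the energy, because `H Ω = 0` and `H` is
  -- symmetric.
  set c := ⟪Ω, (z : ℋ)⟫_ℂ with hc
  have h1 : ((z - c • ω : H.domain) : ℋ) = (z : ℋ) - c • Ω := by
    rw [Submodule.coe_sub, Submodule.coe_smul, hω]
  have hH : H (z - c • ω) = H z := by
    rw [LinearPMap.map_sub, LinearPMap.map_smul, hHω, smul_zero, sub_zero]
  have h0 : ⟪Ω, (z : ℋ) - c • Ω⟫_ℂ = 0 := by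
    rw [inner_sub_right, inner_smul_right, hΩ, mul_one, ← hc, sub_self]
  have h2 := h.gap (z - c • ω) (by rw [h1]; exact h0)
  have h3 : ⟪Ω, H z⟫_ℂ = 0 := by
    rw [← hω, ← h.symm, hHω, inner_zero_left]
  rw [hH, h1, inner_sub_left, inner_smul_left, h3, mul_zero, sub_zero] at h2
  have h4 : ‖(z : ℋ)‖ ^ 2 = ‖(z : ℋ) - c • Ω‖ ^ 2 + ‖c‖ ^ 2 := by
    have := norm_add_sq (𝕜 := ℂ) ((z : ℋ) - c • Ω) (c • Ω)
    rw [sub_add_cancel, inner_smul_right, ← inner_conj_symm, h0, map_zero, mul_zero, map_zero,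
      mul_zero, add_zero, norm_smul, h.norm_vacuum, mul_one] at this
    exact this
  linarith

end IsSiteHamiltonian

/-- The one-site Hamiltonian, extended by `0` outside of its domain. -/
def extendZero (H : ℋ →ₗ.[ℂ] ℋ) (z : ℋ) : ℋ :=
  open Classical in if h : z ∈ H.domain then H ⟨z, h⟩ else 0

theorem extendZero_of_mem {z : ℋ} (hz : z ∈ H.domain) : extendZero H z = H ⟨z, hz⟩ :=
  dif_pos hz

theorem extendZero_of_mem_graph {z w : ℋ} (hz : (z, w) ∈ H.graph) :
    z ∈ H.domain ∧ extendZero H z = w := by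
  obtain ⟨x, hx, hw⟩ := (LinearPMap.mem_graph_iff H).1 hz
  simp only at hx hw
  subst hx
  exact ⟨x.2, by rw [extendZero_of_mem x.2, ← hw]⟩

end Site

/-! ### The free Hamiltonian -/

section Free

variable {N : ℕ} {ℋ : Type*} [NormedAddCommGroup ℋ] [InnerProductSpace ℂ ℋ] [CompleteSpace ℋ]
  {H : ℋ →ₗ.[ℂ] ℋ} {Ω : ℋ} {I J : Finset (Fin N)}

/-- `x₁ ⊗ ⋯ ⊗ H x_i ⊗ ⋯ ⊗ x_N` -/
def siteTensor (H : ℋ →ₗ.[ℂ] ℋ) (i : Fin N) (x : Fin N → ℋ) : Chain N ℋ :=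
  tensor (Function.update x i (extendZero H (x i)))

/-- The families `x₁, …, x_N` with `x_i ∈ D(H)` for `i ∈ I`. -/
abbrev DomainFamily (H : ℋ →ₗ.[ℂ] ℋ) (I : Finset (Fin N)) : Type _ :=
  {x : Fin N → ℋ // ∀ i ∈ I, x i ∈ H.domain}

/-- The vector `∑ c_x x₁ ⊗ ⋯ ⊗ x_N`. -/
def coreVector (c : DomainFamily (N := N) H J →₀ ℂ) : Chain N ℋ :=
  Finsupp.linearCombination ℂ (fun x : DomainFamily (N := N) H J => tensor x.1) c

/-- The image of `∑ c_x x₁ ⊗ ⋯ ⊗ x_N` under `H_i`. -/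
def coreSite (i : Fin N) (c : DomainFamily (N := N) H J →₀ ℂ) : Chain N ℋ :=
  Finsupp.linearCombination ℂ (fun x : DomainFamily (N := N) H J => siteTensor H i x.1) c

/-- The graph of the free Hamiltonian on the span of the pure tensors. -/
def coreGraph (H : ℋ →ₗ.[ℂ] ℋ) (I : Finset (Fin N)) : Submodule ℂ (Chain N ℋ × Chain N ℋ) :=
  Submodule.span ℂ (Set.range fun x : DomainFamily (N := N) H I =>
    (tensor x.1, ∑ i ∈ I, siteTensor H i x.1))

theorem freeHamiltonian_eq (H : ℋ →ₗ.[ℂ] ℋ) (I : Finset (Fin N)) :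
    freeHamiltonian H I = (coreGraph H I).topologicalClosure.toLinearPMap := by
  unfold freeHamiltonian coreGraph
  congr 3
  ext p
  have e : ∀ (x : Fin N → ℋ) (h : ∀ i ∈ I, x i ∈ H.domain), ∑ i ∈ I, siteTensor H i x =
      ∑ i ∈ I.attach, tensor (Function.update x i.1 (H ⟨x i.1, h i.1 i.2⟩)) := by
    intro x h
    rw [← Finset.sum_attach]
    refine Finset.sum_congr rfl fun i _ => ?_
    unfold siteTensor
    rw [extendZero_of_mem (h i.1 i.2)]
  constructor
  · rintro ⟨x, h, rfl⟩
    exact ⟨⟨x, h⟩, by simp only [e x h]⟩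
  · rintro ⟨⟨x, h⟩, rfl⟩
    exact ⟨x, h, by simp only [e x h]⟩

/-- The domain condition is imposed on all of `J`, so the same vectors serve for `H⁰_I` and `H⁰_J`
when the two are compared. -/
theorem coreVector_mem (hIJ : I ⊆ J) (c : DomainFamily (N := N) H J →₀ ℂ) :
    (coreVector c, ∑ i ∈ I, coreSite i c) ∈ coreGraph H I := by
  induction c using Finsupp.induction_linear with
  | zero =>
    simp only [coreVector, coreSite, map_zero, Finset.sum_const_zero]
    exact Submodule.zero_mem _
  | add f g hf hg =>
    have := Submodule.add_mem _ hf hg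
    simp only [coreVector, coreSite, map_add, Finset.sum_add_distrib] at this ⊢
    exact this
  | single x a =>
    have := Submodule.smul_mem (coreGraph H I) a
      (Submodule.subset_span ⟨⟨x.1, fun i hi => x.2 i (hIJ hi)⟩, rfl⟩)
    simp only [coreVector, coreSite, Finsupp.linearCombination_single, ← Finset.smul_sum]
    exact this

theorem exists_coreVector {p : Chain N ℋ × Chain N ℋ} (hp : p ∈ coreGraph H J) :
    ∃ c : DomainFamily (N := N) H J →₀ ℂ, p = (coreVector c, ∑ i ∈ J, coreSite i c) := by
  have key : ∀ c : DomainFamily (N := N) H J →₀ ℂ,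
      Finsupp.linearCombination ℂ (fun x : DomainFamily (N := N) H J =>
        ((tensor x.1, ∑ i ∈ J, siteTensor H i x.1) : Chain N ℋ × Chain N ℋ)) c =
      (coreVector c, ∑ i ∈ J, coreSite i c) := by
    intro c
    induction c using Finsupp.induction_linear with
    | zero =>
      simp only [coreVector, coreSite, map_zero, Finset.sum_const_zero]
      rfl
    | add f g hf hg =>
      rw [map_add, hf, hg]
      simp [coreVector, coreSite, Finset.sum_add_distrib]
    | single x a => simp [coreVector, coreSite, Finset.smul_sum]
  unfold coreGraph at hp
  rw [← Finsupp.range_linearCombination] at hp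
  obtain ⟨c, rfl⟩ := hp
  exact ⟨c, key c⟩

open scoped ComplexOrder in
/-- Positivity of operators acting on one site, on the span of the pure tensors. -/
theorem re_inner_coreVector_nonneg {i : Fin N} (hi : i ∈ J) (S : H.domain →ₗ[ℂ] ℋ)
    (hs : ∀ a b : H.domain, ⟪(a : ℋ), S b⟫_ℂ = ⟪S a, (b : ℋ)⟫_ℂ)
    (hn : ∀ a : H.domain, 0 ≤ (⟪(a : ℋ), S a⟫_ℂ).re) (c : DomainFamily (N := N) H J →₀ ℂ) :
    0 ≤ (⟪coreVector c, Finsupp.linearCombination ℂ (fun x : DomainFamily (N := N) H J =>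
      tensor (Function.update x.1 i (S ⟨x.1 i, x.2 i hi⟩))) c⟫_ℂ).re := by
  refine re_inner_linearCombination_nonneg ?_ c
  have h1 := posSemidef_of_symm_nonneg H.domain.subtype S hs hn
    (fun x : DomainFamily (N := N) H J => ⟨x.1 i, x.2 i hi⟩)
  have h2 := h1.hadamard (posSemidef_prod (Finset.univ.erase i)
    (k := fun j => Matrix.gram ℂ fun x : DomainFamily (N := N) H J => x.1 j)
    fun j _ => gram_posSemidef _)
  refine (congrArg Matrix.PosSemidef (Matrix.ext fun x y => ?_)).mpr h2
  simp only [Matrix.of_apply, Matrix.hadamard_apply, Matrix.gram_apply]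
  rw [inner_tensor_update]
  rfl

namespace IsSiteHamiltonian

theorem inner_siteTensor (h : IsSiteHamiltonian H Ω) {i : Fin N} {x y : Fin N → ℋ}
    (hx : x i ∈ H.domain) (hy : y i ∈ H.domain) :
    ⟪tensor x, siteTensor H i y⟫_ℂ = ⟪siteTensor H i x, tensor y⟫_ℂ := by
  unfold siteTensor
  rw [← inner_conj_symm (tensor (Function.update x i _)), inner_tensor_update,
    inner_tensor_update, map_mul, map_prod]
  simp only [inner_conj_symm]
  rw [extendZero_of_mem hx, extendZero_of_mem hy]
  congr 1
  exact (h.symm ⟨x i, hx⟩ ⟨y i, hy⟩).symm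

theorem re_inner_coreSite_nonneg (h : IsSiteHamiltonian H Ω) {i : Fin N} (hi : i ∈ J)
    (c : DomainFamily (N := N) H J →₀ ℂ) : 0 ≤ (⟪coreVector c, coreSite i c⟫_ℂ).re := by
  have h1 := re_inner_coreVector_nonneg hi H.toFun (fun a b => (h.symm a b).symm) h.nonneg c
  have e : (fun x : DomainFamily (N := N) H J => siteTensor H i x.1) =
      fun x => tensor (Function.update x.1 i (H.toFun ⟨x.1 i, x.2 i hi⟩)) := by
    funext x
    unfold siteTensor
    rw [extendZero_of_mem (x.2 i hi)]
    rfl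
  unfold coreSite
  rw [e]
  exact h1

/-- The defect `f p q` is continuous in `q` and antisymmetric up to conjugation, so it is extended
to the closure in one variable, swapped, and extended in the other. -/
theorem symm_of_mem_closure (h : IsSiteHamiltonian H Ω) {p q : Chain N ℋ × Chain N ℋ}
    (hp : p ∈ (coreGraph H I).topologicalClosure) (hq : q ∈ (coreGraph H I).topologicalClosure) :
    ⟪p.1, q.2⟫_ℂ = ⟪p.2, q.1⟫_ℂ := by
  let f : Chain N ℋ × Chain N ℋ → (Chain N ℋ × Chain N ℋ →L[ℂ] ℂ) := fun p =>
    (innerSL ℂ p.1).comp (ContinuousLinearMap.snd ℂ _ _) -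
      (innerSL ℂ p.2).comp (ContinuousLinearMap.fst ℂ _ _)
  have hf : ∀ p q, f p q = ⟪p.1, q.2⟫_ℂ - ⟪p.2, q.1⟫_ℂ := fun p q => rfl
  have hle : ∀ p, (∀ x : DomainFamily (N := N) H I,
      f p (tensor x.1, ∑ i ∈ I, siteTensor H i x.1) = 0) →
      ∀ q ∈ (coreGraph H I).topologicalClosure, f p q = 0 := by
    intro p hp q hq
    have h1 : (coreGraph H I).topologicalClosure ≤ LinearMap.ker (f p : _ →ₗ[ℂ] ℂ) := by
      refine Submodule.topologicalClosure_minimal _ (Submodule.span_le.2 ?_) (f p).isClosed_ker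
      rintro _ ⟨x, rfl⟩
      exact hp x
    exact h1 hq
  have hanti : ∀ p q, f p q = 0 → f q p = 0 := by
    intro p q hpq
    rw [hf] at hpq ⊢
    rw [← inner_conj_symm q.1, ← inner_conj_symm q.2, ← map_sub, ← neg_sub, hpq, neg_zero,
      map_zero]
  have h1 : f p q = 0 := hle p (fun x => hanti _ _ (hle _ (fun y => ?_) p hp)) q hq
  · rwa [hf, sub_eq_zero] at h1
  · rw [hf, inner_sum, sum_inner, sub_eq_zero]
    exact Finset.sum_congr rfl fun i hi => h.inner_siteTensor (x.2 i hi) (y.2 i hi)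

theorem dense_span_domain (h : IsSiteHamiltonian H Ω) (I : Finset (Fin N)) :
    Dense (Submodule.span ℂ {φ : Chain N ℋ | ∃ x : Fin N → ℋ, (∀ i ∈ I, x i ∈ (H.domain : Set ℋ)) ∧
      φ = tensor x} : Set (Chain N ℋ)) :=
  dense_span_tensor_of_dense h.dense_domain I

/-- Closability: if `(0, y)` lies in the closure, symmetry makes `y` orthogonal to a dense set.
Without it the conversion of the closure to an operator would not return this graph. -/
theorem freeHamiltonian_graph (h : IsSiteHamiltonian H Ω) (I : Finset (Fin N)) :
    (freeHamiltonian H I).graph = (coreGraph H I).topologicalClosure := by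
  rw [freeHamiltonian_eq]
  refine Submodule.toLinearPMap_graph_eq _ fun p hp hp1 => ?_
  refine (h.dense_span_domain I).eq_zero_of_inner_right ℂ fun v hv => ?_
  induction hv using Submodule.span_induction with
  | mem v hv =>
    obtain ⟨x, hx, rfl⟩ := hv
    have h1 := h.symm_of_mem_closure
      (Submodule.le_topologicalClosure _ (Submodule.subset_span ⟨⟨x, hx⟩, rfl⟩)) hp
    rw [hp1, inner_zero_right] at h1
    exact h1
  | zero => rw [inner_zero_left]
  | add u v _ _ hu hv => rw [inner_add_left, hu, hv, add_zero]
  | smul a v _ hv => rw [inner_smul_left, hv, mul_zero]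

/-- A quadratic inequality for `H⁰_I` extends from the span of the pure tensors. -/
theorem le_re_inner_of_core (h : IsSiteHamiltonian H Ω) {f : Chain N ℋ → ℝ} (hf : Continuous f)
    (hc : ∀ c : DomainFamily (N := N) H I →₀ ℂ,
      f (coreVector c) ≤ (⟪coreVector c, ∑ i ∈ I, coreSite i c⟫_ℂ).re)
    {p : Chain N ℋ × Chain N ℋ} (hp : p ∈ (freeHamiltonian H I).graph) :
    f p.1 ≤ (⟪p.1, p.2⟫_ℂ).re := by
  rw [h.freeHamiltonian_graph] at hp
  have hcl : IsClosed {p : Chain N ℋ × Chain N ℋ | f p.1 ≤ (⟪p.1, p.2⟫_ℂ).re} :=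
    isClosed_le (hf.comp continuous_fst)
      (Complex.continuous_re.comp (continuous_fst.inner continuous_snd))
  refine closure_minimal (fun q hq => ?_) hcl hp
  obtain ⟨c, rfl⟩ := exists_coreVector hq
  exact hc c

theorem freeHamiltonian_nonneg (h : IsSiteHamiltonian H Ω) {p : Chain N ℋ × Chain N ℋ}
    (hp : p ∈ (freeHamiltonian H I).graph) : 0 ≤ (⟪p.1, p.2⟫_ℂ).re :=
  h.le_re_inner_of_core (f := fun _ => 0) continuous_const (fun c => by
    rw [inner_sum, Complex.re_sum]
    exact Finset.sum_nonneg fun i hi => h.re_inner_coreSite_nonneg hi c) hp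

/-- The span of the pure tensors is a core: `H⁰_I + 1` maps it onto a dense subspace. -/
theorem dense_core (h : IsSiteHamiltonian H Ω) (I : Finset (Fin N)) :
    Dense ((fun p : Chain N ℋ × Chain N ℋ => p.1 + p.2) ''
      (coreGraph H I : Set (Chain N ℋ × Chain N ℋ))) := by
  obtain ⟨r, hr, hr', hmem⟩ := h.exists_resolvent
  let B : Fin N → ℋ →L[ℂ] ℋ := fun j => if j ∈ I then r else 1
  let C : Chain N ℋ →L[ℂ] Chain N ℋ := tensorMap B
  let C' : Fin N → Chain N ℋ →L[ℂ] Chain N ℋ := fun i => tensorMap (Function.update B i (1 - r))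
  -- With `r = (H + 1)⁻¹` at the sites of `I` one has `H r = 1 - r`, so `M = (H⁰_I + 1) C` on pure
  -- tensors, where `C` is the product of the resolvents.
  let M : Chain N ℋ →L[ℂ] Chain N ℋ := C + ∑ i ∈ I, C' i
  have hB : ∀ j, (B j).IsPositive := fun j => by
    simp only [B]
    split_ifs
    · exact hr
    · exact ContinuousLinearMap.isPositive_one
  have hC : C.IsPositive := tensorMap_isPositive hB
  have hC' : ∀ i, (C' i).IsPositive := fun i => tensorMap_isPositive fun j => by
    by_cases hj : j = i
    · subst hj
      rwa [Function.update_self]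
    · rw [Function.update_of_ne hj]
      exact hB j
  have hsumpos : (∑ i ∈ I, C' i).IsPositive :=
    ContinuousLinearMap.isPositive_sum I fun i _ => hC' i
  have hM : M.IsPositive := hC.add hsumpos
  have hMapp : ∀ φ, M φ = C φ + (∑ i ∈ I, C' i) φ := fun φ => rfl
  have hr_mem : ∀ y, r y ∈ H.domain := fun y => (extendZero_of_mem_graph (hmem y)).1
  have hr_ext : ∀ y, extendZero H (r y) = y - r y := fun y => (extendZero_of_mem_graph (hmem y)).2
  -- `r` inverts `H + 1`, so the range of `C` contains every pure tensor with factors in the domain.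
  have hCdense : DenseRange C := by
    have h1 := h.dense_span_domain I
    refine h1.mono ?_
    have : Submodule.span ℂ {φ : Chain N ℋ | ∃ x : Fin N → ℋ,
        (∀ i ∈ I, x i ∈ (H.domain : Set ℋ)) ∧ φ = tensor x} ≤
        LinearMap.range (C : Chain N ℋ →ₗ[ℂ] Chain N ℋ) := by
      refine Submodule.span_le.2 ?_
      rintro _ ⟨x, hx, rfl⟩
      refine ⟨tensor fun j => if j ∈ I then x j + extendZero H (x j) else x j, ?_⟩
      change C (tensor _) = _
      rw [tensorMap_tensor]
      congr 1
      ext j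
      by_cases hj : j ∈ I
      · have hx' : x j ∈ H.domain := hx j hj
        simp only [B, if_pos hj]
        set z := x j + extendZero H (x j) with hz
        have h2 : (x j, extendZero H (x j)) ∈ H.graph := by
          rw [extendZero_of_mem hx']
          exact LinearPMap.mem_graph H ⟨x j, hx'⟩
        have hnn : ∀ p ∈ H.graph, 0 ≤ (⟪p.1, p.2⟫_ℂ).re := by
          rintro ⟨a, b⟩ hp
          obtain ⟨x, rfl, rfl⟩ := (LinearPMap.mem_graph_iff H).1 hp
          exact h.nonneg x
        have h3 := (re_inner_self_add_nonneg (hnn _ (H.graph.sub_mem (hmem z) h2))).1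
        rw [Prod.fst_sub, Prod.snd_sub, show r z - x j + (z - r z - extendZero H (x j)) =
          z - (x j + extendZero H (x j)) by abel, ← hz, sub_self, norm_zero] at h3
        exact sub_eq_zero.1 (norm_le_zero_iff.1 h3)
      · simp only [B, if_neg hj]
        rfl
    exact this
  have hCsymm : ∀ x y, ⟪C x, y⟫_ℂ = ⟪x, C y⟫_ℂ := hC.inner_left_eq_inner_right
  have hCinj : ∀ φ, C φ = 0 → φ = 0 := by
    intro φ hφ
    refine hCdense.eq_zero_of_inner_left ℂ fun y => ?_
    rw [← hCsymm, hφ, inner_zero_left]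
  -- `M ≥ C ≥ 0`, so a null vector of `M` satisfies `⟪φ, C φ⟫ = 0`, hence `C φ = 0` through the
  -- square root of `C`.
  have hMinj : ∀ φ, M φ = 0 → φ = 0 := by
    intro φ hφ
    have h1 := hC.re_inner_nonneg_right φ
    have h2 := hsumpos.re_inner_nonneg_right φ
    have h3 : RCLike.re ⟪φ, C φ⟫_ℂ + RCLike.re ⟪φ, (∑ i ∈ I, C' i) φ⟫_ℂ = 0 := by
      rw [← map_add, ← inner_add_right, ← hMapp, hφ, inner_zero_right, map_zero]
    have h4 : RCLike.re ⟪φ, C φ⟫_ℂ = 0 := le_antisymm (by linarith) h1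
    have h0 : 0 ≤ C := (ContinuousLinearMap.nonneg_iff_isPositive C).2 hC
    set D := CFC.sqrt C with hD
    have hDpos : D.IsPositive :=
      (ContinuousLinearMap.nonneg_iff_isPositive _).1 (CFC.sqrt_nonneg C)
    have e : ∀ ψ, D (D ψ) = C ψ := fun ψ =>
      congrArg (fun T : Chain N ℋ →L[ℂ] Chain N ℋ => T ψ) (CFC.sqrt_mul_sqrt_self C h0)
    have h5 : D φ = 0 := by
      rw [← e, ← hDpos.inner_left_eq_inner_right, inner_self_eq_norm_sq (𝕜 := ℂ)] at h4
      exact norm_eq_zero.1 (pow_eq_zero_iff two_ne_zero |>.1 h4)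
    exact hCinj φ (by rw [← e, h5, map_zero])
  have hMdense : DenseRange M := denseRange_of_injective hM.inner_left_eq_inner_right hMinj
  have h1 := hMdense.dense_image M.continuous (dense_span_tensor (N := N) (ℋ := ℋ))
  refine h1.mono ?_
  let L : Chain N ℋ × Chain N ℋ →ₗ[ℂ] Chain N ℋ := LinearMap.fst ℂ _ _ + LinearMap.snd ℂ _ _
  have hle : (Submodule.span ℂ (Set.range (tensor : (Fin N → ℋ) → Chain N ℋ))).map
      (M : Chain N ℋ →ₗ[ℂ] Chain N ℋ) ≤ (coreGraph H I).map L := by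
    rw [Submodule.map_span_le]
    rintro _ ⟨y, rfl⟩
    refine ⟨(tensor fun j => B j (y j), ∑ i ∈ I, siteTensor H i fun j => B j (y j)),
      Submodule.subset_span ⟨⟨fun j => B j (y j), fun i hi => ?_⟩, rfl⟩, ?_⟩
    · simp only [B, if_pos hi]
      exact hr_mem _
    · change tensor (fun j => B j (y j)) + ∑ i ∈ I, siteTensor H i (fun j => B j (y j)) =
        M (tensor y)
      rw [hMapp, sum_apply]
      congr 1
      · exact (tensorMap_tensor B y).symm
      · refine Finset.sum_congr rfl fun i hi => ?_
        simp only [C']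
        rw [tensorMap_tensor]
        unfold siteTensor
        congr 1
        ext j
        by_cases hj : j = i
        · subst hj
          rw [Function.update_self, Function.update_self]
          simp only [B, if_pos hi, hr_ext]
          rfl
        · rw [Function.update_of_ne hj, Function.update_of_ne hj]
  rintro _ ⟨φ, hφ, rfl⟩
  exact hle ⟨φ, hφ, rfl⟩

/-- Ensures that `invSqrt` is not at its default value 0 for the free Hamiltonians. -/
theorem isInvSqrt_freeHamiltonian (h : IsSiteHamiltonian H Ω) (I : Finset (Fin N)) :
    IsInvSqrt (freeHamiltonian H I) (invSqrt (freeHamiltonian H I)) := by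
  have hg := h.freeHamiltonian_graph I
  have hnn : ∀ p ∈ (freeHamiltonian H I).graph, 0 ≤ (⟪p.1, p.2⟫_ℂ).re :=
    fun p hp => h.freeHamiltonian_nonneg hp
  obtain ⟨r, hr, -, hmem⟩ := QuantumChain.exists_resolvent (A := freeHamiltonian H I)
    (fun p hp q hq => h.symm_of_mem_closure (hg ▸ hp) (hg ▸ hq)) hnn
    (exists_mem_graph_add_eq (by rw [hg]; exact Submodule.isClosed_topologicalClosure _) hnn
      ((h.dense_core I).mono (Set.image_mono (by
        rw [hg]
        exact Submodule.le_topologicalClosure _))))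
  exact isInvSqrt_invSqrt (exists_isInvSqrt hr hmem)

end IsSiteHamiltonian

end Free


/-! ### The vacuum projections -/

section Vacuum

variable {N : ℕ} {ℋ : Type*} [NormedAddCommGroup ℋ] [InnerProductSpace ℂ ℋ] [CompleteSpace ℋ]
  {H : ℋ →ₗ.[ℂ] ℋ} {Ω : ℋ} {I J : Finset (Fin N)}

theorem vacuumProj_inner (Ω : ℋ) (I : Finset (Fin N)) (φ ψ : Chain N ℋ) :
    ⟪vacuumProj Ω I φ, ψ⟫_ℂ = ⟪φ, vacuumProj Ω I ψ⟫_ℂ :=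
  Submodule.inner_starProjection_left_eq_right _ _ _

theorem vacuumProj_eq_self {x : Fin N → ℋ} (hx : ∀ i ∈ I, x i = Ω) :
    vacuumProj Ω I (tensor x) = tensor x :=
  Submodule.starProjection_eq_self_iff.2
    (Submodule.le_topologicalClosure _ (Submodule.subset_span ⟨x, hx, rfl⟩))

/-- Replacing the factors at the sites in `I` by `Ω`. -/
def vacuumFill (Ω : ℋ) (I : Finset (Fin N)) (x : Fin N → ℋ) : Fin N → ℋ :=
  fun j => if j ∈ I then Ω else x j

theorem vacuumFill_of_mem (x : Fin N → ℋ) {j : Fin N} (hj : j ∈ I) : vacuumFill Ω I x j = Ω :=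
  if_pos hj

theorem vacuumFill_of_notMem (x : Fin N → ℋ) {j : Fin N} (hj : j ∉ I) :
    vacuumFill Ω I x j = x j :=
  if_neg hj

theorem vacuumProj_idem (Ω : ℋ) (I : Finset (Fin N)) (φ : Chain N ℋ) :
    vacuumProj Ω I (vacuumProj Ω I φ) = vacuumProj Ω I φ :=
  Submodule.starProjection_eq_self_iff.2 (Submodule.starProjection_apply_mem _ _)

theorem inner_self_of_norm_one (hΩ : ‖Ω‖ = 1) : ⟪Ω, Ω⟫_ℂ = 1 := by
  rw [inner_self_eq_norm_sq_to_K, hΩ]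
  simp

theorem vacuumProj_tensor (hΩ : ‖Ω‖ = 1) (I : Finset (Fin N)) (x : Fin N → ℋ) :
    vacuumProj Ω I (tensor x) = (∏ i ∈ I, ⟪Ω, x i⟫_ℂ) • tensor (vacuumFill Ω I x) := by
  have hmem : tensor (vacuumFill Ω I x) ∈ (Submodule.span ℂ {φ : Chain N ℋ |
      ∃ x : Fin N → ℋ, (∀ i ∈ I, x i = Ω) ∧ φ = tensor x}).topologicalClosure :=
    Submodule.le_topologicalClosure _
      (Submodule.subset_span ⟨_, fun i hi => vacuumFill_of_mem x hi, rfl⟩)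
  refine Submodule.eq_starProjection_of_mem_orthogonal (Submodule.smul_mem _ _ hmem) ?_
  rw [Submodule.orthogonal_closure, Submodule.mem_orthogonal]
  intro u hu
  induction hu using Submodule.span_induction with
  | mem u hu =>
    obtain ⟨y, hy, rfl⟩ := hu
    rw [inner_sub_right, inner_smul_right, inner_tensor, inner_tensor,
      ← Finset.prod_mul_prod_compl I, ← Finset.prod_mul_prod_compl I, ← mul_assoc,
      ← Finset.prod_mul_distrib, sub_eq_zero]
    congr 1
    · refine Finset.prod_congr rfl fun i hi => ?_
      rw [hy i hi, vacuumFill_of_mem x hi, inner_self_of_norm_one hΩ, mul_one]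
    · refine Finset.prod_congr rfl fun i hi => ?_
      rw [vacuumFill_of_notMem x (Finset.mem_compl.1 hi)]
  | zero => rw [inner_zero_left]
  | add u v _ _ hu hv => rw [inner_add_left, hu, hv, add_zero]
  | smul a v _ hv => rw [inner_smul_left, hv, mul_zero]

theorem vacuumProj_insert (hΩ : ‖Ω‖ = 1) {a : Fin N} (ha : a ∉ I) (φ : Chain N ℋ) :
    vacuumProj Ω (insert a I) φ = vacuumProj Ω I (vacuumProj Ω {a} φ) ∧
      vacuumProj Ω (insert a I) φ = vacuumProj Ω {a} (vacuumProj Ω I φ) := by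
  have h1 : vacuumProj Ω (insert a I) = (vacuumProj Ω I).comp (vacuumProj Ω {a}) := by
    refine clm_ext_tensor fun x => ?_
    rw [ContinuousLinearMap.comp_apply, vacuumProj_tensor hΩ, vacuumProj_tensor hΩ, map_smul,
      vacuumProj_tensor hΩ, smul_smul, Finset.prod_insert ha, Finset.prod_singleton]
    congr 2
    · refine Finset.prod_congr rfl fun i hi => ?_
      rw [vacuumFill_of_notMem x]
      rw [Finset.mem_singleton]
      rintro rfl
      exact ha hi
    · ext j
      unfold vacuumFill
      by_cases hj : j ∈ I <;> by_cases hj' : j = a <;> simp [hj, hj']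
  -- The other order follows by taking adjoints.
  have h2 : vacuumProj Ω (insert a I) = (vacuumProj Ω {a}).comp (vacuumProj Ω I) := by
    ext φ
    refine ext_inner_left ℂ fun ψ => ?_
    rw [← vacuumProj_inner, h1, ContinuousLinearMap.comp_apply, ContinuousLinearMap.comp_apply,
      vacuumProj_inner, vacuumProj_inner]
  exact ⟨by rw [h1]; rfl, by rw [h2]; rfl⟩

theorem vacuumProj_vacuumProj (hΩ : ‖Ω‖ = 1) (hIJ : I ⊆ J) (φ : Chain N ℋ) :
    vacuumProj Ω I (vacuumProj Ω J φ) = vacuumProj Ω J φ := by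
  have h1 : (vacuumProj Ω I).comp (vacuumProj Ω J) = vacuumProj Ω J := by
    refine clm_ext_tensor fun x => ?_
    rw [ContinuousLinearMap.comp_apply, vacuumProj_tensor hΩ, map_smul,
      vacuumProj_eq_self fun i hi => vacuumFill_of_mem x (hIJ hi)]
  rw [← ContinuousLinearMap.comp_apply, h1]

theorem norm_sq_sub_vacuumProj (Ω : ℋ) (I : Finset (Fin N)) (φ : Chain N ℋ) :
    ‖φ‖ ^ 2 - ‖vacuumProj Ω I φ‖ ^ 2 = ‖φ - vacuumProj Ω I φ‖ ^ 2 := by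
  have e := norm_add_sq (𝕜 := ℂ) (φ - vacuumProj Ω I φ) (vacuumProj Ω I φ)
  rw [sub_add_cancel, ← vacuumProj_inner, map_sub, vacuumProj_idem, sub_self, inner_zero_left,
    map_zero, mul_zero, add_zero] at e
  rw [e, add_sub_cancel_right]

theorem norm_vacuumProj_le (Ω : ℋ) (I : Finset (Fin N)) (φ : Chain N ℋ) :
    ‖vacuumProj Ω I φ‖ ≤ ‖φ‖ :=
  abs_le_of_sq_le_sq' (by
    have := norm_sq_sub_vacuumProj Ω I φ
    nlinarith [sq_nonneg ‖φ - vacuumProj Ω I φ‖]) (norm_nonneg _) |>.2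

/-- `1 - P_I ≤ ∑_{i ∈ I} (1 - P_i)` -/
theorem norm_sq_sub_vacuumProj_le_sum (hΩ : ‖Ω‖ = 1) (I : Finset (Fin N)) (φ : Chain N ℋ) :
    ‖φ‖ ^ 2 - ‖vacuumProj Ω I φ‖ ^ 2 ≤ ∑ i ∈ I, (‖φ‖ ^ 2 - ‖vacuumProj Ω {i} φ‖ ^ 2) := by
  induction I using Finset.induction_on with
  | empty =>
    have : vacuumProj Ω (∅ : Finset (Fin N)) = 1 := by
      refine clm_ext_tensor fun x => ?_
      rw [vacuumProj_eq_self (by simp)]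
      rfl
    simp [this]
  | insert a I ha ih =>
    rw [Finset.sum_insert ha]
    have h1 := norm_sq_sub_vacuumProj Ω {a} (vacuumProj Ω I φ)
    rw [← (vacuumProj_insert hΩ ha φ).2] at h1
    -- The left side is `‖P_I (φ - P_a φ)‖`, and `P_I` is a contraction.
    have h2 : ‖vacuumProj Ω I φ - vacuumProj Ω (insert a I) φ‖ ≤ ‖φ - vacuumProj Ω {a} φ‖ := by
      rw [(vacuumProj_insert hΩ ha φ).1, ← map_sub]
      exact norm_vacuumProj_le _ _ _
    have h3 := norm_sq_sub_vacuumProj Ω {a} φ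
    have h4 := pow_le_pow_left₀ (norm_nonneg _) h2 2
    linarith

/-- `H Ω = 0` kills every term on tensors filled with `Ω` on `I`; the graph is closed, so this
passes to the closed span. -/
theorem IsSiteHamiltonian.vacuumProj_mem_graph (h : IsSiteHamiltonian H Ω) (I : Finset (Fin N))
    (φ : Chain N ℋ) : (vacuumProj Ω I φ, (0 : Chain N ℋ)) ∈ (freeHamiltonian H I).graph := by
  rw [h.freeHamiltonian_graph]
  let L : Chain N ℋ →L[ℂ] Chain N ℋ × Chain N ℋ := ContinuousLinearMap.inl ℂ _ _
  have hΩ := extendZero_of_mem_graph h.vacuum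
  have hle : (Submodule.span ℂ {φ : Chain N ℋ |
      ∃ x : Fin N → ℋ, (∀ i ∈ I, x i = Ω) ∧ φ = tensor x}).topologicalClosure ≤
      ((coreGraph H I).topologicalClosure).comap (L : Chain N ℋ →ₗ[ℂ] _) := by
    refine Submodule.topologicalClosure_minimal _ (Submodule.span_le.2 ?_)
      ((Submodule.isClosed_topologicalClosure _).preimage L.continuous)
    rintro _ ⟨x, hx, rfl⟩
    refine Submodule.le_topologicalClosure _ (Submodule.subset_span
      ⟨⟨x, fun i hi => by rw [hx i hi]; exact hΩ.1⟩, Prod.ext rfl ?_⟩)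
    refine Finset.sum_eq_zero fun i hi => ?_
    change siteTensor H i x = 0
    unfold siteTensor
    rw [hx i hi, hΩ.2, tensor_update_zero]
  exact hle (Submodule.starProjection_apply_mem _ φ)

/-- `H⁰_I ≥ P⁺_I` -/
theorem IsSiteHamiltonian.norm_sq_sub_le_of_mem_graph (h : IsSiteHamiltonian H Ω)
    {p : Chain N ℋ × Chain N ℋ} (hp : p ∈ (freeHamiltonian H I).graph) :
    ‖p.1‖ ^ 2 - ‖vacuumProj Ω I p.1‖ ^ 2 ≤ (⟪p.1, p.2⟫_ℂ).re := by
  refine h.le_re_inner_of_core (f := fun φ => ‖φ‖ ^ 2 - ‖vacuumProj Ω I φ‖ ^ 2)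
    (by fun_prop) (fun c => ?_) hp
  refine (norm_sq_sub_vacuumProj_le_sum h.norm_vacuum I _).trans ?_
  rw [inner_sum, Complex.re_sum]
  refine Finset.sum_le_sum fun i hi => ?_
  -- `H - 1 + |Ω⟩⟨Ω| ≥ 0` at a single site; its action at site `i` is `H_i - 1 + P_i`.
  let S : H.domain →ₗ[ℂ] ℋ := H.toFun - H.domain.subtype +
    ((innerSL ℂ Ω : ℋ →ₗ[ℂ] ℂ).comp H.domain.subtype).smulRight Ω
  have hS : ∀ a, S a = H a - (a : ℋ) + ⟪Ω, (a : ℋ)⟫_ℂ • Ω := fun a => rfl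
  have h1 := re_inner_coreVector_nonneg hi S (fun a b => ?_) (fun a => ?_) c
  · have e : Finsupp.linearCombination ℂ (fun x : DomainFamily (N := N) H I =>
        tensor (Function.update x.1 i (S ⟨x.1 i, x.2 i hi⟩))) c =
        coreSite i c - coreVector c + vacuumProj Ω {i} (coreVector c) := by
      have e1 : ∀ x : DomainFamily (N := N) H I,
          tensor (Function.update x.1 i (S ⟨x.1 i, x.2 i hi⟩)) =
          siteTensor H i x.1 - tensor x.1 + vacuumProj Ω {i} (tensor x.1) := by
        intro x
        refine eq_of_inner_tensor fun y => ?_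
        rw [vacuumProj_tensor h.norm_vacuum, inner_add_right, inner_sub_right, inner_smul_right,
          siteTensor, inner_tensor_update, inner_tensor_update, hS, extendZero_of_mem (x.2 i hi),
          inner_tensor_erase y x.1 i, inner_tensor_erase y (vacuumFill Ω {i} x.1) i,
          inner_add_right, inner_sub_right, inner_smul_right,
          vacuumFill_of_mem x.1 (Finset.mem_singleton_self i), Finset.prod_singleton]
        have e2 : ∏ j ∈ Finset.univ.erase i, ⟪y j, vacuumFill Ω {i} x.1 j⟫_ℂ =
            ∏ j ∈ Finset.univ.erase i, ⟪y j, x.1 j⟫_ℂ := by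
          refine Finset.prod_congr rfl fun j hj => ?_
          rw [vacuumFill_of_notMem x.1]
          rw [Finset.mem_singleton]
          exact Finset.ne_of_mem_erase hj
        rw [e2]
        ring
      clear h1
      induction c using Finsupp.induction_linear with
      | zero => simp [coreVector, coreSite]
      | add f g hf hg =>
        rw [map_add, hf, hg]
        simp only [coreVector, coreSite, map_add]
        abel
      | single x a =>
        simp only [coreVector, coreSite, Finsupp.linearCombination_single, map_smul, e1, smul_add,
          smul_sub]
    rw [e, inner_add_right, inner_sub_right, Complex.add_re, Complex.sub_re] at h1
    have e3 : (⟪coreVector c, coreVector c⟫_ℂ).re = ‖coreVector c‖ ^ 2 :=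
      inner_self_eq_norm_sq (𝕜 := ℂ) (coreVector c)
    have e4 : (⟪coreVector c, vacuumProj Ω {i} (coreVector c)⟫_ℂ).re =
        ‖vacuumProj Ω {i} (coreVector c)‖ ^ 2 := by
      rw [← vacuumProj_idem, ← vacuumProj_inner, vacuumProj_idem]
      exact inner_self_eq_norm_sq (𝕜 := ℂ) _
    rw [e3, e4] at h1
    linarith
  · rw [hS, hS, inner_add_right, inner_sub_right, inner_add_left, inner_sub_left, h.symm,
      inner_smul_right, inner_smul_left, inner_conj_symm]
    ring
  · have h2 := h.norm_sq_sub_le a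
    have e3 : (⟪(a : ℋ), (a : ℋ)⟫_ℂ).re = ‖(a : ℋ)‖ ^ 2 := inner_self_eq_norm_sq (𝕜 := ℂ) _
    have e4 : ⟪Ω, (a : ℋ)⟫_ℂ * ⟪(a : ℋ), Ω⟫_ℂ = ((‖⟪Ω, (a : ℋ)⟫_ℂ‖ ^ 2 : ℝ) : ℂ) := by
      rw [← inner_conj_symm (a : ℋ) Ω, Complex.mul_conj, Complex.normSq_eq_norm_sq]
    rw [hS, inner_add_right, inner_sub_right, inner_smul_right, e4, Complex.add_re,
      Complex.sub_re, Complex.ofReal_re, e3]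
    linarith

end Vacuum

/-! ### The kinetic form -/

section Kinetic

variable {K : Type*} [NormedAddCommGroup K] [InnerProductSpace ℂ K] [CompleteSpace K]
  {A : K →ₗ.[ℂ] K}

theorem isSymmForm_kineticForm (h : ∃ R, IsInvSqrt A R) :
    IsSymmForm (formDomain A) (kineticForm A) := by
  refine ⟨?_, ?_, ?_⟩
  · intro φ hφ ψ hψ χ hχ
    obtain ⟨x, rfl⟩ := mem_formDomain_iff.1 hφ
    obtain ⟨y, rfl⟩ := mem_formDomain_iff.1 hψ
    obtain ⟨z, rfl⟩ := mem_formDomain_iff.1 hχ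
    rw [← map_add, kineticForm_invSqrt h, kineticForm_invSqrt h, kineticForm_invSqrt h, map_add,
      inner_add_right, inner_add_right]
    ring
  · intro φ hφ ψ hψ c
    obtain ⟨x, rfl⟩ := mem_formDomain_iff.1 hφ
    obtain ⟨y, rfl⟩ := mem_formDomain_iff.1 hψ
    rw [← map_smul, kineticForm_invSqrt h, kineticForm_invSqrt h, map_smul,
      inner_smul_right, inner_smul_right]
    ring
  · intro φ hφ ψ hψ
    obtain ⟨x, rfl⟩ := mem_formDomain_iff.1 hφ
    obtain ⟨y, rfl⟩ := mem_formDomain_iff.1 hψ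
    rw [kineticForm_invSqrt h, kineticForm_invSqrt h, star_sub, RCLike.star_def, inner_conj_symm,
      inner_conj_symm]

theorem re_kineticForm_invSqrt (h : ∃ R, IsInvSqrt A R) (x : K) :
    (kineticForm A (invSqrt A x) (invSqrt A x)).re = ‖x‖ ^ 2 - ‖invSqrt A x‖ ^ 2 := by
  rw [kineticForm_invSqrt h, Complex.sub_re]
  congr 1
  · exact inner_self_eq_norm_sq (𝕜 := ℂ) x
  · exact inner_self_eq_norm_sq (𝕜 := ℂ) (invSqrt A x)

end Kinetic

/-! ### Comparison of the free Hamiltonians of nested intervals. -/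

section Compare

variable {N : ℕ} {ℋ : Type*} [NormedAddCommGroup ℋ] [InnerProductSpace ℂ ℋ] [CompleteSpace ℋ]
  {H : ℋ →ₗ.[ℂ] ℋ} {Ω : ℋ} {I J : Finset (Fin N)}

namespace IsSiteHamiltonian

theorem norm_invSqrt_le (h : IsSiteHamiltonian H Ω) (I : Finset (Fin N)) (x : Chain N ℋ) :
    ‖invSqrt (freeHamiltonian H I) x‖ ≤ ‖x‖ :=
  (h.isInvSqrt_freeHamiltonian I).norm_le (fun _ hp => h.freeHamiltonian_nonneg hp) x

theorem exists_isInvSqrt (h : IsSiteHamiltonian H Ω) (I : Finset (Fin N)) :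
    ∃ R, IsInvSqrt (freeHamiltonian H I) R :=
  ⟨_, h.isInvSqrt_freeHamiltonian I⟩

/-- The unperturbed case. It makes the relations between `R` and `P` available for every set of
sites, not only for the large interval. -/
theorem isGappedPerturbation_kineticForm (h : IsSiteHamiltonian H Ω) (I : Finset (Fin N)) :
    IsGappedPerturbation (freeHamiltonian H I) (vacuumProj Ω I)
      (kineticForm (freeHamiltonian H I)) 0 := by
  have hR := h.isInvSqrt_freeHamiltonian I
  have hnn : ∀ p ∈ (freeHamiltonian H I).graph, 0 ≤ (⟪p.1, p.2⟫_ℂ).re :=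
    fun p hp => h.freeHamiltonian_nonneg hp
  have hRP : ∀ x, invSqrt (freeHamiltonian H I) (vacuumProj Ω I x) = vacuumProj Ω I x :=
    fun x => hR.apply_of_mem_graph_zero hnn (h.vacuumProj_mem_graph I x)
  have hPR : ∀ x, vacuumProj Ω I (invSqrt (freeHamiltonian H I) x) = vacuumProj Ω I x :=
    fun x => ext_inner_right ℂ fun y => by
      rw [vacuumProj_inner, hR.inner_left, hRP, ← vacuumProj_inner]
  refine ⟨hR, h.norm_invSqrt_le I, vacuumProj_inner Ω I, vacuumProj_idem Ω I, hRP, ?_,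
    isSymmForm_kineticForm ⟨_, hR⟩, by simp, fun x y => ?_, fun φ hφ ψ => ?_⟩
  · intro x hx
    refine hR.mul_norm_sq_le two_pos ?_
    have h1 := h.norm_sq_sub_le_of_mem_graph (hR.2 x)
    simp only [hPR, hx, norm_zero, inner_sub_right, Complex.sub_re] at h1
    have e : ∀ z : Chain N ℋ, (⟪z, z⟫_ℂ).re = ‖z‖ ^ 2 :=
      fun z => inner_self_eq_norm_sq (𝕜 := ℂ) z
    rw [e] at h1
    linarith
  · rw [kineticForm_invSqrt ⟨_, hR⟩, zero_mul, sub_zero, sub_self, norm_zero]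
    positivity
  · obtain ⟨x, rfl⟩ := mem_formDomain_iff.1 hφ
    rw [← hRP ψ, kineticForm_invSqrt ⟨_, hR⟩, hRP, hR.inner_left, hRP]
    simp

/-- Outside the form domain the value is the default 0, so no membership is required. -/
theorem re_kineticForm_nonneg (h : IsSiteHamiltonian H Ω) (I : Finset (Fin N)) (φ : Chain N ℋ) :
    0 ≤ (kineticForm (freeHamiltonian H I) φ φ).re := by
  by_cases hφ : φ ∈ formDomain (freeHamiltonian H I)
  · obtain ⟨x, rfl⟩ := mem_formDomain_iff.1 hφ
    rw [re_kineticForm_invSqrt (h.exists_isInvSqrt I), sub_nonneg]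
    exact pow_le_pow_left₀ (norm_nonneg _) (h.norm_invSqrt_le I x) 2
  · unfold kineticForm
    rw [dif_neg fun h => hφ h.1]
    simp

/-- The vector `(H⁰_I + 1)^{1/2} ∑ c_x x₁ ⊗ ⋯ ⊗ x_N`, as a linear function of `c`. -/
def coreRoot (H : ℋ →ₗ.[ℂ] ℋ) (I J : Finset (Fin N)) :
    (DomainFamily (N := N) H J →₀ ℂ) →ₗ[ℂ] Chain N ℋ :=
  (invSqrt (freeHamiltonian H I) : Chain N ℋ →ₗ[ℂ] Chain N ℋ) ∘ₗ
    (Finsupp.linearCombination ℂ (fun x : DomainFamily (N := N) H J => tensor x.1) +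
      ∑ i ∈ I, Finsupp.linearCombination ℂ (fun x : DomainFamily (N := N) H J =>
        siteTensor H i x.1))

theorem coreRoot_apply (c : DomainFamily (N := N) H J →₀ ℂ) :
    coreRoot H I J c =
      invSqrt (freeHamiltonian H I) (coreVector c + ∑ i ∈ I, coreSite i c) := by
  unfold coreRoot coreVector coreSite
  simp [LinearMap.sum_apply]

theorem invSqrt_coreRoot (h : IsSiteHamiltonian H Ω) (hIJ : I ⊆ J)
    (c : DomainFamily (N := N) H J →₀ ℂ) :
    invSqrt (freeHamiltonian H I) (coreRoot H I J c) = coreVector c := by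
  rw [coreRoot_apply]
  refine (h.isInvSqrt_freeHamiltonian I).apply_apply_add (fun _ hp => h.freeHamiltonian_nonneg hp)
    (p := (coreVector c, ∑ i ∈ I, coreSite i c)) ?_
  rw [h.freeHamiltonian_graph]
  exact Submodule.le_topologicalClosure _ (coreVector_mem hIJ c)

theorem norm_sq_coreRoot (h : IsSiteHamiltonian H Ω) (hIJ : I ⊆ J)
    (c : DomainFamily (N := N) H J →₀ ℂ) :
    ‖coreRoot H I J c‖ ^ 2 = ‖coreVector c‖ ^ 2 +
      ∑ i ∈ I, (⟪coreVector c, coreSite i c⟫_ℂ).re := by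
  have h1 := h.invSqrt_coreRoot hIJ c
  rw [coreRoot_apply] at h1 ⊢
  rw [(h.isInvSqrt_freeHamiltonian I).norm_sq_eq, h1, inner_add_right, Complex.add_re, inner_sum,
    Complex.re_sum]
  congr 1
  exact inner_self_eq_norm_sq (𝕜 := ℂ) (coreVector c)

theorem denseRange_coreRoot (h : IsSiteHamiltonian H Ω) (J : Finset (Fin N)) :
    DenseRange (coreRoot H J J) := by
  have h1 := (h.isInvSqrt_freeHamiltonian J).denseRange.dense_image
    (invSqrt (freeHamiltonian H J)).continuous (h.dense_core J)
  refine h1.mono ?_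
  rintro _ ⟨_, ⟨p, hp, rfl⟩, rfl⟩
  obtain ⟨c, rfl⟩ := exists_coreVector hp
  exact ⟨c, coreRoot_apply c⟩

/-- `(H⁰_I + 1)^{1/2} (H⁰_J + 1)^{-1/2}` is a contraction for `I ⊆ J`. -/
theorem exists_comparison (h : IsSiteHamiltonian H Ω) (hIJ : I ⊆ J) :
    ∃ L : Chain N ℋ →L[ℂ] Chain N ℋ, (∀ c, L (coreRoot H J J c) = coreRoot H I J c) ∧
      ∀ x, invSqrt (freeHamiltonian H I) (L x) = invSqrt (freeHamiltonian H J) x := by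
  -- Passing from `J` to `I` drops nonnegative site energies.
  have hb : ∀ c, ‖coreRoot H I J c‖ ≤ 1 * ‖coreRoot H J J c‖ := by
    intro c
    rw [one_mul]
    refine abs_le_of_sq_le_sq' ?_ (norm_nonneg _) |>.2
    rw [h.norm_sq_coreRoot hIJ, h.norm_sq_coreRoot subset_rfl]
    exact add_le_add_right (Finset.sum_le_sum_of_subset_of_nonneg hIJ
      fun i hi _ => h.re_inner_coreSite_nonneg hi c) _
  have hL : ∀ c, (coreRoot H I J).extendOfNorm (coreRoot H J J) (coreRoot H J J c) =
      coreRoot H I J c :=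
    fun c => LinearMap.extendOfNorm_eq (h.denseRange_coreRoot J) ⟨1, hb⟩ c
  refine ⟨_, hL, fun x => ?_⟩
  have h1 : (invSqrt (freeHamiltonian H I)).comp
      ((coreRoot H I J).extendOfNorm (coreRoot H J J)) = invSqrt (freeHamiltonian H J) := by
    refine ContinuousLinearMap.ext fun x => ?_
    refine congrFun ((h.denseRange_coreRoot J).equalizer (ContinuousLinearMap.continuous _)
      (ContinuousLinearMap.continuous _) (funext fun c => ?_)) x
    rw [Function.comp_apply, Function.comp_apply, ContinuousLinearMap.comp_apply, hL,
      h.invSqrt_coreRoot hIJ, h.invSqrt_coreRoot subset_rfl]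
  rw [← h1]
  rfl

theorem formDomain_anti (h : IsSiteHamiltonian H Ω) (hIJ : I ⊆ J) :
    formDomain (freeHamiltonian H J) ≤ formDomain (freeHamiltonian H I) := by
  intro φ hφ
  obtain ⟨x, rfl⟩ := mem_formDomain_iff.1 hφ
  obtain ⟨L, -, hL⟩ := h.exists_comparison hIJ
  rw [← hL]
  exact invSqrt_mem _

/-- If every site of `J` lies in at most `m` of the sets `I_a`, then `∑_a H⁰_{I_a} ≤ m H⁰_J`. -/
theorem sum_kineticForm_le (h : IsSiteHamiltonian H Ω) {ι : Type*} (s : Finset ι)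
    (I : ι → Finset (Fin N)) (hI : ∀ a ∈ s, I a ⊆ J) (m : ℕ)
    (hm : ∀ j ∈ J, (s.filter fun a => j ∈ I a).card ≤ m) {φ : Chain N ℋ}
    (hφ : φ ∈ formDomain (freeHamiltonian H J)) :
    ∑ a ∈ s, (kineticForm (freeHamiltonian H (I a)) φ φ).re ≤
      m * (kineticForm (freeHamiltonian H J) φ φ).re := by
  choose! L hL hL' using fun a (ha : a ∈ s) => h.exists_comparison (hI a ha)
  have key : ∀ x, ∑ a ∈ s, (‖L a x‖ ^ 2 - ‖invSqrt (freeHamiltonian H J) x‖ ^ 2) ≤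
      m * (‖x‖ ^ 2 - ‖invSqrt (freeHamiltonian H J) x‖ ^ 2) := by
    intro x
    have hcl : IsClosed {x | ∑ a ∈ s, (‖L a x‖ ^ 2 - ‖invSqrt (freeHamiltonian H J) x‖ ^ 2) ≤
        m * (‖x‖ ^ 2 - ‖invSqrt (freeHamiltonian H J) x‖ ^ 2)} :=
      isClosed_le (by fun_prop) (by fun_prop)
    refine (h.denseRange_coreRoot J).induction_on x hcl fun c => ?_
    have e : ∀ a ∈ s, ‖L a (coreRoot H J J c)‖ ^ 2 -
        ‖invSqrt (freeHamiltonian H J) (coreRoot H J J c)‖ ^ 2 =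
        ∑ j ∈ J, if j ∈ I a then (⟪coreVector c, coreSite j c⟫_ℂ).re else 0 := by
      intro a ha
      rw [hL a ha, h.norm_sq_coreRoot (hI a ha), h.invSqrt_coreRoot subset_rfl,
        add_sub_cancel_left, ← Finset.sum_filter, Finset.filter_mem_eq_inter,
        Finset.inter_eq_right.2 (hI a ha)]
    -- After exchanging the sums, the energy of site `j` appears once for each `I a` containing `j`.
    rw [Finset.sum_congr rfl e, Finset.sum_comm, h.norm_sq_coreRoot subset_rfl,
      h.invSqrt_coreRoot subset_rfl, add_sub_cancel_left, Finset.mul_sum]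
    refine Finset.sum_le_sum fun j hj => ?_
    rw [← Finset.sum_filter, Finset.sum_const, nsmul_eq_mul]
    exact mul_le_mul_of_nonneg_right (by exact_mod_cast hm j hj) (h.re_inner_coreSite_nonneg hj c)
  obtain ⟨x, rfl⟩ := mem_formDomain_iff.1 hφ
  rw [re_kineticForm_invSqrt (h.exists_isInvSqrt J)]
  refine le_trans (le_of_eq (Finset.sum_congr rfl fun a ha => ?_)) (key x)
  rw [← hL' a ha, re_kineticForm_invSqrt (h.exists_isInvSqrt (I a))]

end IsSiteHamiltonian

end Compare


/-! ### Block-diagonal potentials -/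

section Potentials

variable {N : ℕ} {ℋ : Type*} [NormedAddCommGroup ℋ] [InnerProductSpace ℂ ℋ] [CompleteSpace ℋ]
  {H : ℋ →ₗ.[ℂ] ℋ} {Ω : ℋ} {I J : Finset (Fin N)} {V : Form (Chain N ℋ)} {v : ℝ}

namespace IsSiteHamiltonian

theorem tensor_mem_formDomain (h : IsSiteHamiltonian H Ω) {x : Fin N → ℋ}
    (hx : ∀ i ∈ I, x i = Ω) : tensor x ∈ formDomain (freeHamiltonian H I) := by
  rw [← vacuumProj_eq_self hx]
  exact (h.isGappedPerturbation_kineticForm I).proj_mem _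

/-- Locality `v ⊗ 1` enters here: with `Ω` on all of `I`, the factor `v` is the vacuum expectation.
-/
theorem potential_tensor (h : IsSiteHamiltonian H Ω) (hV : IsPotential H I V) {x y : Fin N → ℋ}
    (hx : ∀ i ∈ I, x i = Ω) (hy : ∀ i ∈ I, y i = Ω) :
    V (tensor x) (tensor y) =
      V (tensor fun _ => Ω) (tensor fun _ => Ω) * ⟪tensor x, tensor y⟫_ℂ := by
  obtain ⟨w, hw⟩ := hV.support
  have hΩ : ∀ i ∈ I, (fun _ : Fin N => Ω) i = Ω := fun _ _ => rfl
  have hx' : (fun i : I => x i) = fun _ => Ω := funext fun i => hx i i.2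
  have hy' : (fun i : I => y i) = fun _ => Ω := funext fun i => hy i i.2
  have h1 := inner_self_of_norm_one h.norm_vacuum
  rw [hw _ _ (h.tensor_mem_formDomain hx) (h.tensor_mem_formDomain hy),
    hw _ _ (h.tensor_mem_formDomain hΩ) (h.tensor_mem_formDomain hΩ), hx', hy', inner_tensor,
    ← Finset.prod_mul_prod_compl I]
  have e1 : ∏ i ∈ I, ⟪x i, y i⟫_ℂ = 1 := Finset.prod_eq_one fun i hi => by
    rw [hx i hi, hy i hi, h1]
  have e2 : ∏ _j ∈ Iᶜ, ⟪Ω, Ω⟫_ℂ = 1 := Finset.prod_eq_one fun i _ => h1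
  rw [e1, e2, one_mul, mul_one]

/-- `P⁻_I V P⁻_I = ⟨V⟩ P⁻_I` -/
theorem potential_vacuumProj (h : IsSiteHamiltonian H Ω) (hV : IsPotential H I V)
    (hb : FormBound (freeHamiltonian H I) V v) (φ ψ : Chain N ℋ) :
    V (vacuumProj Ω I φ) (vacuumProj Ω I ψ) =
      V (tensor fun _ => Ω) (tensor fun _ => Ω) * ⟪vacuumProj Ω I φ, vacuumProj Ω I ψ⟫_ℂ := by
  have hG := h.isGappedPerturbation_kineticForm I
  obtain ⟨W, hW⟩ := hb.exists_operator hV.symmForm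
  set e := V (tensor fun _ => Ω) (tensor fun _ => Ω) with he
  set P := vacuumProj Ω I with hP
  have hWP : ∀ φ ψ, ⟪P φ, W (P ψ)⟫_ℂ = V (P φ) (P ψ) := fun φ ψ => by
    rw [hW, hG.invSqrt_proj, hG.invSqrt_proj]
  -- A bounded operator is determined by its matrix elements between pure tensors, where the
  -- previous lemma applies.
  have key : P.comp ((W - e • (1 : Chain N ℋ →L[ℂ] Chain N ℋ)).comp P) = 0 := by
    refine clm_ext_tensor fun y => eq_of_inner_tensor fun x => ?_
    rw [ContinuousLinearMap.comp_apply, ContinuousLinearMap.comp_apply, ← vacuumProj_inner,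
      zero_apply, inner_zero_right, sub_apply, smul_apply, one_apply_eq_self, inner_sub_right,
      inner_smul_right, hWP, hP, vacuumProj_tensor h.norm_vacuum, vacuumProj_tensor h.norm_vacuum]
    have hx := h.tensor_mem_formDomain (I := I) (x := vacuumFill Ω I x)
      fun i hi => vacuumFill_of_mem x hi
    have hy := h.tensor_mem_formDomain (I := I) (x := vacuumFill Ω I y)
      fun i hi => vacuumFill_of_mem y hi
    rw [hV.symmForm.smul_left hx (Submodule.smul_mem _ _ hy), hV.symmForm.smul_right _ hx _ hy,
      h.potential_tensor hV (fun i hi => vacuumFill_of_mem x hi)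
        (fun i hi => vacuumFill_of_mem y hi), inner_smul_left, inner_smul_right, RCLike.star_def]
    ring
  have h1 : ⟪φ, P.comp ((W - e • (1 : Chain N ℋ →L[ℂ] Chain N ℋ)).comp P) ψ⟫_ℂ = 0 := by
    rw [key, zero_apply, inner_zero_right]
  rw [ContinuousLinearMap.comp_apply, ContinuousLinearMap.comp_apply, ← vacuumProj_inner,
    sub_apply, smul_apply, one_apply_eq_self, inner_sub_right, inner_smul_right, hWP] at h1
  exact sub_eq_zero.1 h1

/-- The vacuum of `J` lies in the vacuum of `I ⊆ J`, so only the `P⁻` block of `V` acts, and there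
`V` is a number. -/
theorem potential_vacuum (h : IsSiteHamiltonian H Ω) (hV : IsPotential H I V)
    (hb : FormBound (freeHamiltonian H I) V v) (hd : IsBlockDiagonal H Ω I V) (hIJ : I ⊆ J)
    {φ : Chain N ℋ} (hφ : φ ∈ formDomain (freeHamiltonian H I)) (ψ : Chain N ℋ) :
    V φ (vacuumProj Ω J ψ) =
      V (tensor fun _ => Ω) (tensor fun _ => Ω) * ⟪φ, vacuumProj Ω J ψ⟫_ℂ := by
  have hG := h.isGappedPerturbation_kineticForm I
  have e1 := vacuumProj_vacuumProj h.norm_vacuum hIJ ψ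
  rw [← e1]
  set χ := vacuumProj Ω J ψ
  have hφ' := Submodule.sub_mem _ hφ (hG.proj_mem φ)
  have h0 : V (φ - vacuumProj Ω I φ) 0 = 0 := by
    have := hV.symmForm.smul_right _ hφ' _ hφ 0
    rwa [zero_smul, zero_mul] at this
  rw [hd _ hφ _ (hG.proj_mem χ)]
  unfold diagPart
  rw [vacuumProj_idem, sub_self, h0, zero_add, h.potential_vacuumProj hV hb, vacuumProj_inner,
    vacuumProj_idem]

theorem norm_vacuum_expectation_le (h : IsSiteHamiltonian H Ω)
    (hb : FormBound (freeHamiltonian H I) V v) :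
    ‖V (tensor fun _ => Ω) (tensor fun _ => Ω)‖ ≤ v := by
  have hG := h.isGappedPerturbation_kineticForm I
  have h1 := hb (tensor fun _ => Ω) (tensor fun _ => Ω)
  have e : vacuumProj Ω I (tensor fun _ => Ω) = tensor fun _ => Ω :=
    vacuumProj_eq_self fun _ _ => rfl
  have e2 : ‖(tensor fun _ => Ω : Chain N ℋ)‖ = 1 := by
    rw [← Real.sqrt_sq (norm_nonneg (tensor _)), ← inner_self_eq_norm_sq (𝕜 := ℂ), inner_tensor,
      Finset.prod_eq_one fun _ _ => inner_self_of_norm_one h.norm_vacuum]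
    simp
  rw [← e, hG.invSqrt_proj, e, e2] at h1
  simpa using h1

/-- `|V - ⟨V⟩| ≤ 3 ‖V‖ H⁰_I` for a block-diagonal potential `V`. -/
theorem norm_potential_sub_le (h : IsSiteHamiltonian H Ω) (hV : IsPotential H I V) (hv : 0 ≤ v)
    (hb : FormBound (freeHamiltonian H I) V v) (hd : IsBlockDiagonal H Ω I V) {φ ψ : Chain N ℋ}
    (hφ : φ ∈ formDomain (freeHamiltonian H I)) (hψ : ψ ∈ formDomain (freeHamiltonian H I)) :
    ‖V φ ψ - V (tensor fun _ => Ω) (tensor fun _ => Ω) * ⟪φ, ψ⟫_ℂ‖ ≤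
      3 * v * (√(kineticForm (freeHamiltonian H I) φ φ).re *
        √(kineticForm (freeHamiltonian H I) ψ ψ).re) := by
  have hG := h.isGappedPerturbation_kineticForm I
  set e := V (tensor fun _ => Ω) (tensor fun _ => Ω) with he
  have hen : ‖e‖ ≤ v := h.norm_vacuum_expectation_le hb
  obtain ⟨a, rfl⟩ := mem_formDomain_iff.1 hφ
  obtain ⟨b, rfl⟩ := mem_formDomain_iff.1 hψ
  set A := freeHamiltonian H I with hA
  set P := vacuumProj Ω I with hP
  have hin : ⟪invSqrt A a, invSqrt A b⟫_ℂ = ⟪invSqrt A (a - P a), invSqrt A (b - P b)⟫_ℂ +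
      ⟪P (invSqrt A a), P (invSqrt A b)⟫_ℂ := by
    rw [hG.invSqrt_sub_proj, hG.invSqrt_sub_proj, inner_sub_right, hG.inner_proj_sub, sub_zero,
      inner_sub_left, ← hG.proj_inner, hG.proj_idem, sub_add_cancel]
  -- The `P⁻` blocks of `V` and of `⟨V⟩` cancel.
  have hsp : V (invSqrt A a) (invSqrt A b) - e * ⟪invSqrt A a, invSqrt A b⟫_ℂ =
      V (invSqrt A (a - P a)) (invSqrt A (b - P b)) -
        e * ⟪invSqrt A (a - P a), invSqrt A (b - P b)⟫_ℂ := by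
    rw [hd _ hφ _ hψ, hin]
    unfold diagPart
    rw [h.potential_vacuumProj hV hb, hG.invSqrt_sub_proj, hG.invSqrt_sub_proj]
    ring
  -- The vacuum component carries no kinetic energy, and on the rest `‖R c‖² ≤ ‖c‖² / 2`.
  have hk : ∀ c : Chain N ℋ, ‖c - P c‖ ^ 2 ≤
      2 * (kineticForm A (invSqrt A c) (invSqrt A c)).re := by
    intro c
    rw [re_kineticForm_invSqrt (h.exists_isInvSqrt I)]
    have h1 := hG.norm_sq_split c
    have h2 := hG.norm_sq_split (invSqrt A c)
    rw [← hG.invSqrt_sub_proj, hG.proj_invSqrt] at h2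
    have h3 := hG.gap _ (hG.proj_sub c)
    linarith
  have hR : ∀ c : Chain N ℋ, ‖invSqrt A (c - P c)‖ ≤ ‖c - P c‖ * √(1 / 2) := by
    intro c
    refine abs_le_of_sq_le_sq' ?_ (by positivity) |>.2
    rw [mul_pow, Real.sq_sqrt (by norm_num)]
    have h3 := hG.gap _ (hG.proj_sub c)
    linarith
  have hk' : ∀ c : Chain N ℋ, ‖c - P c‖ ≤
      √2 * √(kineticForm A (invSqrt A c) (invSqrt A c)).re := by
    intro c
    rw [← Real.sqrt_mul (by norm_num)]
    exact Real.le_sqrt_of_sq_le (hk c)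
  rw [hsp]
  -- `3/2 = 1 + 1/2`: the form `V`, plus `⟨V⟩` with a factor `√(1/2)` from each `R`. The kinetic
  -- energies bring another factor 2.
  have h1 : ‖V (invSqrt A (a - P a)) (invSqrt A (b - P b)) -
      e * ⟪invSqrt A (a - P a), invSqrt A (b - P b)⟫_ℂ‖ ≤
      3 / 2 * v * (‖a - P a‖ * ‖b - P b‖) := by
    refine (norm_sub_le _ _).trans ?_
    have h2 := hb (a - P a) (b - P b)
    have h3 : ‖e * ⟪invSqrt A (a - P a), invSqrt A (b - P b)⟫_ℂ‖ ≤
        v * ((‖a - P a‖ * √(1 / 2)) * (‖b - P b‖ * √(1 / 2))) := by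
      rw [norm_mul]
      exact mul_le_mul hen ((norm_inner_le_norm _ _).trans
        (mul_le_mul (hR a) (hR b) (norm_nonneg _) (by positivity))) (norm_nonneg _) hv
    have h4 : √(1 / 2 : ℝ) * √(1 / 2) = 1 / 2 := Real.mul_self_sqrt (by norm_num)
    have h5 : v * ((‖a - P a‖ * √(1 / 2)) * (‖b - P b‖ * √(1 / 2))) =
        v * (‖a - P a‖ * ‖b - P b‖) * (√(1 / 2) * √(1 / 2)) := by ring
    rw [h5, h4] at h3
    linarith
  refine h1.trans ?_
  have h2 := mul_le_mul (hk' a) (hk' b) (norm_nonneg _) (by positivity)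
  have h3 : √(2 : ℝ) * √2 = 2 := Real.mul_self_sqrt (by norm_num)
  calc 3 / 2 * v * (‖a - P a‖ * ‖b - P b‖)
      ≤ 3 / 2 * v * ((√2 * √(kineticForm A (invSqrt A a) (invSqrt A a)).re) *
        (√2 * √(kineticForm A (invSqrt A b) (invSqrt A b)).re)) := by gcongr
    _ = 3 / 2 * v * (√2 * √2) * (√(kineticForm A (invSqrt A a) (invSqrt A a)).re *
        √(kineticForm A (invSqrt A b) (invSqrt A b)).re) := by ring
    _ = _ := by rw [h3]; ring

end IsSiteHamiltonian

end Potentials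

/-! ### The local Hamiltonians -/

section Local

variable {N : ℕ} {ℋ : Type*} [NormedAddCommGroup ℋ] [InnerProductSpace ℂ ℋ] [CompleteSpace ℋ]
  {H : ℋ →ₗ.[ℂ] ℋ} {Ω : ℋ}

theorem interval_subset {k q r i : ℕ} (hq : q ≤ i) (hi : i + r ≤ q + k) :
    interval N r i ⊆ interval N k q := by
  intro s hs
  simp only [interval, Finset.mem_filter, Finset.mem_univ, true_and] at hs ⊢
  omega

theorem card_interval_containing_le (s : Finset ℕ) (r : ℕ) (j : Fin N) :
    (s.filter fun i => j ∈ interval N r i).card ≤ r + 1 := by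
  have h1 : (s.filter fun i => j ∈ interval N r i) ⊆
      Finset.Icc ((j : ℕ) + 1 - r) ((j : ℕ) + 1) := by
    intro i hi
    simp only [interval, Finset.mem_filter, Finset.mem_univ, true_and] at hi
    rw [Finset.mem_Icc]
    omega
  refine (Finset.card_le_card h1).trans ?_
  rw [Nat.card_Icc]
  omega

theorem rpow_le_half_pow {t : ℝ} (ht : 0 < t) (ht' : t < 1 / 128) {r : ℕ} (hr : 1 ≤ r) :
    t ^ (((r : ℝ) - 1) / 4) ≤ (1 / 2) ^ (r - 1) := by
  have h1 : t ^ (1 / 4 : ℝ) ≤ 1 / 2 := by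
    have h2 : t ^ (1 / 4 : ℝ) ≤ ((1 / 2 : ℝ) ^ (4 : ℝ)) ^ (1 / 4 : ℝ) :=
      Real.rpow_le_rpow ht.le (by norm_num; linarith) (by norm_num)
    rwa [← Real.rpow_mul (by norm_num), show (4 : ℝ) * (1 / 4) = 1 by norm_num,
      Real.rpow_one] at h2
  have h3 : ((r : ℝ) - 1) / 4 = 1 / 4 * ((r - 1 : ℕ) : ℝ) := by
    rw [Nat.cast_sub hr]
    push_cast
    ring
  rw [h3, Real.rpow_mul ht.le, Real.rpow_natCast]
  exact pow_le_pow_left₀ (Real.rpow_nonneg ht.le _) h1 _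

/-- At most `r + 1` overlapping intervals against the decay in `r`; the closed form is `6 - (2n + 6)
/ 2^n`. -/
theorem sum_succ_mul_half_pow_le (n : ℕ) :
    ∑ r ∈ Finset.Icc 1 n, ((r : ℝ) + 1) * (1 / 2) ^ (r - 1) ≤ 6 := by
  have key : ∑ r ∈ Finset.Icc 1 n, ((r : ℝ) + 1) * (1 / 2) ^ (r - 1) =
      6 - (2 * n + 6) * (1 / 2) ^ n := by
    induction n with
    | zero => norm_num
    | succ n ih =>
      rw [← Finset.insert_Icc_right_eq_Icc_add_one (by omega), Finset.sum_insert (by simp), ih,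
        Nat.add_sub_cancel, pow_succ]
      push_cast
      ring
  rw [key]
  have : (0 : ℝ) ≤ (2 * n + 6) * (1 / 2) ^ n := by positivity
  linarith

variable {k q : ℕ} {t : ℝ} {V : ℕ → ℕ → Form (Chain N ℋ)}

/-- For each `r` the deviations `V - ⟨V⟩` are summed over `i` with Cauchy–Schwarz, and overlaps are
counted by `card_interval_containing_le`. This makes the bound independent of the length of the
chain. -/
theorem isGappedPerturbation_localForm (h : IsSiteHamiltonian H Ω) (ht : 0 < t)
    (ht' : t < 1 / 128)
    (hV : ∀ r i, 1 ≤ r → q ≤ i → i + r ≤ q + k → IsPotential H (interval N r i) (V r i))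
    (hd : ∀ r i, 1 ≤ r → r < k → q ≤ i → i + r ≤ q + k →
      IsBlockDiagonal H Ω (interval N r i) (V r i))
    (hn : ∀ r i, 1 ≤ r → q ≤ i → i + r ≤ q + k →
      weightedNorm (freeHamiltonian H (interval N r i)) (V r i)
        ≤ ENNReal.ofReal (t ^ (((r : ℝ) - 1) / 4))) :
    IsGappedPerturbation (freeHamiltonian H (interval N k q)) (vacuumProj Ω (interval N k q))
      (localForm H t V k q) (vacuumEnergy Ω t V k q) := by
  have hG := h.isGappedPerturbation_kineticForm (interval N k q)
  set A := freeHamiltonian H (interval N k q) with hA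
  set e : ℕ → ℕ → ℂ := fun r i => V r i (tensor fun _ => Ω) (tensor fun _ => Ω) with he
  have hidx : ∀ r ∈ Finset.Icc 1 (k - 1), ∀ i ∈ Finset.Icc q (q + k - r),
      1 ≤ r ∧ r < k ∧ q ≤ i ∧ i + r ≤ q + k := by
    intro r hr i hi
    rw [Finset.mem_Icc] at hr hi
    omega
  have hle : ∀ r ∈ Finset.Icc 1 (k - 1), ∀ i ∈ Finset.Icc q (q + k - r),
      formDomain A ≤ formDomain (freeHamiltonian H (interval N r i)) := by
    intro r hr i hi
    obtain ⟨h1, h2, h3, h4⟩ := hidx r hr i hi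
    exact h.formDomain_anti (interval_subset h3 h4)
  have hpow : ∀ r : ℕ, 0 ≤ t ^ (((r : ℝ) - 1) / 4) := fun r => Real.rpow_nonneg ht.le _
  have hVb : ∀ r ∈ Finset.Icc 1 (k - 1), ∀ i ∈ Finset.Icc q (q + k - r),
      FormBound (freeHamiltonian H (interval N r i)) (V r i) (t ^ (((r : ℝ) - 1) / 4)) := by
    intro r hr i hi
    obtain ⟨h1, h2, h3, h4⟩ := hidx r hr i hi
    exact (hV r i h1 h3 h4).symmForm.formBound_of_weightedNorm_le (hpow r) (hn r i h1 h3 h4)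
  have hsum_symm : IsSymmForm (formDomain A) (fun φ ψ => (t : ℂ) *
      ∑ r ∈ Finset.Icc 1 (k - 1), ∑ i ∈ Finset.Icc q (q + k - r), V r i φ ψ) := by
    refine IsSymmForm.smul (IsSymmForm.sum _ fun r hr => IsSymmForm.sum _ fun i hi => ?_)
      (Complex.conj_ofReal t)
    obtain ⟨h1, h2, h3, h4⟩ := hidx r hr i hi
    exact (hV r i h1 h3 h4).symmForm.mono (hle r hr i hi)
  refine ⟨hG.isInvSqrt, hG.norm_le, hG.proj_inner, hG.proj_idem, hG.invSqrt_proj, hG.gap,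
    hG.symm.add hsum_symm, ?_, fun x y => ?_, fun φ hφ ψ => ?_⟩
  · unfold vacuumEnergy
    rw [star_mul', star_sum, RCLike.star_def, Complex.conj_ofReal]
    congr 1
    refine Finset.sum_congr rfl fun r hr => ?_
    rw [map_sum]
    refine Finset.sum_congr rfl fun i hi => ?_
    obtain ⟨h1, h2, h3, h4⟩ := hidx r hr i hi
    have hm := h.tensor_mem_formDomain (I := interval N r i) (x := fun _ => Ω) fun _ _ => rfl
    exact ((hV r i h1 h3 h4).symmForm.symm _ hm _ hm).symm
  · set φ := invSqrt A x with hφ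
    set ψ := invSqrt A y with hψ
    have hφm : φ ∈ formDomain A := invSqrt_mem x
    have hψm : ψ ∈ formDomain A := invSqrt_mem y
    have e1 : localForm H t V k q φ ψ - vacuumEnergy Ω t V k q * ⟪φ, ψ⟫_ℂ -
        (⟪x, y⟫_ℂ - ⟪φ, ψ⟫_ℂ) = t * ∑ r ∈ Finset.Icc 1 (k - 1),
          ∑ i ∈ Finset.Icc q (q + k - r), (V r i φ ψ - e r i * ⟪φ, ψ⟫_ℂ) := by
      unfold localForm vacuumEnergy
      rw [← hA, hφ, hψ, kineticForm_invSqrt (h.exists_isInvSqrt _)]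
      simp only [Finset.sum_sub_distrib, ← Finset.sum_mul, he]
      ring
    set ax := (kineticForm A φ φ).re with hax
    set ay := (kineticForm A ψ ψ).re with hay
    have hinner : ∀ r ∈ Finset.Icc 1 (k - 1), ‖∑ i ∈ Finset.Icc q (q + k - r),
        (V r i φ ψ - e r i * ⟪φ, ψ⟫_ℂ)‖ ≤
        3 * (((r : ℝ) + 1) * (1 / 2) ^ (r - 1)) * (√ax * √ay) := by
      intro r hr
      set f : ℕ → ℝ := fun i => (kineticForm (freeHamiltonian H (interval N r i)) φ φ).re with hf
      set g : ℕ → ℝ := fun i => (kineticForm (freeHamiltonian H (interval N r i)) ψ ψ).re with hg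
      have h1 : ‖∑ i ∈ Finset.Icc q (q + k - r), (V r i φ ψ - e r i * ⟪φ, ψ⟫_ℂ)‖ ≤
          ∑ i ∈ Finset.Icc q (q + k - r),
            3 * t ^ (((r : ℝ) - 1) / 4) * (√(f i) * √(g i)) := by
        refine norm_sum_le_of_le _ fun i hi => ?_
        obtain ⟨h1, h2, h3, h4⟩ := hidx r hr i hi
        exact h.norm_potential_sub_le (hV r i h1 h3 h4) (hpow r) (hVb r hr i hi)
          (hd r i h1 h2 h3 h4) (hle r hr i hi hφm) (hle r hr i hi hψm)
      have hsub : ∀ i ∈ Finset.Icc q (q + k - r), interval N r i ⊆ interval N k q := by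
        intro i hi
        obtain ⟨h1, h2, h3, h4⟩ := hidx r hr i hi
        exact interval_subset h3 h4
      have hfs : ∀ χ ∈ formDomain A, ∑ i ∈ Finset.Icc q (q + k - r),
          (kineticForm (freeHamiltonian H (interval N r i)) χ χ).re ≤
          ((r : ℝ) + 1) * (kineticForm A χ χ).re := by
        intro χ hχ
        have := h.sum_kineticForm_le (Finset.Icc q (q + k - r)) (fun i => interval N r i) hsub
          (r + 1) (fun j _ => card_interval_containing_le _ r j) hχ
        push_cast at this
        exact this
      have h2 : ∑ i ∈ Finset.Icc q (q + k - r), √(f i) * √(g i) ≤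
          ((r : ℝ) + 1) * (√ax * √ay) := by
        -- Each of the two square roots contributes a factor `√(r + 1)`.
        refine (Real.sum_sqrt_mul_sqrt_le _ (fun i => h.re_kineticForm_nonneg _ _)
          fun i => h.re_kineticForm_nonneg _ _).trans ?_
        refine (mul_le_mul (Real.sqrt_le_sqrt (hfs φ hφm)) (Real.sqrt_le_sqrt (hfs ψ hψm))
          (Real.sqrt_nonneg _) (Real.sqrt_nonneg _)).trans_eq ?_
        rw [Real.sqrt_mul (by positivity), Real.sqrt_mul (by positivity)]
        have h5 : √((r : ℝ) + 1) * √((r : ℝ) + 1) = (r : ℝ) + 1 :=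
          Real.mul_self_sqrt (by positivity)
        linear_combination (√ax * √ay) * h5
      rw [← Finset.mul_sum] at h1
      refine h1.trans ?_
      have h3 := rpow_le_half_pow ht ht' (r := r) (Finset.mem_Icc.1 hr).1
      calc 3 * t ^ (((r : ℝ) - 1) / 4) * ∑ i ∈ Finset.Icc q (q + k - r), √(f i) * √(g i)
          ≤ 3 * (1 / 2) ^ (r - 1) * (((r : ℝ) + 1) * (√ax * √ay)) := by
            refine mul_le_mul (by linarith) h2 (Finset.sum_nonneg fun i _ => by positivity)
              (by positivity)
        _ = _ := by ring
    have hbd : ∀ z : Chain N ℋ, √(kineticForm A (invSqrt A z) (invSqrt A z)).re ≤ ‖z‖ := by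
      intro z
      rw [re_kineticForm_invSqrt (h.exists_isInvSqrt _)]
      refine Real.sqrt_le_left (norm_nonneg _) |>.2 ?_
      nlinarith [sq_nonneg ‖invSqrt A z‖]
    rw [e1, norm_mul, Complex.norm_real, Real.norm_eq_abs, abs_of_pos ht]
    -- `18 = 3 · 6`; multiplied by `t < 1/128` it stays below `1/4`.
    have h2 : ‖∑ r ∈ Finset.Icc 1 (k - 1), ∑ i ∈ Finset.Icc q (q + k - r),
        (V r i φ ψ - e r i * ⟪φ, ψ⟫_ℂ)‖ ≤ 18 * (‖x‖ * ‖y‖) := by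
      refine (norm_sum_le_of_le _ hinner).trans ?_
      rw [← Finset.sum_mul, ← Finset.mul_sum]
      have h3 := sum_succ_mul_half_pow_le (k - 1)
      have h4 : √ax * √ay ≤ ‖x‖ * ‖y‖ :=
        mul_le_mul (hbd x) (hbd y) (Real.sqrt_nonneg _) (norm_nonneg _)
      exact mul_le_mul (by linarith) h4 (by positivity) (by norm_num)
    have h3 := mul_le_mul_of_nonneg_left h2 ht.le
    have h4 : 0 ≤ ‖x‖ * ‖y‖ := by positivity
    nlinarith
  · unfold localForm vacuumEnergy
    rw [hG.vacuum φ hφ ψ, zero_mul, zero_add, mul_assoc, Finset.sum_mul]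
    congr 1
    refine Finset.sum_congr rfl fun r hr => ?_
    rw [Finset.sum_mul]
    refine Finset.sum_congr rfl fun i hi => ?_
    obtain ⟨h1, h2, h3, h4⟩ := hidx r hr i hi
    exact h.potential_vacuum (hV r i h1 h3 h4) (hVb r hr i hi) (hd r i h1 h2 h3 h4)
      (interval_subset h3 h4) (hle r hr i hi hφ) ψ

end Local

end QuantumChain

end

/-! ### Assembly of the final estimates. -/

theorem lemmaA4 :
    ∃ t₀ A B : ℝ, 0 < t₀ ∧ 0 < A ∧ 0 < B ∧
    ∀ (ℋ : Type*) [NormedAddCommGroup ℋ] [InnerProductSpace ℂ ℋ] [CompleteSpace ℋ]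
      [TopologicalSpace.SeparableSpace ℋ]
      (H : ℋ →ₗ.[ℂ] ℋ) (Ω : ℋ) (_ : IsSiteHamiltonian H Ω)
      (N k q : ℕ) (_ : 1 ≤ k) (_ : 1 ≤ q) (_ : q + k ≤ N)
      (t : ℝ) (_ : 0 < t) (_ : t < t₀)
      (V : ℕ → ℕ → Form (Chain N ℋ))
      (_ : ∀ r i, 1 ≤ r → q ≤ i → i + r ≤ q + k →
        IsPotential H (interval N r i) (V r i))
      (_ : ∀ r i, 1 ≤ r → r < k → q ≤ i → i + r ≤ q + k →
        IsBlockDiagonal H Ω (interval N r i) (V r i))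
      (_ : ∀ r i, 1 ≤ r → q ≤ i → i + r ≤ q + k →
        weightedNorm (freeHamiltonian H (interval N r i)) (V r i)
          ≤ ENNReal.ofReal (t ^ (((r : ℝ) - 1) / 4)))
      (_ : HasGap H Ω t V k q (1 / 2)),
      let H₀ : Chain N ℋ →ₗ.[ℂ] Chain N ℋ := freeHamiltonian H (interval N k q)
      let P : Chain N ℋ →L[ℂ] Chain N ℋ := vacuumProj Ω (interval N k q)
      let g : Form (Chain N ℋ) := localForm H t V k q
      let E : ℂ := vacuumEnergy Ω t V k q
      let Sj : ℕ → Chain N ℋ →L[ℂ] Chain N ℋ := lieS H₀ P g E (V k q)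
      let Vj : ℕ → Form (Chain N ℋ) := lieV H₀ P g E (V k q)
      let S : Chain N ℋ →L[ℂ] Chain N ℋ := lieSeries H₀ P g E (V k q) t
      let V' : Form (Chain N ℋ) := diagSeries H₀ P g E (V k q) t
      -- all the terms of the two series are well defined
      (∀ j, 1 ≤ j → IsSymmForm (formDomain H₀) (Vj j) ∧ weightedNorm H₀ (Vj j) < ⊤ ∧
        ∃! T : Chain N ℋ →L[ℂ] Chain N ℋ, IsOffDiagSolution H₀ P g E (Vj j) T) ∧
      -- the series defining `S` converges absolutely in operator norm
      (Summable fun j : ℕ => ‖(t : ℂ) ^ (j + 1) • Sj (j + 1)‖) ∧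
      -- the series defining the new potential converges absolutely in the weighted norm,
      -- with sum `V'`
      (∑' j : ℕ, ENNReal.ofReal (t ^ j) * weightedNorm H₀ (diagPart P (Vj (j + 1))) < ⊤) ∧
      Tendsto (fun n => weightedNorm H₀
        (V' - diagPartialSum H₀ P g E (V k q) t n)) atTop (𝓝 0) ∧
      IsSymmForm (formDomain H₀) V' ∧
      -- the bounds
      weightedNorm H₀ V' ≤ 2 * weightedNorm H₀ (V k q) ∧
      ‖S‖ₑ ≤ ENNReal.ofReal (A * t) * weightedNorm H₀ (V k q) ∧
      ∃ T T' : Chain N ℋ →L[ℂ] Chain N ℋ,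
        -- `T = (H₀ + 1)^{1/2} S`, and `T'` is the bounded extension of `S (H₀ + 1)^{1/2}`
        (∀ ψ, ∃ h : S ψ ∈ (sqrtOp H₀).domain, T ψ = sqrtOp H₀ ⟨S ψ, h⟩) ∧
        (∀ ψ : (sqrtOp H₀).domain, T' ψ = S (sqrtOp H₀ ψ)) ∧
        ‖T'‖ = ‖T‖ ∧
        ‖T‖ₑ ≤ ENNReal.ofReal (B * t) * weightedNorm H₀ (V k q) := by
  -- `1/128` closes the induction in `sum_pow_mul_le`; `16 = 8 · 2` combines the generator bound `8
  -- ‖V_j‖` with the sum bound `2 t ‖V‖`.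
  refine ⟨1 / 128, 16, 16, by norm_num, by norm_num, by norm_num, ?_⟩
  intro ℋ _ _ _ _ H Ω hH N k q hk hq _ t ht ht' V hV hd hn _ H₀ P g E Sj Vj S V'
  have hG : IsGappedPerturbation H₀ P g E :=
    isGappedPerturbation_localForm hH ht ht' hV hd hn
  have hsymm : IsSymmForm (formDomain H₀) (V k q) := (hV k q hk le_rfl (by omega)).symmForm
  -- The exponent `(k - 1) / 4` is nonnegative and `t < 1`.
  have hnorm : weightedNorm H₀ (V k q) ≤ 1 := by
    refine (hn k q hk le_rfl (by omega)).trans ?_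
    rw [← ENNReal.ofReal_one]
    refine ENNReal.ofReal_le_ofReal (Real.rpow_le_one ht.le (by linarith) ?_)
    have : (1 : ℝ) ≤ k := by exact_mod_cast hk
    linarith
  obtain ⟨h1, h2, h3, h4⟩ := hG.diagSeries_spec hsymm hnorm ht ht'
  obtain ⟨h5, h6, h7⟩ := hG.lieSeries_spec hsymm hnorm ht ht'
  refine ⟨fun j hj => ?_, h5, h1, h2, h3, h4, h6, h7⟩
  have hVj := hG.isBoundedForm_lieV hsymm (hnorm.trans_lt ENNReal.one_lt_top) hj
  exact ⟨hVj.symm, hVj.toReal.1, hG.existsUnique_offDiagSolution hVj.symm hVj.bound hVj.nonneg⟩
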